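/- For positive integers $r_1,\dots,r_k$ and integers $s_1,\dots,s_k\ge 0$ let $T((r_1,s_1),\dots,(r_k,s_k))$ denote the link that is the closure of the positive braid $$(\sigma_1\sigma_2\cdots\sigma_{r_1-1})^{s_1}(\sigma_1\sigma_2\cdots\sigma_{r_2-1})^{s_2}\cdots(\sigma_1\sigma_2\cdots\sigma_{r_k-1})^{s_k}$$ on $\max_i r_i$ strands (a T-link; a pair with $s_i=0$ contributes no crossings). Here $\sigma_i$ are the standard generators of the braid group, and two links are equivalent if they are ambient isotopic in $\mathbb R^3$. Let $n,m\ge 0$ and let $r_1,\dots,r_n,s_1,\dots,s_n,u_1,\dots,u_m,v_1,\dots,v_m,p,q$ be positive integers such that $2\le r_1<\dots<r_n<p$, $2\le u_1<\dots<u_m\le p$ and $p\le q$. Let $V((u_1,\overline{v_1}),\dots,(u_m,\overline{v_m}),(r_1,s_1),\dots,(r_n,s_n),(p,q))$ denote the V-link, that is, the closure of the braid $$(\sigma_{p-1}\sigma_{p-2}\cdots\sigma_{p-u_1+1})^{v_1}\cdots(\sigma_{p-1}\sigma_{p-2}\cdots\sigma_{p-u_m+1})^{v_m}(\sigma_1\cdots\sigma_{r_1-1})^{s_1}\cdots(\sigma_1\cdots\sigma_{r_n-1})^{s_n}(\sigma_1\cdots\sigma_{p-1})^{q}$$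 on $p$ strands. Then the T-links $$T\big((r_1,s_1),\dots,(r_n,s_n),(p,q-u_m),(p+v_m,u_m-u_{m-1}),(p+v_m+v_{m-1},u_{m-1}-u_{m-2}),\dots,(p+v_m+\dots+v_2,u_2-u_1),(p+v_m+\dots+v_1,u_1)\big)$$ and $$T\big((u_1,v_1),\dots,(u_m,v_m),(q,p-r_n),(q+s_n,r_n-r_{n-1}),(q+s_n+s_{n-1},r_{n-1}-r_{n-2}),\dots,(q+s_n+\dots+s_2,r_2-r_1),(q+s_n+\dots+s_1,r_1)\big)$$ are equivalent, and both are equivalent to the V-link $V((u_1,\overline{v_1}),\dots,(u_m,\overline{v_m}),(r_1,s_1),\dots,(r_n,s_n),(p,q))$. If $m=0$, the first T-link is read as $T((r_1,s_1),\dots,(r_n,s_n),(p,q))$; if $n=0$, the second one is read as $T((u_1,v_1),\dots,(u_m,v_m),(q,p))$. -/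

import Mathlib

/-- Three-dimensional space `ℝ³`, in cylindrical form: a point is `(z, h)` with `z` in the
horizontal plane `ℂ = ℝ²` and `h` the height. -/
abbrev Space : Type := ℂ × ℝ

/-- Two links, given as subsets of `ℝ³`, are equivalent when they are ambient isotopic: there is a
jointly continuous family of homeomorphisms `H t` of `ℝ³`, `0 ≤ t ≤ 1`, which starts at the
identity and whose end map carries the first link onto the second one. -/
def LinkEquiv (L L' : Set Space) : Prop :=
  ∃ H : unitInterval → (Space ≃ₜ Space),
    Continuous (fun x : unitInterval × Space => H x.1 x.2) ∧
    H 0 = Homeomorph.refl Space ∧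
    H 1 '' L = L'

/-- The cross-section at time `a ∈ [0, 1]` of an elementary braid on `N` strands, as a subset of the
half-plane with coordinates (distance to the braid axis, height). The strands sit at
`(1, 0), …, (N, 0)`. For `none` (trivial braid) they do not move. For `some i` with `1 ≤ i < N`
(the generator `σ_i`) the strands in positions `i` and `i + 1` exchange their places by a half-turn
about the midpoint, and all the others stay where they are. -/
noncomputable def letterSection (N : ℕ) : Option ℕ → ℝ → Set (ℝ × ℝ)
  | none, _ => {c | ∃ j : ℕ, 1 ≤ j ∧ j ≤ N ∧ c = ((j : ℝ), 0)}
  | some i, a =>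
      {c | ∃ j : ℕ, 1 ≤ j ∧ j ≤ N ∧ j ≠ i ∧ j ≠ i + 1 ∧ c = ((j : ℝ), 0)} ∪
      {((i : ℝ) + 1 / 2 + Real.cos (Real.pi * a) / 2, -(Real.sin (Real.pi * a) / 2)),
       ((i : ℝ) + 1 / 2 - Real.cos (Real.pi * a) / 2, Real.sin (Real.pi * a) / 2)}

/-- The closure of the positive braid `σ_{w₀} σ_{w₁} ⋯ σ_{w_{ℓ-1}}` on `N` strands, where
`w = [w₀, …, w_{ℓ-1}]` has entries in `{1, …, N - 1}`, as a subset of `ℝ³`. The braid is wrapped once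
around the vertical axis: at angle `2πt`, `0 ≤ t ≤ 1`, one sees the cross-section of the braid at
time `ℓt`, the letter `w_k` being performed during the times `k ≤ ℓt ≤ k + 1`.
For the empty word these are `N` concentric circles. -/
noncomputable def closedBraid (N : ℕ) (w : List ℕ) : Set Space :=
  {P | ∃ t ∈ Set.Icc (0 : ℝ) 1,
    ∃ c ∈ letterSection N (w[⌊w.length * t⌋₊]?) (w.length * t - ⌊w.length * t⌋₊),
      P = ((c.1 : ℂ) * Complex.exp (2 * Real.pi * t * Complex.I), c.2)}

/-- The `s`-th power of a braid word. -/
def wordPow (w : List ℕ) (s : ℕ) : List ℕ := (List.replicate s w).flatten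

/-- The braid word `σ_1 σ_2 ⋯ σ_{r-1}`. -/
def ascWord (r : ℕ) : List ℕ := List.range' 1 (r - 1)

/-- The braid word `σ_{p-1} σ_{p-2} ⋯ σ_{p-u+1}`, for `1 ≤ u ≤ p`. -/
def descWord (p u : ℕ) : List ℕ := (List.range' (p - u + 1) (u - 1)).reverse

/-- The braid word `(σ_1 ⋯ σ_{r_1-1})^{s_1} ⋯ (σ_1 ⋯ σ_{r_k-1})^{s_k}` of the list
`[(r_1, s_1), …, (r_k, s_k)]`. -/
def tWord (L : List (ℕ × ℕ)) : List ℕ := L.flatMap fun x => wordPow (ascWord x.1) x.2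

/-- The T-link `T((r_1, s_1), …, (r_k, s_k))`: the closure of the braid above; its number of strands
is the largest of the `r_i`. -/
noncomputable def TLink (L : List (ℕ × ℕ)) : Set Space :=
  closedBraid ((L.map Prod.fst).foldr max 0) (tWord L)

/-- The V-link `V((u_1, v̄_1), …, (u_m, v̄_m), (r_1, s_1), …, (r_n, s_n), (p, q))`, with
`U = [(u_1, v_1), …, (u_m, v_m)]` and `R = [(r_1, s_1), …, (r_n, s_n)]`: the closure of the braid
`(σ_{p-1} ⋯ σ_{p-u_1+1})^{v_1} ⋯ (σ_{p-1} ⋯ σ_{p-u_m+1})^{v_m}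
(σ_1 ⋯ σ_{r_1-1})^{s_1} ⋯ (σ_1 ⋯ σ_{r_n-1})^{s_n} (σ_1 ⋯ σ_{p-1})^q` on `p` strands. -/
noncomputable def VLink (U R : List (ℕ × ℕ)) (p q : ℕ) : Set Space :=
  closedBraid p
    ((U.flatMap fun x => wordPow (descWord p x.1) x.2) ++ tWord R ++ wordPow (ascWord p) q)

/-- The tail of parameters attached to `(p, q)` and a list of pairs. For
`[(u_m, v_m), (u_{m-1}, v_{m-1}), …, (u_1, v_1)]` (largest `u` first) it is
`[(p, q - u_m), (p + v_m, u_m - u_{m-1}), (p + v_m + v_{m-1}, u_{m-1} - u_{m-2}), …,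
(p + v_m + ⋯ + v_2, u_2 - u_1), (p + v_m + ⋯ + v_1, u_1)]`, and for `[]` it is `[(p, q)]`. -/
def dualTail : ℕ → ℕ → List (ℕ × ℕ) → List (ℕ × ℕ)
  | p, q, [] => [(p, q)]
  | p, q, (u, v) :: l => (p, q - u) :: dualTail (p + v) u l

open Set Filter Topology NNReal

/-! Write A_p = σ_1⋯σ_{p-1} and D_{p,u} = σ_{p-1}⋯σ_{p-u+1}. The combinatorial heart is `asc_pow`:
A_{P+1}^u = A_P^u D_{P+1,u+1} for u ≤ P. Here D_{P+1,u+1} = σ_P D_{P,u}, and moving this factor to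
the right past blocks D_{P+1,x} with x ≤ u lowers them to D_{P,x}. The generator σ_P then occurs
only once, so Markov destabilization removes it: one outer strand is traded for one factor D_{P,u}
(`closedBraid_destabilize_asc`). Removing in this way v_1 strands, then v_2, and so on up to v_m,
turns the first T-link into the closure on p strands of a conjugate of the V-braid.

The second T-link is treated alike, down to q strands and then from q to p with u = p. What remains
carries A_p^p D_{p,p}^{q-p} and has the roles of left and right exchanged. A half-turn replaces σ_i
by σ_{p-i} and so interchanges A_p and D_{p,p}. Since D_{p,p}^p = A_p^p is the central full twist
(`desc_pow_self`, `commute_fullTwist`), the V-braid appears.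

The topological input is that braid relations, conjugation, the half-turn and destabilization are
ambient isotopies of the given subsets of ℝ³. Isotopy extension is done by Lipschitz estimates: a
small Lipschitz displacement of a link extends to all of space, and identity plus a contraction is a
homeomorphism. This yields `linkEquiv_of_arc_homotopy` for embedded regular arcs, and
`linkEquiv_pieceLink` for straight-line homotopies of closed braids. Braid relations follow from
`linkEquiv_of_isLayered`: if strands can be stacked in layers, only their permutation matters.
Destabilization (`linkEquiv_kinkWord`) tilts the innermost loop until its height is monotone, then
contracts it inside a cylinder which the other strands do not enter. -/

/-! ### Ambient isotopy as an equivalence relation -/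

theorem LinkEquiv.refl (L : Set Space) : LinkEquiv L L :=
  ⟨fun _ => Homeomorph.refl Space, continuous_snd, rfl, by simp⟩

theorem LinkEquiv.symm {L L' : Set Space} (h : LinkEquiv L L') : LinkEquiv L' L := by
  obtain ⟨H, hc, h0, h1⟩ := h
  -- Running time backwards after the fixed inverse of the end map avoids any question of continuity
  -- of the inverses in the time parameter.
  refine ⟨fun t => (H 1).symm.trans (H (unitInterval.symm t)), ?_, ?_, ?_⟩
  · have : Continuous fun x : unitInterval × Space =>
        ((unitInterval.symm x.1, (H 1).symm x.2) : unitInterval × Space) := by fun_prop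
    exact hc.comp this
  · ext x <;> simp
  · subst h1
    rw [Set.image_image]
    simp [h0]

theorem LinkEquiv.trans {L L' L'' : Set Space} (h : LinkEquiv L L') (h' : LinkEquiv L' L'') :
    LinkEquiv L L'' := by
  obtain ⟨H, hc, h0, h1⟩ := h
  obtain ⟨G, gc, g0, g1⟩ := h'
  refine ⟨fun t => (H t).trans (G t), ?_, ?_, ?_⟩
  · exact gc.comp (continuous_fst.prodMk hc)
  · simp only [h0, g0]; rfl
  · rw [← g1, ← h1, Set.image_image]; rfl

/-! ### Isotopy extension by Lipschitz estimates -/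

/-- A map close to the identity in the Lipschitz seminorm moves a link by an ambient isotopy. -/
theorem exists_pos_linkEquiv_of_lipschitz_close : ∃ ε : ℝ, 0 < ε ∧
    ∀ (X : Type) (S : Set X) (f g : X → Space),
      (∀ x ∈ S, ∀ y ∈ S, ‖(g x - f x) - (g y - f y)‖ ≤ ε * ‖f x - f y‖) →
      LinkEquiv (f '' S) (g '' S) := by
  set C : ℝ≥0 := lipschitzExtensionConstant Space with hC
  have hCpos : 0 < C := lipschitzExtensionConstant_pos Space
  -- Extension to the whole space multiplies the Lipschitz constant by at most C, so the extended
  -- displacement has constant 1/2.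
  refine ⟨(((2 * C)⁻¹ : ℝ≥0) : ℝ), by positivity, fun X S f g h => ?_⟩
  classical
  -- The displacement g - f as a function of the point f x. It does not depend on the chosen
  -- preimage: the hypothesis for f x = f y forces equal displacements.
  set D : Space → Space := fun P =>
    if hP : ∃ x ∈ S, f x = P then g hP.choose - f hP.choose else 0 with hD
  have hDf : ∀ x ∈ S, D (f x) = g x - f x := by
    intro x hx
    have hP : ∃ y ∈ S, f y = f x := ⟨x, hx, rfl⟩
    simp only [hD, dif_pos hP]
    have h1 := h _ hP.choose_spec.1 x hx
    rw [hP.choose_spec.2, sub_self, norm_zero, mul_zero] at h1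
    have h2 := sub_eq_zero.1 (norm_le_zero_iff.1 h1)
    rw [← h2, hP.choose_spec.2]
  have hL : LipschitzOnWith (2 * C)⁻¹ D (f '' S) := by
    refine LipschitzOnWith.of_dist_le_mul ?_
    rintro _ ⟨x, hx, rfl⟩ _ ⟨y, hy, rfl⟩
    rw [hDf x hx, hDf y hy, dist_eq_norm, dist_eq_norm]
    exact h x hx y hy
  obtain ⟨G, hG, hDG⟩ := hL.extend_finite_dimension
  have hG2 : LipschitzWith (1 / 2) G := by
    have h2 : C * (2 * C)⁻¹ = 1 / 2 := by
      rw [mul_inv]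
      field_simp
    rw [← hC, h2] at hG
    exact hG
  -- Identity plus a map with Lipschitz constant below 1 is a homeomorphism, for every t.
  have happ : ∀ t : unitInterval, ApproximatesLinearOn (fun P => P + (t : ℝ) • G P)
      ((ContinuousLinearEquiv.refl ℝ Space : Space ≃L[ℝ] Space) : Space →L[ℝ] Space) univ
      (1 / 2) := by
    intro t x _ y _
    have h1 := hG2.dist_le_mul x y
    rw [dist_eq_norm, dist_eq_norm] at h1
    have h2 : x + (t : ℝ) • G x - (y + (t : ℝ) • G y)
        - ((ContinuousLinearEquiv.refl ℝ Space : Space ≃L[ℝ] Space) : Space →L[ℝ] Space) (x - y)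
        = (t : ℝ) • (G x - G y) := by
      simp only [ContinuousLinearEquiv.coe_refl, ContinuousLinearMap.coe_id', id, smul_sub]
      abel
    rw [h2, norm_smul, Real.norm_of_nonneg t.2.1]
    calc (t : ℝ) * ‖G x - G y‖ ≤ 1 * ‖G x - G y‖ := by
          gcongr; exact t.2.2
      _ ≤ _ := by rw [one_mul]; exact h1
  have hlt : Subsingleton Space ∨ ((1 / 2 : ℝ≥0)) <
      ‖((ContinuousLinearEquiv.refl ℝ Space).symm : Space →L[ℝ] Space)‖₊⁻¹ := by
    right
    have : ‖((ContinuousLinearEquiv.refl ℝ Space).symm : Space →L[ℝ] Space)‖₊ = 1 := by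
      ext
      exact ContinuousLinearMap.norm_id
    rw [this, inv_one]
    exact NNReal.half_lt_self one_ne_zero
  refine ⟨fun t => (happ t).toHomeomorph _ hlt, ?_, ?_, ?_⟩
  · change Continuous fun x : unitInterval × Space => x.2 + (x.1 : ℝ) • G x.2
    have := hG.continuous
    fun_prop
  · ext x
    · change (x + ((0 : unitInterval) : ℝ) • G x).1 = x.1
      simp
    · change (x + ((0 : unitInterval) : ℝ) • G x).2 = x.2
      simp
  · change (fun x => x + ((1 : unitInterval) : ℝ) • G x) '' _ = _
    rw [Set.image_image]
    refine Set.image_congr fun x hx => ?_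
    rw [← hDG (mem_image_of_mem f hx), hDf x hx]
    simp

/-- A homotopy whose increments are Lipschitz with respect to the moving link, with constant
proportional to the elapsed time, is realised by an ambient isotopy. -/
theorem linkEquiv_of_lipschitz_homotopy {X : Type} (S : Set X) (φ : ℝ → X → Space) (C : ℝ)
    (h : ∀ s ∈ Icc (0 : ℝ) 1, ∀ s' ∈ Icc (0 : ℝ) 1, ∀ x ∈ S, ∀ y ∈ S,
      ‖(φ s' x - φ s x) - (φ s' y - φ s y)‖ ≤ C * |s' - s| * ‖φ s x - φ s y‖) :
    LinkEquiv (φ 0 '' S) (φ 1 '' S) := by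
  obtain ⟨ε, hε, H⟩ := exists_pos_linkEquiv_of_lipschitz_close
  -- Over n equal steps each increment has constant C / n ≤ ε, so every step is realised by the
  -- previous lemma.
  obtain ⟨n, hn⟩ := exists_nat_gt (max 1 (C / ε))
  have hn1 : (1 : ℝ) < n := lt_of_le_of_lt (le_max_left _ _) hn
  have hn0 : (0 : ℝ) < n := by linarith
  have hnC : C / n ≤ ε := by
    rw [div_le_iff₀ hn0]
    have := (le_max_right 1 (C / ε)).trans hn.le
    rw [div_le_iff₀ hε] at this
    linarith
  have key : ∀ k : ℕ, k ≤ n → LinkEquiv (φ 0 '' S) (φ ((k : ℝ) / n) '' S) := by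
    intro k
    induction k with
    | zero => intro _; simpa using LinkEquiv.refl _
    | succ k ih =>
      intro hk
      refine (ih (by omega)).trans (H X S _ _ fun x hx y hy => ?_)
      have hk' : ((k + 1 : ℕ) : ℝ) ≤ n := by exact_mod_cast hk
      have h1 : ((k : ℝ) / n) ∈ Icc (0 : ℝ) 1 :=
        ⟨by positivity, (div_le_one hn0).2 (by push_cast at hk'; linarith)⟩
      have h2 : (((k + 1 : ℕ) : ℝ) / n) ∈ Icc (0 : ℝ) 1 :=
        ⟨by positivity, (div_le_one hn0).2 hk'⟩
      refine (h _ h1 _ h2 x hx y hy).trans ?_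
      gcongr
      have h3 : ((k + 1 : ℕ) : ℝ) / n - (k : ℝ) / n = 1 / n := by
        push_cast; ring
      rw [h3, abs_of_pos (by positivity)]
      calc C * (1 / n) = C / n := by ring
        _ ≤ ε := hnC
  have := key n le_rfl
  rwa [div_self hn0.ne'] at this

/-- The two increments between times `s` and `s'` differ by at most `C |s' - s|` times the distance
of the two points at time `s`. -/
def IncrementBound (A B : ℝ → ℝ → Space) (C s a b : ℝ) : Prop :=
  ∀ s' ∈ Icc (0 : ℝ) 1, ‖(A s' a - A s a) - (B s' b - B s b)‖ ≤ C * |s' - s| * ‖A s a - B s b‖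

theorem IncrementBound.mono {A B : ℝ → ℝ → Space} {C C' s a b : ℝ}
    (h : IncrementBound A B C s a b) (hC : C ≤ C') : IncrementBound A B C' s a b := by
  intro s' hs'
  refine (h s' hs').trans ?_
  gcongr

theorem IncrementBound.swap {A B : ℝ → ℝ → Space} {C s a b : ℝ}
    (h : IncrementBound A B C s a b) : IncrementBound B A C s b a := by
  intro s' hs'
  have := h s' hs'
  rwa [norm_sub_rev, norm_sub_rev (B s b)]

theorem deriv_slice {A : ℝ → ℝ → Space} (hA : ContDiff ℝ 2 fun p : ℝ × ℝ => A p.1 p.2) (s a : ℝ) :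
    HasDerivAt (A s) (fderiv ℝ (fun p : ℝ × ℝ => A p.1 p.2) (s, a) (0, 1)) a := by
  have h1 : HasFDerivAt (fun p : ℝ × ℝ => A p.1 p.2)
      (fderiv ℝ (fun p : ℝ × ℝ => A p.1 p.2) (s, a)) (s, a) :=
    ((hA.differentiable (by norm_num)) (s, a)).hasFDerivAt
  have h2 : HasDerivAt (fun b : ℝ => (s, b)) ((0 : ℝ), (1 : ℝ)) a :=
    (hasDerivAt_const a s).prodMk (hasDerivAt_id a)
  exact h1.comp_hasDerivAt a h2

theorem continuous_deriv_slice {A : ℝ → ℝ → Space}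
    (hA : ContDiff ℝ 2 fun p : ℝ × ℝ => A p.1 p.2) :
    Continuous fun p : ℝ × ℝ => deriv (A p.1) p.2 := by
  have : (fun p : ℝ × ℝ => deriv (A p.1) p.2) =
      fun p => fderiv ℝ (fun p : ℝ × ℝ => A p.1 p.2) p (0, 1) := by
    ext1 p
    exact (deriv_slice hA p.1 p.2).deriv
  rw [this]
  exact (hA.continuous_fderiv (by norm_num)).clm_apply continuous_const

theorem isCompact_unitSquare : IsCompact (Icc (0 : ℝ) 1 ×ˢ Icc (0 : ℝ) 1) :=
  isCompact_Icc.prod isCompact_Icc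

theorem exists_lipschitz_slice {A : ℝ → ℝ → Space}
    (hA : ContDiff ℝ 2 fun p : ℝ × ℝ => A p.1 p.2) :
    ∃ C : ℝ, 0 ≤ C ∧ ∀ s ∈ Icc (0 : ℝ) 1, ∀ s' ∈ Icc (0 : ℝ) 1, ∀ a ∈ Icc (0 : ℝ) 1,
      ‖A s' a - A s a‖ ≤ C * |s' - s| := by
  obtain ⟨K, hK⟩ := ((hA.of_le (by norm_num)).locallyLipschitz.locallyLipschitzOn
    (s := Icc (0 : ℝ) 1 ×ˢ Icc (0 : ℝ) 1)).exists_lipschitzOnWith_of_compact isCompact_unitSquare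
  refine ⟨K, K.2, fun s hs s' hs' a ha => ?_⟩
  have := hK.dist_le_mul (s', a) ⟨hs', ha⟩ (s, a) ⟨hs, ha⟩
  rw [dist_eq_norm] at this
  refine this.trans_eq ?_
  simp [Prod.dist_eq, Real.dist_eq]

/-- The derivative along the arc is C¹, hence Lipschitz in s on the compact square; the mean value
inequality along the arc then bounds the double difference. This is why arcs are required to be C².
-/
theorem exists_mixed_lipschitz {A : ℝ → ℝ → Space}
    (hA : ContDiff ℝ 2 fun p : ℝ × ℝ => A p.1 p.2) :
    ∃ C : ℝ, 0 ≤ C ∧ ∀ s ∈ Icc (0 : ℝ) 1, ∀ s' ∈ Icc (0 : ℝ) 1, ∀ a ∈ Icc (0 : ℝ) 1,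
      ∀ b ∈ Icc (0 : ℝ) 1, ‖(A s' a - A s a) - (A s' b - A s b)‖ ≤ C * |s' - s| * |a - b| := by
  have h1 : ContDiff ℝ 1 fun p : ℝ × ℝ => fderiv ℝ (fun p : ℝ × ℝ => A p.1 p.2) p (0, 1) :=
    (hA.fderiv_right (m := 1) (by norm_num)).clm_apply contDiff_const
  obtain ⟨K, hK⟩ := (h1.locallyLipschitz.locallyLipschitzOn
    (s := Icc (0 : ℝ) 1 ×ˢ Icc (0 : ℝ) 1)).exists_lipschitzOnWith_of_compact isCompact_unitSquare
  refine ⟨K, K.2, fun s hs s' hs' a ha b hb => ?_⟩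
  have hd : ∀ x ∈ Icc (0 : ℝ) 1, HasDerivWithinAt (fun x => A s' x - A s x)
      (fderiv ℝ (fun p : ℝ × ℝ => A p.1 p.2) (s', x) (0, 1)
        - fderiv ℝ (fun p : ℝ × ℝ => A p.1 p.2) (s, x) (0, 1)) (Icc 0 1) x := fun x _ =>
    ((deriv_slice hA s' x).sub (deriv_slice hA s x)).hasDerivWithinAt
  have hb' : ∀ x ∈ Icc (0 : ℝ) 1, ‖fderiv ℝ (fun p : ℝ × ℝ => A p.1 p.2) (s', x) (0, 1)
        - fderiv ℝ (fun p : ℝ × ℝ => A p.1 p.2) (s, x) (0, 1)‖ ≤ K * |s' - s| := by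
    intro x hx
    have := hK.dist_le_mul (s', x) ⟨hs', hx⟩ (s, x) ⟨hs, hx⟩
    rw [dist_eq_norm] at this
    refine this.trans_eq ?_
    simp [Prod.dist_eq, Real.dist_eq]
  have := (convex_Icc (0 : ℝ) 1).norm_image_sub_le_of_norm_hasDerivWithin_le hd hb' hb ha
  rwa [Real.norm_eq_abs] at this

/-- By continuity the derivative of f along nearby arcs stays above half its value at the centre,
and the mean value inequality integrates this bound. It serves to bound distances on the link from
below. -/
theorem eventually_mul_sub_le {A : ℝ → ℝ → Space}
    (hA : ContDiff ℝ 2 fun p : ℝ × ℝ => A p.1 p.2) (f : Space →L[ℝ] ℝ) {s₀ a₀ : ℝ}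
    (hf : 0 < f (deriv (A s₀) a₀)) : ∃ c > 0, ∃ r > 0, ∀ s ∈ Metric.ball s₀ r,
      ∀ a ∈ Metric.ball a₀ r, ∀ b ∈ Metric.ball a₀ r, a ≤ b →
        c * (b - a) ≤ f (A s b) - f (A s a) := by
  have hc : Continuous fun p : ℝ × ℝ => f (deriv (A p.1) p.2) :=
    f.continuous.comp (continuous_deriv_slice hA)
  set c := f (deriv (A s₀) a₀) / 2 with hcdef
  have hev : ∀ᶠ p : ℝ × ℝ in 𝓝 (s₀, a₀), c < f (deriv (A p.1) p.2) :=
    hc.continuousAt.eventually_const_lt (by simp only [hcdef]; linarith)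
  obtain ⟨r, hr, hball⟩ := Metric.eventually_nhds_iff_ball.1 hev
  refine ⟨c, by positivity, r, hr, fun s hs a ha b hb hab => ?_⟩
  have hdf : ∀ x, HasDerivAt (fun x => f (A s x)) (f (deriv (A s) x)) x := fun x =>
    f.hasFDerivAt.comp_hasDerivAt x
      ((deriv_slice hA s x).differentiableAt.hasDerivAt)
  refine (convex_ball a₀ r).mul_sub_le_image_sub_of_le_deriv
    (fun x _ => (hdf x).continuousAt.continuousWithinAt)
    (fun x _ => (hdf x).differentiableAt.differentiableWithinAt) (fun x hx => ?_) a ha b hb hab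
  rw [(hdf x).deriv]
  refine (hball (s, x) ?_).le
  rw [← ball_prod_same]
  exact ⟨hs, interior_subset hx⟩

theorem eventually_ball_triple {s₀ a₀ b₀ r : ℝ} (hr : 0 < r) :
    ∀ᶠ q : ℝ × ℝ × ℝ in 𝓝 (s₀, a₀, b₀), q.1 ∈ Metric.ball s₀ r ∧ q.2.1 ∈ Metric.ball a₀ r ∧
      q.2.2 ∈ Metric.ball b₀ r := by
  refine ((continuous_fst.tendsto _).eventually (Metric.ball_mem_nhds _ hr)).and
    ((((continuous_fst.comp continuous_snd).tendsto _).eventually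
      (Metric.ball_mem_nhds _ hr)).and
    (((continuous_snd.comp continuous_snd).tendsto _).eventually
      (Metric.ball_mem_nhds _ hr)))

/-- `IncrementBound` holds with a uniform constant near a given triple of parameters. -/
def LocalIncrementBound (A B : ℝ → ℝ → Space) (q₀ : ℝ × ℝ × ℝ) : Prop :=
  ∃ C : ℝ, ∀ᶠ q : ℝ × ℝ × ℝ in 𝓝 q₀, q.1 ∈ Icc (0 : ℝ) 1 → q.2.1 ∈ Icc (0 : ℝ) 1 →
    q.2.2 ∈ Icc (0 : ℝ) 1 → IncrementBound A B C q.1 q.2.1 q.2.2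

theorem LocalIncrementBound.swap {A B : ℝ → ℝ → Space} {s a b : ℝ}
    (h : LocalIncrementBound A B (s, a, b)) : LocalIncrementBound B A (s, b, a) := by
  obtain ⟨C, hC⟩ := h
  refine ⟨C, ?_⟩
  have hcont : Continuous fun q : ℝ × ℝ × ℝ => (q.1, q.2.2, q.2.1) := by fun_prop
  have := (hcont.tendsto (s, b, a)).eventually hC
  filter_upwards [this] with q hq h1 h2 h3
  exact (hq h1 h3 h2).swap

/-- The distance of the two points stays bounded below nearby, while each increment is O(|s' - s|).
-/
theorem localIncrementBound_of_ne {A B : ℝ → ℝ → Space}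
    (hA : ContDiff ℝ 2 fun p : ℝ × ℝ => A p.1 p.2) (hB : ContDiff ℝ 2 fun p : ℝ × ℝ => B p.1 p.2)
    {s₀ a₀ b₀ : ℝ} (hne : A s₀ a₀ ≠ B s₀ b₀) : LocalIncrementBound A B (s₀, a₀, b₀) := by
  obtain ⟨CA, hCA, hA1⟩ := exists_lipschitz_slice hA
  obtain ⟨CB, hCB, hB1⟩ := exists_lipschitz_slice hB
  have hc1 := hA.continuous
  have hc2 := hB.continuous
  have hc : Continuous fun q : ℝ × ℝ × ℝ => ‖A q.1 q.2.1 - B q.1 q.2.2‖ := by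
    have h1 : Continuous fun q : ℝ × ℝ × ℝ => A q.1 q.2.1 :=
      hc1.comp (by fun_prop : Continuous fun q : ℝ × ℝ × ℝ => (q.1, q.2.1))
    have h2 : Continuous fun q : ℝ × ℝ × ℝ => B q.1 q.2.2 :=
      hc2.comp (by fun_prop : Continuous fun q : ℝ × ℝ × ℝ => (q.1, q.2.2))
    exact (h1.sub h2).norm
  set ε := ‖A s₀ a₀ - B s₀ b₀‖ / 2 with hε
  have hpos : 0 < ‖A s₀ a₀ - B s₀ b₀‖ := norm_pos_iff.2 (sub_ne_zero.2 hne)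
  have hεpos : 0 < ε := by positivity
  have hev : ∀ᶠ q : ℝ × ℝ × ℝ in 𝓝 (s₀, a₀, b₀), ε < ‖A q.1 q.2.1 - B q.1 q.2.2‖ :=
    hc.continuousAt.eventually_const_lt (by simp only [hε]; linarith)
  refine ⟨(CA + CB) / ε, ?_⟩
  filter_upwards [hev] with q hq h1 h2 h3 s' hs'
  calc _ ≤ ‖A s' q.2.1 - A q.1 q.2.1‖ + ‖B s' q.2.2 - B q.1 q.2.2‖ := norm_sub_le _ _
    _ ≤ CA * |s' - q.1| + CB * |s' - q.1| :=
      add_le_add (hA1 _ h1 _ hs' _ h2) (hB1 _ h1 _ hs' _ h3)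
    _ = (CA + CB) / ε * |s' - q.1| * ε := by field_simp
    _ ≤ _ := by gcongr

theorem le_norm_of_functional {f : Space →L[ℝ] ℝ} {P Q : Space} {d : ℝ} (h : d ≤ f P - f Q) :
    d ≤ ‖f‖ * ‖P - Q‖ := by
  rw [← map_sub] at h
  exact h.trans ((le_abs_self _).trans (f.le_opNorm _))

/-- A functional norming the velocity shows that the distance of two nearby points of the arc is at
least a multiple of |a - b|; the double difference is at most a multiple of |s' - s| |a - b|. -/
theorem localIncrementBound_self {A : ℝ → ℝ → Space}
    (hA : ContDiff ℝ 2 fun p : ℝ × ℝ => A p.1 p.2) {s₀ a₀ : ℝ} (hne : deriv (A s₀) a₀ ≠ 0) :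
    LocalIncrementBound A A (s₀, a₀, a₀) := by
  obtain ⟨f, -, hf⟩ := exists_dual_vector ℝ _ (norm_ne_zero_iff.2 hne)
  have hf' : 0 < f (deriv (A s₀) a₀) := by
    rw [hf]; exact norm_pos_iff.2 hne
  obtain ⟨c, hc, r, hr, hmono⟩ := eventually_mul_sub_le hA f hf'
  obtain ⟨C, hC, hmix⟩ := exists_mixed_lipschitz hA
  refine ⟨C * ‖f‖ / c, ?_⟩
  filter_upwards [eventually_ball_triple (s₀ := s₀) (a₀ := a₀) (b₀ := a₀) hr] with q hq h1 h2 h3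
    s' hs'
  have hkey : c * |q.2.1 - q.2.2| ≤ ‖f‖ * ‖A q.1 q.2.1 - A q.1 q.2.2‖ := by
    rcases le_total q.2.1 q.2.2 with h | h
    · rw [abs_sub_comm, abs_of_nonneg (by linarith), norm_sub_rev]
      exact le_norm_of_functional (hmono _ hq.1 _ hq.2.1 _ hq.2.2 h)
    · rw [abs_of_nonneg (by linarith)]
      exact le_norm_of_functional (hmono _ hq.1 _ hq.2.2 _ hq.2.1 h)
  calc _ ≤ C * |s' - q.1| * |q.2.1 - q.2.2| := hmix _ h1 _ hs' _ h2 _ h3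
    _ = C * |s' - q.1| / c * (c * |q.2.1 - q.2.2|) := by field_simp
    _ ≤ C * |s' - q.1| / c * (‖f‖ * ‖A q.1 q.2.1 - A q.1 q.2.2‖) := by gcongr
    _ = _ := by ring

/-- Both arcs are compared with their common point. Because f increases along both, the distance of
a point before the junction from one after it controls the sum of their parameter distances to the
junction. The tangents may differ there; a common functional positive on both is enough. -/
theorem localIncrementBound_junction {A B : ℝ → ℝ → Space}
    (hA : ContDiff ℝ 2 fun p : ℝ × ℝ => A p.1 p.2) (hB : ContDiff ℝ 2 fun p : ℝ × ℝ => B p.1 p.2)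
    {s₀ : ℝ} (hAB : ∀ s ∈ Icc (0 : ℝ) 1, A s 1 = B s 0) (f : Space →L[ℝ] ℝ)
    (hfA : 0 < f (deriv (A s₀) 1)) (hfB : 0 < f (deriv (B s₀) 0)) :
    LocalIncrementBound A B (s₀, 1, 0) := by
  obtain ⟨cA, hcA, rA, hrA, hmA⟩ := eventually_mul_sub_le hA f hfA
  obtain ⟨cB, hcB, rB, hrB, hmB⟩ := eventually_mul_sub_le hB f hfB
  obtain ⟨CA, hCA, hmixA⟩ := exists_mixed_lipschitz hA
  obtain ⟨CB, hCB, hmixB⟩ := exists_mixed_lipschitz hB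
  refine ⟨(CA / cA + CB / cB) * ‖f‖, ?_⟩
  filter_upwards [eventually_ball_triple (s₀ := s₀) (a₀ := 1) (b₀ := 0) hrA,
    eventually_ball_triple (s₀ := s₀) (a₀ := 1) (b₀ := 0) hrB] with q hqA hqB h1 h2 h3 s' hs'
  have e1 := hmA _ hqA.1 _ hqA.2.1 1 (Metric.mem_ball_self hrA) h2.2
  have e2 := hmB _ hqB.1 0 (Metric.mem_ball_self hrB) _ hqB.2.2 h3.1
  rw [hAB _ h1] at e1
  have ha : 0 ≤ cA * (1 - q.2.1) := mul_nonneg hcA.le (by linarith [h2.2])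
  have hb : 0 ≤ cB * (q.2.2 - 0) := mul_nonneg hcB.le (by linarith [h3.1])
  set R := ‖f‖ * ‖A q.1 q.2.1 - B q.1 q.2.2‖ with hR
  have hsum : cA * (1 - q.2.1) + cB * (q.2.2 - 0) ≤ R := by
    rw [hR, norm_sub_rev]
    exact le_norm_of_functional (by linarith)
  have hm1 := hmixA _ h1 _ hs' _ h2 1 ⟨zero_le_one, le_rfl⟩
  have hm2 := hmixB _ h1 _ hs' 0 ⟨le_rfl, zero_le_one⟩ _ h3
  rw [abs_sub_comm q.2.1, abs_of_nonneg (by linarith [h2.2] : 0 ≤ 1 - q.2.1)] at hm1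
  rw [abs_sub_comm (0 : ℝ), abs_of_nonneg (by linarith [h3.1] : 0 ≤ q.2.2 - 0)] at hm2
  have hsplit : (A s' q.2.1 - A q.1 q.2.1) - (B s' q.2.2 - B q.1 q.2.2) =
      ((A s' q.2.1 - A q.1 q.2.1) - (A s' 1 - A q.1 1)) +
      ((B s' 0 - B q.1 0) - (B s' q.2.2 - B q.1 q.2.2)) := by
    rw [hAB _ h1, hAB _ hs']; abel
  rw [hsplit]
  calc _ ≤ CA * |s' - q.1| * (1 - q.2.1) + CB * |s' - q.1| * (q.2.2 - 0) :=
        (norm_add_le _ _).trans (add_le_add hm1 hm2)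
    _ = CA * |s' - q.1| / cA * (cA * (1 - q.2.1)) + CB * |s' - q.1| / cB * (cB * (q.2.2 - 0)) := by
        field_simp
    _ ≤ CA * |s' - q.1| / cA * R + CB * |s' - q.1| / cB * R := by
        gcongr <;> linarith
    _ = _ := by rw [hR]; ring

/-- Compactness of the cube of parameters: having a uniform constant passes to unions, by taking the
maximum. -/
theorem exists_incrementBound {A B : ℝ → ℝ → Space}
    (h : ∀ s ∈ Icc (0 : ℝ) 1, ∀ a ∈ Icc (0 : ℝ) 1, ∀ b ∈ Icc (0 : ℝ) 1,
      LocalIncrementBound A B (s, a, b)) :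
    ∃ C : ℝ, ∀ s ∈ Icc (0 : ℝ) 1, ∀ a ∈ Icc (0 : ℝ) 1, ∀ b ∈ Icc (0 : ℝ) 1,
      IncrementBound A B C s a b := by
  have hK : IsCompact (Icc (0 : ℝ) 1 ×ˢ (Icc (0 : ℝ) 1 ×ˢ Icc (0 : ℝ) 1)) :=
    isCompact_Icc.prod isCompact_unitSquare
  have := hK.induction_on (p := fun U => ∃ C : ℝ, ∀ q ∈ U, q.1 ∈ Icc (0 : ℝ) 1 →
      q.2.1 ∈ Icc (0 : ℝ) 1 → q.2.2 ∈ Icc (0 : ℝ) 1 → IncrementBound A B C q.1 q.2.1 q.2.2)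
    ⟨0, by simp⟩ (fun s t hst ⟨C, hC⟩ => ⟨C, fun q hq => hC q (hst hq)⟩)
    (fun s t ⟨C, hC⟩ ⟨C', hC'⟩ => ⟨max C C', fun q hq h1 h2 h3 => hq.elim
      (fun hq => (hC q hq h1 h2 h3).mono (le_max_left _ _))
      (fun hq => (hC' q hq h1 h2 h3).mono (le_max_right _ _))⟩)
    (fun q hq => by
      obtain ⟨C, hC⟩ := h q.1 hq.1 q.2.1 hq.2.1 q.2.2 hq.2.2
      exact ⟨_, mem_nhdsWithin_of_mem_nhds hC, C, fun q hq => hq⟩)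
  obtain ⟨C, hC⟩ := this
  exact ⟨C, fun s hs a ha b hb => hC (s, a, b) ⟨hs, ha, hb⟩ hs ha hb⟩

/-- Isotopy extension for finite families of regular arcs glued end to end. -/
theorem linkEquiv_of_arc_homotopy {ι : Type} {I : Set ι} (hI : I.Finite) (φ : ℝ → ι → ℝ → Space)
    (hφ : ∀ k ∈ I, ContDiff ℝ 2 fun p : ℝ × ℝ => φ p.1 k p.2) (J : ι → ι → Prop)
    (hJ : ∀ k ∈ I, ∀ k' ∈ I, J k k' → ∀ s ∈ Icc (0 : ℝ) 1, φ s k 1 = φ s k' 0)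
    (hinj : ∀ s ∈ Icc (0 : ℝ) 1, ∀ k ∈ I, ∀ k' ∈ I, ∀ a ∈ Icc (0 : ℝ) 1, ∀ b ∈ Icc (0 : ℝ) 1,
      φ s k a = φ s k' b → (k = k' ∧ a = b) ∨ (J k k' ∧ a = 1 ∧ b = 0) ∨ (J k' k ∧ a = 0 ∧ b = 1))
    (hreg : ∀ s ∈ Icc (0 : ℝ) 1, ∀ k ∈ I, ∀ a ∈ Icc (0 : ℝ) 1, deriv (φ s k) a ≠ 0)
    (hJreg : ∀ k ∈ I, ∀ k' ∈ I, J k k' → ∀ s ∈ Icc (0 : ℝ) 1, ∃ f : Space →L[ℝ] ℝ,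
      0 < f (deriv (φ s k) 1) ∧ 0 < f (deriv (φ s k') 0)) :
    LinkEquiv {P | ∃ k ∈ I, ∃ a ∈ Icc (0 : ℝ) 1, φ 0 k a = P}
      {P | ∃ k ∈ I, ∃ a ∈ Icc (0 : ℝ) 1, φ 1 k a = P} := by
  have hpair : ∀ k k' : I, ∃ C : ℝ, ∀ s ∈ Icc (0 : ℝ) 1, ∀ a ∈ Icc (0 : ℝ) 1,
      ∀ b ∈ Icc (0 : ℝ) 1, IncrementBound (φ · k) (φ · k') C s a b := by
    rintro ⟨k, hk⟩ ⟨k', hk'⟩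
    refine exists_incrementBound fun s hs a ha b hb => ?_
    by_cases heq : φ s k a = φ s k' b
    · rcases hinj s hs k hk k' hk' a ha b hb heq with ⟨rfl, rfl⟩ | ⟨hj, rfl, rfl⟩ | ⟨hj, rfl, rfl⟩
      · exact localIncrementBound_self (hφ k hk) (hreg s hs k hk a ha)
      · obtain ⟨f, hf1, hf2⟩ := hJreg k hk k' hk' hj s hs
        exact localIncrementBound_junction (A := fun t => φ t k) (B := fun t => φ t k')
          (hφ k hk) (hφ k' hk') (hJ k hk k' hk' hj) f hf1 hf2
      · obtain ⟨f, hf1, hf2⟩ := hJreg k' hk' k hk hj s hs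
        exact (localIncrementBound_junction (A := fun t => φ t k') (B := fun t => φ t k)
          (hφ k' hk') (hφ k hk) (hJ k' hk' k hk hj) f hf1 hf2).swap
    · exact localIncrementBound_of_ne (A := fun t => φ t k) (B := fun t => φ t k')
        (hφ k hk) (hφ k' hk') heq
  choose C hC using hpair
  have : Finite I := hI
  obtain ⟨M, hM⟩ := (Set.finite_range fun p : I × I => C p.1 p.2).bddAbove
  have hmain := linkEquiv_of_lipschitz_homotopy (I ×ˢ Icc (0 : ℝ) 1)
    (fun s (x : ι × ℝ) => φ s x.1 x.2) M (by
      rintro s hs s' hs' ⟨k, a⟩ ⟨hk, ha⟩ ⟨k', b⟩ ⟨hk', hb⟩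
      exact ((hC ⟨k, hk⟩ ⟨k', hk'⟩ s hs a ha b hb).mono
        (hM ⟨(⟨k, hk⟩, ⟨k', hk'⟩), rfl⟩)) s' hs')
  have himg : ∀ s, (fun x : ι × ℝ => φ s x.1 x.2) '' (I ×ˢ Icc (0 : ℝ) 1) =
      {P | ∃ k ∈ I, ∃ a ∈ Icc (0 : ℝ) 1, φ s k a = P} := by
    intro s
    ext P
    constructor
    · rintro ⟨⟨k, a⟩, ⟨hk, ha⟩, rfl⟩
      exact ⟨k, hk, a, ha, rfl⟩
    · rintro ⟨k, hk, a, ha, rfl⟩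
      exact ⟨(k, a), ⟨hk, ha⟩, rfl⟩
  rwa [himg 0, himg 1] at hmain

/-! ### Cylindrical coordinates about the braid axis -/

/-- The point of `ℝ³` seen at angle `2πt` at the point `c` of the half-plane. -/
noncomputable def wrap (t : ℝ) (c : ℝ × ℝ) : Space :=
  ((c.1 : ℂ) * Complex.exp (2 * Real.pi * t * Complex.I), c.2)

/-- The functional measuring the horizontal velocity orthogonal to the half-plane at angle `2πt`. -/
noncomputable def angularFunctional (t : ℝ) : Space →L[ℝ] ℝ :=
  Complex.imCLM.comp (((ContinuousLinearMap.mul ℝ ℂ) (Complex.exp (-(2 * Real.pi * t * Complex.I)))).comp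
    (ContinuousLinearMap.fst ℝ ℂ ℝ))

theorem angularFunctional_apply (t : ℝ) (P : Space) :
    angularFunctional t P = (Complex.exp (-(2 * Real.pi * t * Complex.I)) * P.1).im := rfl

theorem exp_neg_two_pi_one : Complex.exp (-(2 * Real.pi * (1 : ℝ) * Complex.I)) = 1 := by
  rw [Complex.exp_neg]
  simp [Complex.exp_two_pi_mul_I]

theorem angularFunctional_one : angularFunctional 1 = angularFunctional 0 := by
  ext P
  · rw [ContinuousLinearMap.comp_apply, ContinuousLinearMap.comp_apply, angularFunctional_apply,
      angularFunctional_apply, exp_neg_two_pi_one]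
    simp
  · simp [angularFunctional]

theorem wrap_one (c : ℝ × ℝ) : wrap 1 c = wrap 0 c := by
  simp [wrap, Complex.exp_two_pi_mul_I]

theorem hasDerivAt_wrap {θ : ℝ → ℝ} {p : ℝ → ℝ × ℝ} {θ' a : ℝ} {p' : ℝ × ℝ}
    (hθ : HasDerivAt θ θ' a) (hp : HasDerivAt p p' a) :
    HasDerivAt (fun b => wrap (θ b) (p b))
      (((p'.1 : ℂ) + 2 * Real.pi * θ' * (p a).1 * Complex.I)
        * Complex.exp (2 * Real.pi * θ a * Complex.I), p'.2) a := by
  have h1 : HasDerivAt (fun b => ((p b).1 : ℂ)) (p'.1 : ℂ) a :=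
    HasDerivAt.ofReal_comp (f := fun b => (p b).1)
      ((hasFDerivAt_fst (𝕜 := ℝ) (p := p a)).comp_hasDerivAt a hp)
  have h2 : HasDerivAt (fun b => (p b).2) p'.2 a :=
    (hasFDerivAt_snd (𝕜 := ℝ) (p := p a)).comp_hasDerivAt a hp
  have h3 : HasDerivAt (fun b => Complex.exp (2 * Real.pi * (θ b : ℂ) * Complex.I))
      (Complex.exp (2 * Real.pi * (θ a : ℂ) * Complex.I) * (2 * Real.pi * θ' * Complex.I)) a :=
    ((hθ.ofReal_comp.const_mul (2 * (Real.pi : ℂ))).mul_const Complex.I).cexp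
  have := (h1.mul h3).prodMk h2
  refine this.congr_deriv (Prod.ext ?_ rfl)
  dsimp only
  ring

theorem angularFunctional_deriv_wrap {θ : ℝ → ℝ} {p : ℝ → ℝ × ℝ} {θ' a : ℝ}
    (hθ : HasDerivAt θ θ' a) (hp : DifferentiableAt ℝ p a) :
    angularFunctional (θ a) (deriv (fun b => wrap (θ b) (p b)) a)
      = 2 * Real.pi * θ' * (p a).1 := by
  rw [(hasDerivAt_wrap hθ hp.hasDerivAt).deriv, angularFunctional_apply]
  dsimp only
  rw [mul_left_comm, ← Complex.exp_add, neg_add_cancel, Complex.exp_zero, mul_one]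
  have : (2 * Real.pi * θ' * (p a).1 * Complex.I : ℂ)
      = ((2 * Real.pi * θ' * (p a).1 : ℝ) : ℂ) * Complex.I := by push_cast; ring
  rw [this]
  simp [-Complex.ofReal_mul]

theorem contDiff_wrap {E : Type} [NormedAddCommGroup E] [NormedSpace ℝ E] {θ : E → ℝ}
    {p : E → ℝ × ℝ} (hθ : ContDiff ℝ 2 θ) (hp : ContDiff ℝ 2 p) :
    ContDiff ℝ 2 fun x => wrap (θ x) (p x) := by
  have h1 : ContDiff ℝ 2 fun x => ((p x).1 : ℂ) := Complex.ofRealCLM.contDiff.comp hp.fst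
  have h2 : ContDiff ℝ 2 fun x => (θ x : ℂ) := Complex.ofRealCLM.contDiff.comp hθ
  have h3 : ContDiff ℝ 2 fun x => Complex.exp (2 * Real.pi * (θ x : ℂ) * Complex.I) :=
    ((contDiff_const.mul h2).mul contDiff_const).cexp
  exact (h1.mul h3).prodMk hp.snd

theorem norm_wrap_fst (t : ℝ) (c : ℝ × ℝ) : ‖(wrap t c).1‖ = |c.1| := by
  have : (2 * Real.pi * t * Complex.I : ℂ) = ((2 * Real.pi * t : ℝ) : ℂ) * Complex.I := by
    push_cast; ring
  simp only [wrap]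
  rw [norm_mul, this, Complex.norm_exp_ofReal_mul_I, mul_one, Complex.norm_real, Real.norm_eq_abs]

theorem wrap_inj {t t' : ℝ} {c c' : ℝ × ℝ} (ht : t ∈ Icc (0 : ℝ) 1) (ht' : t' ∈ Icc (0 : ℝ) 1)
    (hc : 0 < c.1) (hc' : 0 < c'.1) (h : wrap t c = wrap t' c') :
    c = c' ∧ (t = t' ∨ (t = 1 ∧ t' = 0) ∨ (t = 0 ∧ t' = 1)) := by
  have h2 : c.2 = c'.2 := congrArg (fun P : Space => P.2) h
  have h1 : c.1 = c'.1 := by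
    have := congrArg (fun P : Space => ‖P.1‖) h
    simp only [norm_wrap_fst] at this
    rwa [abs_of_pos hc, abs_of_pos hc'] at this
  refine ⟨Prod.ext h1 h2, ?_⟩
  have h3 := congrArg (fun P : Space => P.1) h
  simp only [wrap, ← h1] at h3
  have hne : (c.1 : ℂ) ≠ 0 := by exact_mod_cast hc.ne'
  obtain ⟨n, hn⟩ := Complex.exp_eq_exp_iff_exists_int.1 (mul_left_cancel₀ hne h3)
  have hpi : (2 * Real.pi * Complex.I : ℂ) ≠ 0 := Complex.two_pi_I_ne_zero
  have h4 : (t : ℂ) = t' + n := by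
    apply mul_left_cancel₀ hpi
    linear_combination hn
  have h5 : t = t' + n := by exact_mod_cast h4
  have hn1 : n ≤ 1 := by
    have : (n : ℝ) ≤ 1 := by linarith [ht.2, ht'.1]
    exact_mod_cast this
  have hn2 : -1 ≤ n := by
    have : (-1 : ℝ) ≤ n := by linarith [ht.1, ht'.2]
    exact_mod_cast this
  interval_cases n
  · right; right; push_cast at h5; constructor <;> linarith [ht.1, ht'.2]
  · left; simpa using h5
  · right; left; push_cast at h5; constructor <;> linarith [ht.2, ht'.1]

/-! ### Clocks and links made of pieces around the axis -/

/-- Division of the unit time interval at times `0 = T 0 < T 1 < ⋯ < T ℓ = 1`. -/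
structure IsClock (ℓ : ℕ) (T : ℕ → ℝ) : Prop where
  pos : 0 < ℓ
  zero : T 0 = 0
  last : T ℓ = 1
  lt : ∀ k < ℓ, T k < T (k + 1)

/-- The time at which a fraction `a` of the `k`-th interval has elapsed. -/
def nodeTime (T : ℕ → ℝ) (k : ℕ) (a : ℝ) : ℝ := T k + a * (T (k + 1) - T k)

namespace IsClock
variable {ℓ : ℕ} {T T' : ℕ → ℝ}

theorem mono (hT : IsClock ℓ T) {k k' : ℕ} (h : k ≤ k') (hk' : k' ≤ ℓ) : T k ≤ T k' := by
  induction k', h using Nat.le_induction with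
  | base => rfl
  | succ n hn ih => exact (ih (by omega)).trans (hT.lt n (by omega)).le

/-- Strict monotonicity is a convex condition, so a homotopy may also change the durations of the
pieces. -/
theorem convex (hT : IsClock ℓ T) (hT' : IsClock ℓ T') {s : ℝ} (hs : s ∈ Icc (0 : ℝ) 1) :
    IsClock ℓ fun k => (1 - s) * T k + s * T' k where
  pos := hT.pos
  zero := by simp [hT.zero, hT'.zero]
  last := by simp [hT.last, hT'.last]
  lt := by
    intro k hk
    have h1 := hT.lt k hk
    have h2 := hT'.lt k hk
    rcases hs.1.eq_or_lt with rfl | h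
    · simpa using h1
    · have := mul_lt_mul_of_pos_left h2 h
      have := mul_le_mul_of_nonneg_left h1.le (by linarith [hs.2] : (0 : ℝ) ≤ 1 - s)
      linarith

theorem nodeTime_mem (hT : IsClock ℓ T) {k : ℕ} (hk : k < ℓ) {a : ℝ} (ha : a ∈ Icc (0 : ℝ) 1) :
    T k ≤ nodeTime T k a ∧ nodeTime T k a ≤ T (k + 1) := by
  have := hT.lt k hk
  simp only [nodeTime]
  constructor
  · nlinarith [ha.1]
  · nlinarith [ha.2]

theorem nodeTime_mem_Icc (hT : IsClock ℓ T) {k : ℕ} (hk : k < ℓ) {a : ℝ}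
    (ha : a ∈ Icc (0 : ℝ) 1) : nodeTime T k a ∈ Icc (0 : ℝ) 1 := by
  obtain ⟨h1, h2⟩ := hT.nodeTime_mem hk ha
  have h3 := hT.mono (Nat.zero_le k) hk.le
  have h4 := hT.mono (show k + 1 ≤ ℓ from hk) le_rfl
  rw [hT.zero] at h3
  rw [hT.last] at h4
  exact ⟨by linarith, by linarith⟩

theorem eq_zero_of_nodeTime (hT : IsClock ℓ T) {k : ℕ} (hk : k < ℓ) {a : ℝ}
    (ha : a ∈ Icc (0 : ℝ) 1) (h : nodeTime T k a ≤ T k) : a = 0 := by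
  have := hT.lt k hk
  simp only [nodeTime] at h
  by_contra hne
  have : 0 < a := lt_of_le_of_ne ha.1 (Ne.symm hne)
  nlinarith

theorem eq_one_of_nodeTime (hT : IsClock ℓ T) {k : ℕ} (hk : k < ℓ) {a : ℝ}
    (ha : a ∈ Icc (0 : ℝ) 1) (h : T (k + 1) ≤ nodeTime T k a) : a = 1 := by
  have := hT.lt k hk
  simp only [nodeTime] at h
  by_contra hne
  have : a < 1 := lt_of_le_of_ne ha.2 hne
  nlinarith

theorem nodeTime_eq_of_lt (hT : IsClock ℓ T) {k k' : ℕ} (hk : k < k') (hk' : k' < ℓ) {a b : ℝ}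
    (ha : a ∈ Icc (0 : ℝ) 1) (hb : b ∈ Icc (0 : ℝ) 1) (h : nodeTime T k a = nodeTime T k' b) :
    k' = k + 1 ∧ a = 1 ∧ b = 0 := by
  have h1 := hT.nodeTime_mem (by omega : k < ℓ) ha
  have h2 := hT.nodeTime_mem hk' hb
  have h3 := hT.mono (show k + 1 ≤ k' from hk) hk'.le
  refine ⟨?_, hT.eq_one_of_nodeTime (k := k) (by omega) ha (by linarith),
    hT.eq_zero_of_nodeTime hk' hb (by linarith)⟩
  by_contra hne
  have h4 := hT.lt (k + 1) (by omega)
  have h5 := hT.mono (show k + 2 ≤ k' by omega) hk'.le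
  have : T (k + 1 + 1) = T (k + 2) := rfl
  linarith

theorem nodeTime_eq (hT : IsClock ℓ T) {k k' : ℕ} (hk : k < ℓ) (hk' : k' < ℓ) {a b : ℝ}
    (ha : a ∈ Icc (0 : ℝ) 1) (hb : b ∈ Icc (0 : ℝ) 1) (h : nodeTime T k a = nodeTime T k' b) :
    (k = k' ∧ a = b) ∨ (k' = k + 1 ∧ a = 1 ∧ b = 0) ∨ (k = k' + 1 ∧ a = 0 ∧ b = 1) := by
  rcases lt_trichotomy k k' with hlt | rfl | hlt
  · exact .inr (.inl (hT.nodeTime_eq_of_lt hlt hk' ha hb h))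
  · left
    have := hT.lt k hk
    simp only [nodeTime, add_right_inj] at h
    exact ⟨rfl, mul_right_cancel₀ (by linarith : T (k + 1) - T k ≠ 0) h⟩
  · have := hT.nodeTime_eq_of_lt hlt hk hb ha h.symm
    exact .inr (.inr ⟨this.1, this.2.2, this.2.1⟩)

theorem first_of_nodeTime (hT : IsClock ℓ T) {k : ℕ} (hk : k < ℓ) {a : ℝ}
    (ha : a ∈ Icc (0 : ℝ) 1) (h : nodeTime T k a = 0) : k = 0 ∧ a = 0 := by
  have h0 : nodeTime T 0 0 = 0 := by simp [nodeTime, hT.zero]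
  rcases hT.nodeTime_eq hk hT.pos ha ⟨le_rfl, zero_le_one⟩ (h.trans h0.symm) with
    h | ⟨h, -⟩ | ⟨-, -, h⟩
  · exact h
  · omega
  · norm_num at h

theorem last_of_nodeTime (hT : IsClock ℓ T) {k : ℕ} (hk : k < ℓ) {a : ℝ}
    (ha : a ∈ Icc (0 : ℝ) 1) (h : nodeTime T k a = 1) : k + 1 = ℓ ∧ a = 1 := by
  have hp := hT.pos
  have h0 : nodeTime T (ℓ - 1) 1 = 1 := by
    simp [nodeTime, Nat.sub_add_cancel hT.pos, hT.last]
  rcases hT.nodeTime_eq hk (by omega : ℓ - 1 < ℓ) ha ⟨zero_le_one, le_rfl⟩ (h.trans h0.symm) with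
    ⟨h, h'⟩ | ⟨-, -, h⟩ | ⟨h, -⟩
  · exact ⟨by omega, h'⟩
  · norm_num at h
  · omega

/-- At positive radius a point determines its time up to the identification of 0 with 1; that is why
adjacency of pieces is counted modulo ℓ. -/
theorem wrap_nodeTime_inj (hT : IsClock ℓ T) {k k' : ℕ} (hk : k < ℓ) (hk' : k' < ℓ) {a b : ℝ}
    (ha : a ∈ Icc (0 : ℝ) 1) (hb : b ∈ Icc (0 : ℝ) 1) {c c' : ℝ × ℝ} (hc : 0 < c.1)
    (hc' : 0 < c'.1) (h : wrap (nodeTime T k a) c = wrap (nodeTime T k' b) c') :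
    c = c' ∧ ((k = k' ∧ a = b) ∨ (k' = (k + 1) % ℓ ∧ a = 1 ∧ b = 0) ∨
      (k = (k' + 1) % ℓ ∧ a = 0 ∧ b = 1)) := by
  obtain ⟨h1, h2⟩ := wrap_inj (hT.nodeTime_mem_Icc hk ha) (hT.nodeTime_mem_Icc hk' hb) hc hc' h
  refine ⟨h1, ?_⟩
  rcases h2 with h2 | ⟨h2, h3⟩ | ⟨h2, h3⟩
  · rcases hT.nodeTime_eq hk hk' ha hb h2 with h | ⟨h, h'⟩ | ⟨h, h'⟩
    · exact .inl h
    · exact .inr (.inl ⟨by rw [Nat.mod_eq_of_lt (by omega)]; exact h, h'⟩)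
    · exact .inr (.inr ⟨by rw [Nat.mod_eq_of_lt (by omega)]; exact h, h'⟩)
  · obtain ⟨e1, e2⟩ := hT.last_of_nodeTime hk ha h2
    obtain ⟨e3, e4⟩ := hT.first_of_nodeTime hk' hb h3
    exact .inr (.inl ⟨by rw [e1, e3, Nat.mod_self], e2, e4⟩)
  · obtain ⟨e1, e2⟩ := hT.last_of_nodeTime hk' hb h3
    obtain ⟨e3, e4⟩ := hT.first_of_nodeTime hk ha h2
    exact .inr (.inr ⟨by rw [e1, e3, Nat.mod_self], e4, e2⟩)

/-- The end of a piece is the start of the next one, cyclically. -/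
theorem wrap_nodeTime_succ (hT : IsClock ℓ T) {k : ℕ} (hk : k < ℓ) (c : ℝ × ℝ) :
    wrap (nodeTime T k 1) c = wrap (nodeTime T ((k + 1) % ℓ) 0) c := by
  have h1 : nodeTime T k 1 = T (k + 1) := by simp [nodeTime]
  have h2 : ∀ i, nodeTime T i 0 = T i := by simp [nodeTime]
  rw [h1, h2]
  rcases (show k + 1 ≤ ℓ from hk).eq_or_lt with h | h
  · rw [h, Nat.mod_self, hT.zero, hT.last, wrap_one]
  · rw [Nat.mod_eq_of_lt h]

theorem angularFunctional_nodeTime_succ (hT : IsClock ℓ T) {k : ℕ} (hk : k < ℓ) :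
    angularFunctional (nodeTime T k 1) = angularFunctional (nodeTime T ((k + 1) % ℓ) 0) := by
  have h1 : nodeTime T k 1 = T (k + 1) := by simp [nodeTime]
  have h2 : ∀ i, nodeTime T i 0 = T i := by simp [nodeTime]
  rw [h1, h2]
  rcases (show k + 1 ≤ ℓ from hk).eq_or_lt with h | h
  · rw [h, Nat.mod_self, hT.zero, hT.last, angularFunctional_one]
  · rw [Nat.mod_eq_of_lt h]

end IsClock

theorem hasDerivAt_nodeTime (T : ℕ → ℝ) (k : ℕ) (a : ℝ) :
    HasDerivAt (nodeTime T k) (T (k + 1) - T k) a := by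
  have := ((hasDerivAt_id' a).mul_const (T (k + 1) - T k)).const_add (T k)
  rwa [one_mul] at this

/-- The link made of `ℓ` pieces of `N` strands around the axis. -/
noncomputable def pieceLink (ℓ N : ℕ) (T : ℕ → ℝ) (c : ℕ → ℕ → ℝ → ℝ × ℝ) : Set Space :=
  {P | ∃ k < ℓ, ∃ j, (1 ≤ j ∧ j ≤ N) ∧ ∃ a ∈ Icc (0 : ℝ) 1, wrap (nodeTime T k a) (c k j a) = P}

theorem pieceLink_congr {ℓ N : ℕ} {T : ℕ → ℝ} {c c' : ℕ → ℕ → ℝ → ℝ × ℝ}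
    (h : ∀ k < ℓ, ∀ j, 1 ≤ j → j ≤ N → ∀ a ∈ Icc (0 : ℝ) 1, c k j a = c' k j a) :
    pieceLink ℓ N T c = pieceLink ℓ N T c' := by
  ext P
  constructor
  · rintro ⟨k, hk, j, hj, a, ha, rfl⟩
    exact ⟨k, hk, j, hj, a, ha, by rw [h k hk j hj.1 hj.2 a ha]⟩
  · rintro ⟨k, hk, j, hj, a, ha, rfl⟩
    exact ⟨k, hk, j, hj, a, ha, by rw [h k hk j hj.1 hj.2 a ha]⟩

/-- The linear interpolation between two piecewise braids is an isotopy as long as strands do not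
collide in any cross-section. -/
theorem linkEquiv_pieceLink {ℓ N : ℕ} {T T' : ℕ → ℝ} (hT : IsClock ℓ T) (hT' : IsClock ℓ T')
    {c c' : ℕ → ℕ → ℝ → ℝ × ℝ} (hc : ∀ k < ℓ, ∀ j, ContDiff ℝ 2 (c k j))
    (hc' : ∀ k < ℓ, ∀ j, ContDiff ℝ 2 (c' k j))
    (hpos : ∀ k < ℓ, ∀ j, 1 ≤ j → j ≤ N → ∀ a ∈ Icc (0 : ℝ) 1, 0 < (c k j a).1 ∧ 0 < (c' k j a).1)
    (hglue : ∀ k < ℓ, ∀ j, 1 ≤ j → j ≤ N → ∃ j', (1 ≤ j' ∧ j' ≤ N) ∧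
      c k j 1 = c ((k + 1) % ℓ) j' 0 ∧ c' k j 1 = c' ((k + 1) % ℓ) j' 0)
    (hinj : ∀ s ∈ Icc (0 : ℝ) 1, ∀ k < ℓ, ∀ j j', 1 ≤ j → j < j' → j' ≤ N → ∀ a ∈ Icc (0 : ℝ) 1,
      (1 - s) • c k j a + s • c' k j a ≠ (1 - s) • c k j' a + s • c' k j' a) :
    LinkEquiv (pieceLink ℓ N T c) (pieceLink ℓ N T' c') := by
  have hinj' : ∀ s ∈ Icc (0 : ℝ) 1, ∀ k < ℓ, ∀ j j', 1 ≤ j → j ≤ N → 1 ≤ j' → j' ≤ N →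
      ∀ a ∈ Icc (0 : ℝ) 1,
      (1 - s) • c k j a + s • c' k j a = (1 - s) • c k j' a + s • c' k j' a → j = j' := by
    intro s hs k hk j j' h1 h2 h3 h4 a ha h
    rcases lt_trichotomy j j' with hlt | heq | hlt
    · exact absurd h (hinj s hs k hk j j' h1 hlt h4 a ha)
    · exact heq
    · exact absurd h.symm (hinj s hs k hk j' j h3 hlt h2 a ha)
  set Ts : ℝ → ℕ → ℝ := fun s k => (1 - s) * T k + s * T' k with hTs
  set cs : ℝ → ℕ × ℕ → ℝ → ℝ × ℝ := fun s x a =>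
    (1 - s) • c x.1 x.2 a + s • c' x.1 x.2 a with hcs
  have hclock : ∀ s ∈ Icc (0 : ℝ) 1, IsClock ℓ (Ts s) := fun s hs => hT.convex hT' hs
  set I : Set (ℕ × ℕ) := {x | x.1 < ℓ ∧ 1 ≤ x.2 ∧ x.2 ≤ N} with hI
  have hIfin : I.Finite :=
    ((Set.finite_Iio ℓ).prod (Set.finite_Icc 1 N)).subset fun x hx => ⟨hx.1, hx.2⟩
  have hcpos : ∀ s ∈ Icc (0 : ℝ) 1, ∀ x ∈ I, ∀ a ∈ Icc (0 : ℝ) 1, 0 < (cs s x a).1 := by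
    intro s hs x hx a ha
    obtain ⟨h1, h2⟩ := hpos x.1 hx.1 x.2 hx.2.1 hx.2.2 a ha
    simp only [hcs, Prod.fst_add, Prod.smul_fst, smul_eq_mul]
    rcases hs.1.eq_or_lt with rfl | h
    · simpa using h1
    · have := mul_pos h h2
      have := mul_nonneg (by linarith [hs.2] : (0 : ℝ) ≤ 1 - s) h1.le
      linarith
  have hcdiff : ∀ s, ∀ x ∈ I, ∀ a, DifferentiableAt ℝ (cs s x) a := by
    intro s x hx a
    have h1 := ((hc x.1 hx.1 x.2).differentiable (by norm_num)) a
    have h2 := ((hc' x.1 hx.1 x.2).differentiable (by norm_num)) a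
    exact (h1.const_smul (1 - s)).add (h2.const_smul s)
  -- The velocity across the half-plane is 2π times the rate of the clock times the radius, hence
  -- positive. This gives regularity of the arcs, and a common functional on the two sides of each
  -- junction.
  have hang : ∀ s ∈ Icc (0 : ℝ) 1, ∀ x ∈ I, ∀ a ∈ Icc (0 : ℝ) 1,
      0 < angularFunctional (nodeTime (Ts s) x.1 a)
        (deriv (fun b => wrap (nodeTime (Ts s) x.1 b) (cs s x b)) a) := by
    intro s hs x hx a ha
    rw [angularFunctional_deriv_wrap (hasDerivAt_nodeTime _ _ _) (hcdiff s x hx a)]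
    have h1 := hcpos s hs x hx a ha
    have h2 := sub_pos.2 ((hclock s hs).lt x.1 hx.1)
    have := Real.pi_pos
    positivity
  have key := linkEquiv_of_arc_homotopy hIfin
    (fun s x a => wrap (nodeTime (Ts s) x.1 a) (cs s x a)) ?_
    (fun x y => y.1 = (x.1 + 1) % ℓ ∧ c x.1 x.2 1 = c y.1 y.2 0 ∧ c' x.1 x.2 1 = c' y.1 y.2 0)
    ?_ ?_ ?_ ?_
  · convert key using 1
    · ext P
      constructor
      · rintro ⟨k, hk, j, hj, a, ha, rfl⟩
        exact ⟨(k, j), ⟨hk, hj⟩, a, ha, by simp [hTs, hcs]⟩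
      · rintro ⟨⟨k, j⟩, ⟨hk, hj⟩, a, ha, rfl⟩
        exact ⟨k, hk, j, hj, a, ha, by simp [hTs, hcs]⟩
    · ext P
      constructor
      · rintro ⟨k, hk, j, hj, a, ha, rfl⟩
        exact ⟨(k, j), ⟨hk, hj⟩, a, ha, by simp [hTs, hcs]⟩
      · rintro ⟨⟨k, j⟩, ⟨hk, hj⟩, a, ha, rfl⟩
        exact ⟨k, hk, j, hj, a, ha, by simp [hTs, hcs]⟩
  · intro x hx
    have h1 : ContDiff ℝ 2 fun p : ℝ × ℝ => nodeTime (Ts p.1) x.1 p.2 := by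
      simp only [nodeTime, hTs]; fun_prop
    have h2 : ContDiff ℝ 2 fun p : ℝ × ℝ => cs p.1 x p.2 := by
      have h3 := (hc x.1 hx.1 x.2).comp (contDiff_snd (𝕜 := ℝ) (E := ℝ) (F := ℝ))
      have h4 := (hc' x.1 hx.1 x.2).comp (contDiff_snd (𝕜 := ℝ) (E := ℝ) (F := ℝ))
      exact ((contDiff_const.sub contDiff_fst).smul h3).add (contDiff_fst.smul h4)
    exact contDiff_wrap h1 h2
  · rintro x hx y hy ⟨h1, h2, h3⟩ s hs
    have : cs s x 1 = cs s y 0 := by simp only [hcs, h2, h3]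
    simp only [this]
    rw [(hclock s hs).wrap_nodeTime_succ hx.1, ← h1]
  · rintro s hs ⟨k, j⟩ hx ⟨k', j'⟩ hy a ha b hb h
    obtain ⟨h1, h2⟩ := (hclock s hs).wrap_nodeTime_inj hx.1 hy.1 ha hb
      (hcpos s hs _ hx a ha) (hcpos s hs _ hy b hb) h
    -- If two ends meet at time s, injectivity at that time identifies the second strand with the
    -- one glued to the first, so the ends meet in both links and the junction does not depend on s.
    have hstep : ∀ x ∈ I, ∀ y ∈ I, y.1 = (x.1 + 1) % ℓ → cs s x 1 = cs s y 0 →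
        c x.1 x.2 1 = c y.1 y.2 0 ∧ c' x.1 x.2 1 = c' y.1 y.2 0 := by
      intro x hx y hy hxy he
      obtain ⟨j'', hj'', e1, e2⟩ := hglue x.1 hx.1 x.2 hx.2.1 hx.2.2
      rw [← hxy] at e1 e2
      have : j'' = y.2 := by
        refine hinj' s hs y.1 hy.1 _ _ hj''.1 hj''.2 hy.2.1 hy.2.2 0 ⟨le_rfl, zero_le_one⟩ ?_
        rw [← e1, ← e2]
        exact he
      rw [← this]
      exact ⟨e1, e2⟩
    rcases h2 with ⟨h2, h3⟩ | ⟨h2, h3, h4⟩ | ⟨h2, h3, h4⟩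
    · dsimp only at h2
      subst h2 h3
      left
      exact ⟨congrArg (Prod.mk k)
        (hinj' s hs k hx.1 _ _ hx.2.1 hx.2.2 hy.2.1 hy.2.2 a ha h1), rfl⟩
    · subst h3 h4
      exact .inr (.inl ⟨⟨h2, hstep _ hx _ hy h2 h1⟩, rfl, rfl⟩)
    · subst h3 h4
      exact .inr (.inr ⟨⟨h2, hstep _ hy _ hx h2 h1.symm⟩, rfl, rfl⟩)
  · intro s hs x hx a ha h0
    have := hang s hs x hx a ha
    rw [h0, map_zero] at this
    exact lt_irrefl _ this
  · rintro x hx y hy ⟨h1, -⟩ s hs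
    refine ⟨angularFunctional (nodeTime (Ts s) x.1 1), hang s hs x hx 1 ⟨zero_le_one, le_rfl⟩, ?_⟩
    rw [(hclock s hs).angularFunctional_nodeTime_succ hx.1, ← h1]
    exact hang s hs y hy 0 ⟨le_rfl, zero_le_one⟩

/-! ### Elementary motions of strands -/

/-- The position at time `a` of the strand starting in position `j`, while a letter (`none` for no
crossing) is being performed. -/
noncomputable def motion (l : Option ℕ) (j : ℕ) (a : ℝ) : ℝ × ℝ :=
  match l with
  | none => (j, 0)
  | some i =>
    if j = i then ((i : ℝ) + 1 / 2 - Real.cos (Real.pi * a) / 2, Real.sin (Real.pi * a) / 2)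
    else if j = i + 1 then
      ((i : ℝ) + 1 / 2 + Real.cos (Real.pi * a) / 2, -(Real.sin (Real.pi * a) / 2))
    else (j, 0)

/-- The position in which the strand starting in position `j` ends. -/
def step (l : Option ℕ) (j : ℕ) : ℕ :=
  match l with
  | none => j
  | some i => if j = i then i + 1 else if j = i + 1 then i else j

/-- A letter that can be performed on `N` strands. -/
def ValidLetter (N : ℕ) (l : Option ℕ) : Prop := ∀ i, l = some i → 1 ≤ i ∧ i < N

theorem validLetter_none (N : ℕ) : ValidLetter N none := by simp [ValidLetter]

theorem validLetter_some {N i : ℕ} : ValidLetter N (some i) ↔ 1 ≤ i ∧ i < N := by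
  simp [ValidLetter]

theorem motion_zero (l : Option ℕ) (j : ℕ) : motion l j 0 = ((j : ℝ), 0) := by
  cases l with
  | none => rfl
  | some i =>
    simp only [motion]
    split_ifs with h1 h2
    · subst h1; simp
    · subst h2; ext <;> simp; ring
    · rfl

theorem motion_one (l : Option ℕ) (j : ℕ) : motion l j 1 = ((step l j : ℝ), 0) := by
  cases l with
  | none => rfl
  | some i =>
    simp only [motion, step]
    split_ifs with h1 h2
    · ext <;> simp; ring
    · ext <;> simp; ring
    · rfl

theorem contDiff_motion (l : Option ℕ) (j : ℕ) : ContDiff ℝ 2 (motion l j) := by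
  cases l with
  | none => exact contDiff_const
  | some i =>
    unfold motion
    dsimp only
    split_ifs
    · exact ((contDiff_const.sub ((Real.contDiff_cos.comp (contDiff_const.mul contDiff_id)).div_const
        2))).prodMk ((Real.contDiff_sin.comp (contDiff_const.mul contDiff_id)).div_const 2)
    · exact ((contDiff_const.add ((Real.contDiff_cos.comp (contDiff_const.mul contDiff_id)).div_const
        2))).prodMk ((Real.contDiff_sin.comp (contDiff_const.mul contDiff_id)).div_const 2).neg
    · exact contDiff_const

theorem sin_pi_mul_nonneg {a : ℝ} (ha : a ∈ Icc (0 : ℝ) 1) : 0 ≤ Real.sin (Real.pi * a) := by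
  have := Real.pi_pos
  apply Real.sin_nonneg_of_nonneg_of_le_pi
  · exact mul_nonneg this.le ha.1
  · nlinarith [ha.2]

theorem sin_pi_mul_pos_of_cos {a : ℝ} (ha : a ∈ Icc (0 : ℝ) 1) (h : Real.cos (Real.pi * a) = 0) :
    0 < Real.sin (Real.pi * a) := by
  have h1 := sin_pi_mul_nonneg ha
  have h2 := Real.sin_sq_add_cos_sq (Real.pi * a)
  rw [h] at h2
  nlinarith

theorem motion_other {i j : ℕ} (h1 : j ≠ i) (h2 : j ≠ i + 1) (a : ℝ) :
    motion (some i) j a = ((j : ℝ), 0) := by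
  simp [motion, h1, h2]

theorem motion_left (i : ℕ) (a : ℝ) : motion (some i) i a =
    ((i : ℝ) + 1 / 2 - Real.cos (Real.pi * a) / 2, Real.sin (Real.pi * a) / 2) := by
  simp [motion]

theorem motion_right (i : ℕ) (a : ℝ) : motion (some i) (i + 1) a =
    ((i : ℝ) + 1 / 2 + Real.cos (Real.pi * a) / 2, -(Real.sin (Real.pi * a) / 2)) := by
  simp [motion]

theorem motion_left_mem (i : ℕ) (a : ℝ) :
    (i : ℝ) ≤ (motion (some i) i a).1 ∧ (motion (some i) i a).1 ≤ i + 1 := by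
  rw [motion_left]
  have h1 := Real.cos_le_one (Real.pi * a)
  have h2 := Real.neg_one_le_cos (Real.pi * a)
  constructor <;> dsimp only <;> linarith

theorem motion_right_mem (i : ℕ) (a : ℝ) :
    (i : ℝ) ≤ (motion (some i) (i + 1) a).1 ∧ (motion (some i) (i + 1) a).1 ≤ i + 1 := by
  rw [motion_right]
  have h1 := Real.cos_le_one (Real.pi * a)
  have h2 := Real.neg_one_le_cos (Real.pi * a)
  constructor <;> dsimp only <;> linarith

/-- Positions at possibly different times: strands are ordered unless they are crossing. -/
theorem motion_fst_lt {l : Option ℕ} {j j' : ℕ} (hj : j < j')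
    (hne : ¬ (l = some j ∧ j' = j + 1)) (a b : ℝ) : (motion l j a).1 < (motion l j' b).1 := by
  have hc : (j : ℝ) + 1 ≤ j' := by exact_mod_cast hj
  cases l with
  | none => simp only [motion]; linarith
  | some i =>
    by_cases h1 : j = i
    · subst h1
      have h2 : j' ≠ j + 1 := fun h => hne ⟨rfl, h⟩
      rw [motion_other (by omega) h2]
      have := (motion_left_mem j a).2
      have : (j : ℝ) + 1 < j' := by exact_mod_cast (by omega : j + 1 < j')
      dsimp only
      linarith
    by_cases h2 : j = i + 1
    · subst h2
      rw [motion_other (j := j') (by omega) (by omega)]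
      have := (motion_right_mem i a).2
      push_cast at hc
      dsimp only
      linarith
    rw [motion_other h1 h2]
    by_cases h3 : j' = i
    · subst h3
      have := (motion_left_mem j' b).1
      dsimp only
      linarith
    by_cases h4 : j' = i + 1
    · subst h4
      have := (motion_right_mem i b).1
      have : (j : ℝ) + 1 ≤ i := by exact_mod_cast (by omega : j + 1 ≤ i)
      dsimp only
      linarith
    rw [motion_other h3 h4]
    dsimp only
    linarith

/-- Only the crossing pair can share a first coordinate, and then the cosine vanishes and the sine
is positive: the strand coming from the left passes above. -/
theorem motion_over {l : Option ℕ} {j j' : ℕ} (hj : j < j') {a : ℝ} (ha : a ∈ Icc (0 : ℝ) 1)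
    (h : (motion l j a).1 = (motion l j' a).1) : (motion l j' a).2 < (motion l j a).2 := by
  by_cases hne : l = some j ∧ j' = j + 1
  · obtain ⟨rfl, rfl⟩ := hne
    rw [motion_left, motion_right] at h ⊢
    dsimp only at h ⊢
    have := sin_pi_mul_pos_of_cos ha (by linarith)
    linarith
  · exact absurd h (motion_fst_lt hj hne a a).ne

theorem motion_ne {l : Option ℕ} {j j' : ℕ} (hj : j < j') {a : ℝ} (ha : a ∈ Icc (0 : ℝ) 1) :
    motion l j a ≠ motion l j' a := fun h =>
  (motion_over hj ha (congrArg Prod.fst h)).ne' (congrArg Prod.snd h)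

theorem motion_fst_ge {N : ℕ} {l : Option ℕ} (hl : ValidLetter N l) {j : ℕ} (hj : 1 ≤ j) (a : ℝ) :
    1 ≤ (motion l j a).1 := by
  cases l with
  | none => simpa [motion] using hj
  | some i =>
    have hi : (1 : ℝ) ≤ i := by exact_mod_cast (hl i rfl).1
    by_cases h1 : j = i
    · subst h1; exact hi.trans (motion_left_mem j a).1
    by_cases h2 : j = i + 1
    · subst h2; exact hi.trans (motion_right_mem i a).1
    rw [motion_other h1 h2]
    dsimp only
    exact_mod_cast hj

theorem step_mem {N : ℕ} {l : Option ℕ} (hl : ValidLetter N l) {j : ℕ} (hj : 1 ≤ j ∧ j ≤ N) :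
    1 ≤ step l j ∧ step l j ≤ N := by
  cases l with
  | none => exact hj
  | some i =>
    have := hl i rfl
    simp only [step]
    split_ifs <;> omega

theorem step_step (l : Option ℕ) (j : ℕ) : step l (step l j) = j := by
  cases l with
  | none => rfl
  | some i =>
    simp only [step]
    split_ifs <;> omega

/-! ### Closed braids as links made of pieces -/

/-- Equal time intervals. -/
noncomputable def uniformClock (ℓ k : ℕ) : ℝ := (k : ℝ) / ℓ

theorem isClock_uniform {ℓ : ℕ} (hℓ : 0 < ℓ) : IsClock ℓ (uniformClock ℓ) where
  pos := hℓ
  zero := by simp [uniformClock]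
  last := by
    have : (ℓ : ℝ) ≠ 0 := by positivity
    simp [uniformClock, this]
  lt := by
    intro k _
    have : (0 : ℝ) < ℓ := by positivity
    simp only [uniformClock]
    gcongr
    simp

theorem nodeTime_uniform (ℓ k : ℕ) (a : ℝ) : nodeTime (uniformClock ℓ) k a = (k + a) / ℓ := by
  simp only [nodeTime, uniformClock]
  push_cast
  ring

/-- The closed braid of a word in which `none` stands for an idle time interval. -/
noncomputable def optLink (N : ℕ) (w : List (Option ℕ)) : Set Space :=
  pieceLink w.length N (uniformClock w.length) fun k => motion (w.getD k none)

/-- All letters of the word can be performed on `N` strands. -/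
def ValidWord (N : ℕ) (w : List (Option ℕ)) : Prop := ∀ l ∈ w, ValidLetter N l

theorem ValidWord.getD {N : ℕ} {w : List (Option ℕ)} (hw : ValidWord N w) (k : ℕ) :
    ValidLetter N (w.getD k none) := by
  rcases lt_or_ge k w.length with h | h
  · rw [List.getD_eq_getElem _ _ h]
    exact hw _ (List.getElem_mem h)
  · rw [List.getD_eq_default _ _ h]
    exact validLetter_none N

theorem letterSection_eq {N : ℕ} {l : Option ℕ} (hl : ValidLetter N l) (a : ℝ) :
    letterSection N l a = {c | ∃ j, (1 ≤ j ∧ j ≤ N) ∧ c = motion l j a} := by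
  cases l with
  | none =>
    ext c
    simp only [letterSection, motion, mem_ofPred_eq, and_assoc]
  | some i =>
    have hi := hl i rfl
    ext c
    simp only [letterSection, mem_union, mem_ofPred_eq, mem_insert_iff, mem_singleton_iff]
    constructor
    · rintro (⟨j, h1, h2, h3, h4, rfl⟩ | rfl | rfl)
      · exact ⟨j, ⟨h1, h2⟩, (motion_other h3 h4 a).symm⟩
      · exact ⟨i + 1, by omega, (motion_right i a).symm⟩
      · exact ⟨i, by omega, (motion_left i a).symm⟩
    · rintro ⟨j, hj, rfl⟩
      by_cases h1 : j = i
      · subst h1; exact .inr (.inr (motion_left j a))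
      by_cases h2 : j = i + 1
      · subst h2; exact .inr (.inl (motion_right i a))
      exact .inl ⟨j, hj.1, hj.2, h1, h2, motion_other h1 h2 a⟩

theorem validWord_map_some {N : ℕ} {w : List ℕ} :
    ValidWord N (w.map some) ↔ ∀ i ∈ w, 1 ≤ i ∧ i < N := by
  simp [ValidWord, validLetter_some]

theorem getD_map_some (w : List ℕ) (k : ℕ) : (w.map some).getD k none = w[k]? := by
  rw [List.getD_eq_getElem?_getD, List.getElem?_map]
  cases w[k]? <;> rfl

theorem mem_closedBraid_iff {N : ℕ} {w : List ℕ} (hw : ∀ i ∈ w, 1 ≤ i ∧ i < N) {P : Space} :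
    P ∈ closedBraid N w ↔ ∃ t ∈ Icc (0 : ℝ) 1, ∃ j, (1 ≤ j ∧ j ≤ N) ∧
      P = wrap t (motion w[⌊w.length * t⌋₊]? j (w.length * t - ⌊w.length * t⌋₊)) := by
  have hv : ∀ k : ℕ, ValidLetter N w[k]? := by
    intro k
    rw [← getD_map_some]
    exact (validWord_map_some.2 hw).getD k
  simp only [closedBraid, letterSection_eq (hv _), mem_ofPred_eq]
  constructor
  · rintro ⟨t, ht, c, ⟨j, hj, rfl⟩, rfl⟩
    exact ⟨t, ht, j, hj, rfl⟩
  · rintro ⟨t, ht, j, hj, rfl⟩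
    exact ⟨t, ht, _, ⟨j, hj, rfl⟩, rfl⟩

/-- The floor in the definition cuts time into half-open intervals, the pieces use closed ones; the
discrepancies lie at interval ends, where consecutive pieces agree. -/
theorem closedBraid_eq_optLink {N : ℕ} {w : List ℕ} (hw : ∀ i ∈ w, 1 ≤ i ∧ i < N) (hne : w ≠ []) :
    closedBraid N w = optLink N (w.map some) := by
  have hv := (validWord_map_some (w := w)).2 hw
  have hpos : 0 < w.length := List.length_pos_iff.2 hne
  have hposR : (0 : ℝ) < w.length := by exact_mod_cast hpos
  ext P
  rw [mem_closedBraid_iff hw]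
  simp only [optLink, pieceLink, List.length_map, nodeTime_uniform, mem_ofPred_eq, getD_map_some]
  constructor
  · rintro ⟨t, ht, j, hj, rfl⟩
    have h0 : 0 ≤ w.length * t := mul_nonneg hposR.le ht.1
    -- At t = 1 the floor is past the last letter and the lookup gives the default `none`; the point
    -- also lies at the start of the first piece.
    rcases ht.2.eq_or_lt with rfl | hlt
    · refine ⟨0, hpos, j, hj, 0, ⟨le_rfl, zero_le_one⟩, ?_⟩
      rw [mul_one, Nat.floor_natCast, sub_self, motion_zero, motion_zero, wrap_one]
      simp
    · have h1 := Nat.floor_le h0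
      have h2 := Nat.lt_floor_add_one (w.length * t)
      refine ⟨⌊w.length * t⌋₊, (Nat.floor_lt h0).2 (by nlinarith), j, hj, _,
        ⟨sub_nonneg.2 h1, by linarith⟩, ?_⟩
      congr 1
      field_simp
      ring
  · rintro ⟨k, hk, j, hj, a, ha, rfl⟩
    have hkR : (k : ℝ) + 1 ≤ w.length := by exact_mod_cast hk
    have hmem : ((k : ℝ) + a) / w.length ∈ Icc (0 : ℝ) 1 :=
      ⟨div_nonneg (by linarith [ha.1, k.cast_nonneg (α := ℝ)]) hposR.le,
        (div_le_one hposR).2 (by linarith [ha.2])⟩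
    have hval : w.length * (((k : ℝ) + a) / w.length) = k + a := by field_simp
    -- At a = 1 the floor already designates the next letter, so the strand must be named by the
    -- position it has reached.
    rcases ha.2.eq_or_lt with rfl | hlt
    · have hstep := step_mem (hv.getD k) hj
      rw [getD_map_some] at hstep
      refine ⟨_, hmem, _, hstep, ?_⟩
      have hfl : ⌊(k : ℝ) + 1⌋₊ = k + 1 := by exact_mod_cast Nat.floor_natCast (R := ℝ) (k + 1)
      rw [hval, hfl, motion_one]
      push_cast
      rw [sub_self, motion_zero]
    · refine ⟨_, hmem, j, hj, ?_⟩
      have hfl : ⌊(k : ℝ) + a⌋₊ = k := by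
        rw [Nat.floor_eq_iff (by linarith [ha.1, k.cast_nonneg (α := ℝ)])]
        constructor <;> linarith [ha.1]
      rw [hval, hfl, add_sub_cancel_left]

/-- A clock needs at least one interval, so the empty word is represented by a single idle one. -/
theorem closedBraid_nil (N : ℕ) : closedBraid N [] = optLink N [none] := by
  ext P
  rw [mem_closedBraid_iff (by simp)]
  simp only [optLink, pieceLink, nodeTime_uniform, mem_ofPred_eq]
  constructor
  · rintro ⟨t, ht, j, hj, rfl⟩
    exact ⟨0, by simp, j, hj, t, ht, by simp [motion]⟩
  · rintro ⟨k, hk, j, hj, a, ha, rfl⟩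
    obtain rfl : k = 0 := by simpa using hk
    exact ⟨a, ha, j, hj, by simp [motion]⟩

/-! ### Conjugation as rotation about the axis -/

/-- Rotation about the axis by the angle `2πα`. -/
noncomputable def axisRotation (α : ℝ) : Space ≃ₜ Space where
  toFun P := (Complex.exp (2 * Real.pi * α * Complex.I) * P.1, P.2)
  invFun P := (Complex.exp (-(2 * Real.pi * α * Complex.I)) * P.1, P.2)
  left_inv P := by
    ext1
    · simp only
      rw [← mul_assoc, ← Complex.exp_add, neg_add_cancel, Complex.exp_zero, one_mul]
    · rfl
  right_inv P := by
    ext1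
    · simp only
      rw [← mul_assoc, ← Complex.exp_add, add_neg_cancel, Complex.exp_zero, one_mul]
    · rfl
  continuous_toFun := by fun_prop
  continuous_invFun := by fun_prop

theorem axisRotation_wrap (α t : ℝ) (c : ℝ × ℝ) :
    axisRotation α (wrap t c) = wrap (α + t) c := by
  simp only [axisRotation, wrap]
  refine Prod.ext ?_ rfl
  change Complex.exp _ * (_ * Complex.exp _) = _
  rw [mul_left_comm, ← Complex.exp_add]
  push_cast
  ring_nf

theorem linkEquiv_axisRotation (α : ℝ) (L : Set Space) : LinkEquiv L (axisRotation α '' L) := by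
  refine ⟨fun t => axisRotation (t * α), ?_, ?_, ?_⟩
  · change Continuous fun x : unitInterval × Space =>
      (Complex.exp (2 * Real.pi * ((x.1 * α : ℝ) : ℂ) * Complex.I) * x.2.1, x.2.2)
    fun_prop
  · ext P <;> simp [axisRotation]
  · simp

theorem wrap_add_one (t : ℝ) (c : ℝ × ℝ) : wrap (t + 1) c = wrap t c := by
  have : (2 * Real.pi * ((t + 1 : ℝ) : ℂ) * Complex.I : ℂ)
      = 2 * Real.pi * t * Complex.I + 2 * Real.pi * Complex.I := by push_cast; ring
  simp only [wrap, this, Complex.exp_add, Complex.exp_two_pi_mul_I, mul_one]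

/-- Turning back by one time interval makes the first letter the last; its piece lands at negative
times and is brought back by a full turn. -/
theorem linkEquiv_optLink_rotate (N : ℕ) (l : Option ℕ) (w : List (Option ℕ)) :
    LinkEquiv (optLink N (l :: w)) (optLink N (w ++ [l])) := by
  convert linkEquiv_axisRotation (-(1 / (w.length + 1 : ℝ))) (optLink N (l :: w)) using 1
  have hpos : (0 : ℝ) < (w.length : ℝ) + 1 := by positivity
  ext P
  simp only [optLink, pieceLink, nodeTime_uniform, mem_ofPred_eq, mem_image, List.length_append,
    List.length_cons, List.length_nil, zero_add]
  constructor
  · rintro ⟨k, hk, j, hj, a, ha, rfl⟩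
    rcases (Nat.lt_succ_iff.1 hk).eq_or_lt with rfl | hlt
    · refine ⟨_, ⟨0, by omega, j, hj, a, ha, rfl⟩, ?_⟩
      rw [axisRotation_wrap, ← wrap_add_one]
      congr 1
      · push_cast; field_simp; ring
      · simp
    · refine ⟨_, ⟨k + 1, by omega, j, hj, a, ha, rfl⟩, ?_⟩
      rw [axisRotation_wrap]
      congr 1
      · push_cast; field_simp; ring
      · simp [List.getElem?_append_left hlt]
  · rintro ⟨_, ⟨k, hk, j, hj, a, ha, rfl⟩, rfl⟩
    rcases k with _ | k
    · refine ⟨w.length, by omega, j, hj, a, ha, ?_⟩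
      rw [axisRotation_wrap, ← wrap_add_one (_ + _)]
      congr 1
      · push_cast; field_simp; ring
      · simp
    · have hlt : k < w.length := by omega
      refine ⟨k, by omega, j, hj, a, ha, ?_⟩
      rw [axisRotation_wrap]
      congr 1
      · push_cast; field_simp; ring
      · simp [List.getElem?_append_left hlt]

/-! ### Layered blocks -/

/-- The motion of strands labelled by their initial positions during `m` time intervals, from the
standard configuration to itself, with `π` the resulting permutation. -/
structure IsBlock (m N : ℕ) (π : ℕ → ℕ) (B : ℕ → ℕ → ℝ → ℝ × ℝ) : Prop where
  length_pos : 0 < m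
  smooth : ∀ k < m, ∀ j, ContDiff ℝ 2 (B k j)
  pos : ∀ k < m, ∀ j, 1 ≤ j → j ≤ N → ∀ a ∈ Icc (0 : ℝ) 1, 0 < (B k j a).1
  start : ∀ j, 1 ≤ j → j ≤ N → B 0 j 0 = ((j : ℝ), 0)
  glue : ∀ k, k + 1 < m → ∀ j, 1 ≤ j → j ≤ N → B k j 1 = B (k + 1) j 0
  last : ∀ j, 1 ≤ j → j ≤ N → B (m - 1) j 1 = ((π j : ℝ), 0)
  maps : ∀ j, 1 ≤ j → j ≤ N → 1 ≤ π j ∧ π j ≤ N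

/-- Whenever two strands cross, the one with the smaller label passes above. -/
def IsLayered (m N : ℕ) (B : ℕ → ℕ → ℝ → ℝ × ℝ) : Prop :=
  ∀ k < m, ∀ j j', 1 ≤ j → j < j' → j' ≤ N → ∀ a ∈ Icc (0 : ℝ) 1,
    (B k j a).1 = (B k j' a).1 → (B k j' a).2 < (B k j a).2

/-- A block followed by the letters of a word. -/
noncomputable def blockPieces (m : ℕ) (B : ℕ → ℕ → ℝ → ℝ × ℝ) (y : List (Option ℕ)) (k : ℕ) :
    ℕ → ℝ → ℝ × ℝ :=
  if k < m then B k else motion (y.getD (k - m) none)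

noncomputable def blockLink (m N : ℕ) (B : ℕ → ℕ → ℝ → ℝ × ℝ) (y : List (Option ℕ)) : Set Space :=
  pieceLink (m + y.length) N (uniformClock (m + y.length)) (blockPieces m B y)

theorem contDiff_blockPieces {m N : ℕ} {π : ℕ → ℕ} {B : ℕ → ℕ → ℝ → ℝ × ℝ} (hB : IsBlock m N π B)
    (y : List (Option ℕ)) (k j : ℕ) : ContDiff ℝ 2 (blockPieces m B y k j) := by
  unfold blockPieces
  split_ifs with h
  · exact hB.smooth k h j
  · exact contDiff_motion _ _

theorem blockPieces_pos {m N : ℕ} {π : ℕ → ℕ} {B : ℕ → ℕ → ℝ → ℝ × ℝ} (hB : IsBlock m N π B)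
    {y : List (Option ℕ)} (hy : ValidWord N y) (k j : ℕ) (hj : 1 ≤ j) (hj' : j ≤ N) (a : ℝ)
    (ha : a ∈ Icc (0 : ℝ) 1) : 0 < (blockPieces m B y k j a).1 := by
  unfold blockPieces
  split_ifs with h
  · exact hB.pos k h j hj hj' a ha
  · exact zero_lt_one.trans_le (motion_fst_ge (hy.getD _) hj a)

theorem blockPieces_start {m N : ℕ} {π : ℕ → ℕ} {B : ℕ → ℕ → ℝ → ℝ × ℝ} (hB : IsBlock m N π B)
    (y : List (Option ℕ)) {k : ℕ} (hk : k = 0 ∨ m ≤ k) {j : ℕ} (hj : 1 ≤ j) (hj' : j ≤ N) :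
    blockPieces m B y k j 0 = ((j : ℝ), 0) := by
  unfold blockPieces
  split_ifs with h
  · obtain rfl : k = 0 := by omega
    exact hB.start j hj hj'
  · exact motion_zero _ _

/-- The strand reached at the end of a piece depends only on the permutation of the block. -/
theorem blockPieces_glue {m N : ℕ} {π : ℕ → ℕ} {y : List (Option ℕ)} (hy : ValidWord N y)
    {k : ℕ} (hk : k < m + y.length) {j : ℕ} (hj : 1 ≤ j) (hj' : j ≤ N) {B B' : ℕ → ℕ → ℝ → ℝ × ℝ}
    (hB : IsBlock m N π B) (hB' : IsBlock m N π B') : ∃ j', (1 ≤ j' ∧ j' ≤ N) ∧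
      blockPieces m B y k j 1 = blockPieces m B y ((k + 1) % (m + y.length)) j' 0 ∧
      blockPieces m B' y k j 1 = blockPieces m B' y ((k + 1) % (m + y.length)) j' 0 := by
  have hm := hB.length_pos
  by_cases h : k + 1 < m
  · refine ⟨j, ⟨hj, hj'⟩, ?_⟩
    rw [Nat.mod_eq_of_lt (by omega)]
    simp only [blockPieces, h, if_true, show k < m by omega]
    exact ⟨hB.glue k h j hj hj', hB'.glue k h j hj hj'⟩
  · have hnext : (k + 1) % (m + y.length) = 0 ∨ m ≤ (k + 1) % (m + y.length) := by
      rcases (show k + 1 ≤ m + y.length from hk).eq_or_lt with h' | h'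
      · left; rw [h', Nat.mod_self]
      · right; rw [Nat.mod_eq_of_lt h']; omega
    by_cases h2 : k < m
    · obtain rfl : k = m - 1 := by omega
      obtain ⟨h3, h4⟩ := hB.maps j hj hj'
      refine ⟨π j, ⟨h3, h4⟩, ?_⟩
      rw [blockPieces_start hB y hnext h3 h4, blockPieces_start hB' y hnext h3 h4]
      simp only [blockPieces, h2, if_true]
      exact ⟨hB.last j hj hj', hB'.last j hj hj'⟩
    · obtain ⟨h3, h4⟩ := step_mem (hy.getD (k - m)) ⟨hj, hj'⟩
      refine ⟨_, ⟨h3, h4⟩, ?_⟩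
      rw [blockPieces_start hB y hnext h3 h4, blockPieces_start hB' y hnext h3 h4]
      simp only [blockPieces, h2, if_false, motion_one, and_self]

theorem convex_self (s : ℝ) (x : ℝ × ℝ) : (1 - s) • x + s • x = x := by
  rw [← add_smul, sub_add_cancel, one_smul]

theorem linkEquiv_blockLink {m N : ℕ} {π : ℕ → ℕ} {y : List (Option ℕ)} (hy : ValidWord N y)
    {B B' : ℕ → ℕ → ℝ → ℝ × ℝ} (hB : IsBlock m N π B) (hB' : IsBlock m N π B')
    (h : ∀ s ∈ Icc (0 : ℝ) 1, ∀ k < m, ∀ j j', 1 ≤ j → j < j' → j' ≤ N → ∀ a ∈ Icc (0 : ℝ) 1,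
      (1 - s) • B k j a + s • B' k j a ≠ (1 - s) • B k j' a + s • B' k j' a) :
    LinkEquiv (blockLink m N B y) (blockLink m N B' y) := by
  have hclock := isClock_uniform (show 0 < m + y.length by have := hB.length_pos; omega)
  refine linkEquiv_pieceLink hclock hclock (fun k _ j => contDiff_blockPieces hB y k j)
    (fun k _ j => contDiff_blockPieces hB' y k j) (fun k _ j h1 h2 a ha =>
      ⟨blockPieces_pos hB hy k j h1 h2 a ha, blockPieces_pos hB' hy k j h1 h2 a ha⟩)
    (fun k hk j h1 h2 => blockPieces_glue hy hk h1 h2 hB hB') ?_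
  intro s hs k _ j j' h1 h2 h3 a ha
  by_cases hk : k < m
  · simp only [blockPieces, hk, if_true]
    exact h s hs k hk j j' h1 h2 h3 a ha
  · simp only [blockPieces, hk, if_false, convex_self]
    exact motion_ne h2 ha

/-- The same motion in plan, at heights depending only on the label and on time. -/
def flatBlock (m : ℕ) (B : ℕ → ℕ → ℝ → ℝ × ℝ) (k j : ℕ) (a : ℝ) : ℝ × ℝ :=
  ((B k j a).1, -(((k : ℝ) + a) * (m - k - a) * j))

theorem IsBlock.flat {m N : ℕ} {π : ℕ → ℕ} {B : ℕ → ℕ → ℝ → ℝ × ℝ} (hB : IsBlock m N π B) :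
    IsBlock m N π (flatBlock m B) where
  length_pos := hB.length_pos
  smooth := by
    intro k hk j
    have h1 := (hB.smooth k hk j).fst
    have h2 : ContDiff ℝ 2 fun a : ℝ => -(((k : ℝ) + a) * (m - k - a) * j) := by fun_prop
    exact h1.prodMk h2
  pos := hB.pos
  start := by
    intro j h1 h2
    simp [flatBlock, hB.start j h1 h2]
  glue := by
    intro k hk j h1 h2
    simp only [flatBlock, hB.glue k hk j h1 h2]
    push_cast
    ring_nf
  last := by
    intro j h1 h2
    have : ((m - 1 : ℕ) : ℝ) = m - 1 := by
      rw [Nat.cast_sub hB.length_pos, Nat.cast_one]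
    simp [flatBlock, hB.last j h1 h2, this]
  maps := hB.maps

theorem height_nonneg {m k : ℕ} (hk : k < m) {a : ℝ} (ha : a ∈ Icc (0 : ℝ) 1) :
    0 ≤ ((k : ℝ) + a) * (m - k - a) := by
  have : (k : ℝ) + 1 ≤ m := by exact_mod_cast hk
  exact mul_nonneg (add_nonneg k.cast_nonneg ha.1) (by linarith [ha.2])

theorem ends_of_height_eq_zero {m k : ℕ} (hk : k < m) {a : ℝ} (ha : a ∈ Icc (0 : ℝ) 1)
    (h : ((k : ℝ) + a) * (m - k - a) = 0) : (k = 0 ∧ a = 0) ∨ (k = m - 1 ∧ a = 1) := by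
  have hk1 : (k : ℝ) + 1 ≤ m := by exact_mod_cast hk
  have hk0 : (0 : ℝ) ≤ k := k.cast_nonneg
  rcases mul_eq_zero.1 h with h | h
  · have h1 : a = 0 := by linarith [ha.1]
    have h2 : (k : ℝ) = 0 := by linarith
    exact .inl ⟨by exact_mod_cast h2, h1⟩
  · have h1 : a = 1 := by linarith [ha.2]
    have h2 : (m : ℝ) = k + 1 := by linarith
    have h3 : m = k + 1 := by exact_mod_cast h2
    exact .inr ⟨by omega, h1⟩

/-- Two strands with a common end would lie there at the same height 0, against the strict ordering
of layers. -/
theorem IsBlock.ends_ne {m N : ℕ} {π : ℕ → ℕ} {B : ℕ → ℕ → ℝ → ℝ × ℝ} (hB : IsBlock m N π B)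
    (hl : IsLayered m N B) {j j' : ℕ} (h1 : 1 ≤ j) (h2 : j < j') (h3 : j' ≤ N) : π j ≠ π j' := by
  intro h
  have hm := hB.length_pos
  have := hl (m - 1) (by omega) j j' h1 h2 h3 1 ⟨zero_le_one, le_rfl⟩
  rw [hB.last j h1 (by omega), hB.last j' (by omega) h3, h] at this
  exact lt_irrefl _ (this rfl)

/-- Only heights change. Where two strands coincide in plan, the smaller label is above in both
blocks, hence also in every convex combination. -/
theorem linkEquiv_flatBlock {m N : ℕ} {π : ℕ → ℕ} {y : List (Option ℕ)} (hy : ValidWord N y)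
    {B : ℕ → ℕ → ℝ → ℝ × ℝ} (hB : IsBlock m N π B) (hl : IsLayered m N B) :
    LinkEquiv (blockLink m N B y) (blockLink m N (flatBlock m B) y) := by
  refine linkEquiv_blockLink hy hB hB.flat ?_
  intro s hs k hk j j' h1 h2 h3 a ha heq
  have e1 := congrArg Prod.fst heq
  have e2 := congrArg Prod.snd heq
  simp only [flatBlock, Prod.fst_add, Prod.smul_fst, Prod.snd_add, Prod.smul_snd,
    smul_eq_mul] at e1 e2
  have e3 : (B k j a).1 = (B k j' a).1 := by linarith
  have e4 := hl k hk j j' h1 h2 h3 a ha e3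
  have hjj : (j : ℝ) < j' := by exact_mod_cast h2
  have hβ := height_nonneg hk ha
  -- The factor separating the layers vanishes only at the two ends of the block, where the strands
  -- are already apart in plan.
  have hβpos : 0 < ((k : ℝ) + a) * (m - k - a) := by
    refine lt_of_le_of_ne hβ fun h0 => ?_
    rcases ends_of_height_eq_zero hk ha h0.symm with ⟨rfl, rfl⟩ | ⟨rfl, rfl⟩
    · rw [hB.start j h1 (by omega), hB.start j' (by omega) h3] at e3
      exact hjj.ne e3
    · rw [hB.last j h1 (by omega), hB.last j' (by omega) h3] at e3
      exact hB.ends_ne hl h1 h2 h3 (Nat.cast_injective (R := ℝ) e3)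
  have h5 : 0 < ((k : ℝ) + a) * (m - k - a) * (j' - j) := mul_pos hβpos (by linarith)
  rcases hs.1.eq_or_lt with rfl | hs0
  · simp only [sub_zero, one_mul, zero_mul, add_zero] at e2
    linarith
  · have h6 := mul_pos hs0 h5
    have h7 := mul_nonneg (by linarith [hs.2] : 0 ≤ 1 - s) (sub_pos.2 e4).le
    nlinarith

/-- Two layered blocks with the same permutation are isotopic. -/
theorem linkEquiv_of_isLayered {m N : ℕ} {π : ℕ → ℕ} {y : List (Option ℕ)} (hy : ValidWord N y)
    {B B' : ℕ → ℕ → ℝ → ℝ × ℝ} (hB : IsBlock m N π B) (hB' : IsBlock m N π B')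
    (hl : IsLayered m N B) (hl' : IsLayered m N B') :
    LinkEquiv (blockLink m N B y) (blockLink m N B' y) := by
  refine (linkEquiv_flatBlock hy hB hl).trans
    (LinkEquiv.trans ?_ (linkEquiv_flatBlock hy hB' hl').symm)
  -- In the two flat blocks a label has the same height at the same time. So distinct labels stay
  -- separated vertically whatever happens in plan, except at the ends, where both blocks occupy the
  -- same positions.
  refine linkEquiv_blockLink hy hB.flat hB'.flat ?_
  intro s hs k hk j j' h1 h2 h3 a ha heq
  have hjj : (j : ℝ) < j' := by exact_mod_cast h2
  have e2 := congrArg Prod.snd heq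
  simp only [flatBlock, Prod.snd_add, Prod.smul_snd, smul_eq_mul] at e2
  have h0 : ((k : ℝ) + a) * (m - k - a) = 0 := by
    have : ((k : ℝ) + a) * (m - k - a) * ((j' : ℝ) - j) = 0 := by linarith
    exact (mul_eq_zero.1 this).resolve_right (by linarith)
  rcases ends_of_height_eq_zero hk ha h0 with ⟨rfl, rfl⟩ | ⟨rfl, rfl⟩
  · rw [hB.flat.start j h1 (by omega), hB.flat.start j' (by omega) h3,
      hB'.flat.start j h1 (by omega), hB'.flat.start j' (by omega) h3, convex_self,
      convex_self] at heq
    exact hjj.ne (congrArg Prod.fst heq)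
  · rw [hB.flat.last j h1 (by omega), hB.flat.last j' (by omega) h3,
      hB'.flat.last j h1 (by omega), hB'.flat.last j' (by omega) h3, convex_self,
      convex_self] at heq
    have := congrArg Prod.fst heq
    exact hB.ends_ne hl h1 h2 h3 (Nat.cast_injective (R := ℝ) this)

/-- The position after `k` letters of the strand starting in position `j`. -/
def track (x : List (Option ℕ)) : ℕ → ℕ → ℕ
  | 0, j => j
  | k + 1, j => step (x.getD k none) (track x k j)

/-- The block of a word. -/
noncomputable def wordBlock (x : List (Option ℕ)) (k j : ℕ) (a : ℝ) : ℝ × ℝ :=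
  motion (x.getD k none) (track x k j) a

theorem track_mem {N : ℕ} {x : List (Option ℕ)} (hx : ValidWord N x) (k : ℕ) {j : ℕ}
    (hj : 1 ≤ j ∧ j ≤ N) : 1 ≤ track x k j ∧ track x k j ≤ N := by
  induction k with
  | zero => exact hj
  | succ k ih => exact step_mem (hx.getD k) ih

theorem exists_track_eq {N : ℕ} {x : List (Option ℕ)} (hx : ValidWord N x) (k : ℕ) {j : ℕ}
    (hj : 1 ≤ j ∧ j ≤ N) : ∃ i, (1 ≤ i ∧ i ≤ N) ∧ track x k i = j := by
  induction k generalizing j with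
  | zero => exact ⟨j, hj, rfl⟩
  | succ k ih =>
    obtain ⟨i, hi, h⟩ := ih (step_mem (hx.getD k) hj)
    exact ⟨i, hi, by rw [track, h, step_step]⟩

theorem track_injective (x : List (Option ℕ)) (k : ℕ) : Function.Injective (track x k) := by
  induction k with
  | zero => exact fun _ _ h => h
  | succ k ih =>
    intro i j h
    apply ih
    rw [← step_step (x.getD k none) (track x k i), ← step_step (x.getD k none) (track x k j)]
    exact congrArg _ h

theorem isBlock_wordBlock {N : ℕ} {x : List (Option ℕ)} (hx : ValidWord N x) (hne : x ≠ []) :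
    IsBlock x.length N (track x x.length) (wordBlock x) where
  length_pos := List.length_pos_iff.2 hne
  smooth := fun _ _ _ => contDiff_motion _ _
  pos := fun k _ j h1 h2 a _ =>
    zero_lt_one.trans_le (motion_fst_ge (hx.getD k) (track_mem hx k ⟨h1, h2⟩).1 a)
  start := fun j _ _ => motion_zero _ _
  glue := fun k _ j _ _ => (motion_one _ _).trans (motion_zero _ _).symm
  last := by
    intro j _ _
    have h := List.length_pos_iff.2 hne
    rw [wordBlock, motion_one]
    conv_rhs => rw [show x.length = (x.length - 1) + 1 by omega]
    rfl
  maps := fun j h1 h2 => track_mem hx _ ⟨h1, h2⟩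

/-- Strands of the prefix are renamed by their initial positions; `track` permutes the positions at
every time, so the point set is unchanged. -/
theorem optLink_append {N : ℕ} {x : List (Option ℕ)} (hx : ValidWord N x) (y : List (Option ℕ)) :
    optLink N (x ++ y) = blockLink x.length N (wordBlock x) y := by
  ext P
  simp only [optLink, blockLink, pieceLink, List.length_append, blockPieces, mem_ofPred_eq]
  constructor
  · rintro ⟨k, hk, j, hj, a, ha, rfl⟩
    by_cases h : k < x.length
    · obtain ⟨i, hi, rfl⟩ := exists_track_eq hx k hj
      exact ⟨k, hk, i, hi, a, ha, by simp [h, wordBlock, List.getElem?_append_left h]⟩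
    · exact ⟨k, hk, j, hj, a, ha, by simp [h, List.getElem?_append_right (not_lt.1 h)]⟩
  · rintro ⟨k, hk, j, hj, a, ha, rfl⟩
    by_cases h : k < x.length
    · exact ⟨k, hk, _, track_mem hx k hj, a, ha,
        by simp [h, wordBlock, List.getElem?_append_left h]⟩
    · exact ⟨k, hk, j, hj, a, ha, by simp [h, List.getElem?_append_right (not_lt.1 h)]⟩

/-! ### Reduced words and the braid relations -/

/-- No two strands that have already crossed cross again. -/
def IsReducedWord (x : List (Option ℕ)) : Prop :=
  ∀ k < x.length, ∀ j j', j < j' →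
    ¬ (x.getD k none = some (track x k j') ∧ track x k j = track x k j' + 1)

/-- As long as two strands keep their initial order, a crossing takes the smaller label above. Once
the order is reversed, reducedness forbids a crossing and they stay apart in plan. -/
theorem IsReducedWord.isLayered {x : List (Option ℕ)} (hx : IsReducedWord x) (N : ℕ) :
    IsLayered x.length N (wordBlock x) := by
  intro k hk j j' _ hjj _ a ha h
  rcases lt_trichotomy (track x k j) (track x k j') with hlt | heq | hlt
  · exact motion_over hlt ha h
  · exact absurd (track_injective x k heq) hjj.ne
  · exact absurd h.symm (motion_fst_lt hlt (hx k hk j j' hjj) a a).ne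

/-- Both relations of the braid group compare reduced words with the same permutation. Equal lengths
are asked so that the two blocks occupy the same intervals. -/
theorem linkEquiv_of_isReducedWord {N : ℕ} {x x' y : List (Option ℕ)} (hx : ValidWord N x)
    (hx' : ValidWord N x') (hy : ValidWord N y) (hne : x ≠ []) (hlen : x'.length = x.length)
    (ht : track x' x.length = track x x.length) (hr : IsReducedWord x) (hr' : IsReducedWord x') :
    LinkEquiv (optLink N (x ++ y)) (optLink N (x' ++ y)) := by
  have hne' : x' ≠ [] := by
    rintro rfl
    exact hne (List.length_eq_zero_iff.1 hlen.symm)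
  have hB' := isBlock_wordBlock hx' hne'
  have hl' := hr'.isLayered N
  rw [optLink_append hx, optLink_append hx']
  rw [hlen] at hB' hl' ⊢
  rw [ht] at hB'
  exact linkEquiv_of_isLayered hy (isBlock_wordBlock hx hne) hB' (hr.isLayered N) hl'

theorem step_some_cases (i j : ℕ) : (j = i ∧ step (some i) j = i + 1) ∨
    (j = i + 1 ∧ step (some i) j = i) ∨ (j ≠ i ∧ j ≠ i + 1 ∧ step (some i) j = j) := by
  simp only [step]
  split_ifs <;> omega

theorem isReducedWord_pair {i j : ℕ} (h : i ≠ j) : IsReducedWord [some i, some j] := by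
  intro k hk s s' hs
  have hk' : k < 2 := hk
  have h1 := step_some_cases i s
  have h2 := step_some_cases i s'
  interval_cases k <;>
    simp only [track, List.getD_cons_succ, List.getD_cons_zero, Option.some.injEq] <;> omega

theorem isReducedWord_triple {i j : ℕ} (h : j = i + 1 ∨ i = j + 1) :
    IsReducedWord [some i, some j, some i] := by
  intro k hk s s' hs
  have hk' : k < 3 := hk
  have h1 := step_some_cases i s
  have h2 := step_some_cases i s'
  have h3 := step_some_cases j (step (some i) s)
  have h4 := step_some_cases j (step (some i) s')
  interval_cases k <;>
    simp only [track, List.getD_cons_succ, List.getD_cons_zero, Option.some.injEq] <;> omega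

theorem linkEquiv_far_comm {N i j : ℕ} {y : List (Option ℕ)} (hi : 1 ≤ i ∧ i < N)
    (hj : 1 ≤ j ∧ j < N) (hij : i + 2 ≤ j) (hy : ValidWord N y) :
    LinkEquiv (optLink N ([some i, some j] ++ y)) (optLink N ([some j, some i] ++ y)) := by
  refine linkEquiv_of_isReducedWord ?_ ?_ hy (by simp) rfl ?_ (isReducedWord_pair (by omega))
    (isReducedWord_pair (by omega))
  · simp [ValidWord, validLetter_some, hi, hj]
  · simp [ValidWord, validLetter_some, hi, hj]
  · funext s
    have h1 := step_some_cases i s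
    have h2 := step_some_cases j (step (some i) s)
    have h3 := step_some_cases j s
    have h4 := step_some_cases i (step (some j) s)
    simp only [track, List.length_cons, List.length_nil, zero_add, List.getD_cons_succ,
      List.getD_cons_zero]
    omega

theorem linkEquiv_braid_rel {N i : ℕ} {y : List (Option ℕ)} (hi : 1 ≤ i ∧ i + 1 < N)
    (hy : ValidWord N y) :
    LinkEquiv (optLink N ([some i, some (i + 1), some i] ++ y))
      (optLink N ([some (i + 1), some i, some (i + 1)] ++ y)) := by
  refine linkEquiv_of_isReducedWord ?_ ?_ hy (by simp) rfl ?_ (isReducedWord_triple (by omega))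
    (isReducedWord_triple (by omega))
  · simp [ValidWord, validLetter_some]; omega
  · simp [ValidWord, validLetter_some]; omega
  · funext s
    have h1 := step_some_cases i s
    have h2 := step_some_cases (i + 1) (step (some i) s)
    have h3 := step_some_cases i (step (some (i + 1)) (step (some i) s))
    have h4 := step_some_cases (i + 1) s
    have h5 := step_some_cases i (step (some (i + 1)) s)
    have h6 := step_some_cases (i + 1) (step (some i) (step (some (i + 1)) s))
    simp only [track, List.length_cons, List.length_nil, zero_add, List.getD_cons_succ,
      List.getD_cons_zero]
    omega

/-! ### Removal of idle intervals -/

/-- A letter performed at half speed, in two time intervals. -/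
noncomputable def slowBlock (l : Option ℕ) (k j : ℕ) (a : ℝ) : ℝ × ℝ := motion l j ((k + a) / 2)

theorem slow_mem {k : ℕ} (hk : k < 2) {a : ℝ} (ha : a ∈ Icc (0 : ℝ) 1) :
    ((k : ℝ) + a) / 2 ∈ Icc (0 : ℝ) 1 := by
  have hk' : (k : ℝ) ≤ 1 := by exact_mod_cast Nat.lt_succ_iff.1 hk
  have hk0 : (0 : ℝ) ≤ k := k.cast_nonneg
  constructor <;> linarith [ha.1, ha.2]

theorem isBlock_slowBlock {N : ℕ} {l : Option ℕ} (hl : ValidLetter N l) :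
    IsBlock 2 N (step l) (slowBlock l) where
  length_pos := two_pos
  smooth := fun k _ j => (contDiff_motion l j).comp
    (by fun_prop : ContDiff ℝ 2 fun a : ℝ => ((k : ℝ) + a) / 2)
  pos := fun _ _ _ h1 _ _ _ => zero_lt_one.trans_le (motion_fst_ge hl h1 _)
  start := fun j _ _ => by simp [slowBlock, motion_zero]
  glue := fun k _ j _ _ => by simp [slowBlock]
  last := fun j _ _ => by
    have : ((2 - 1 : ℕ) : ℝ) = 1 := by norm_num
    rw [slowBlock, this, ← motion_one]
    norm_num
  maps := fun _ h1 h2 => step_mem hl ⟨h1, h2⟩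

theorem isLayered_slowBlock (N : ℕ) (l : Option ℕ) : IsLayered 2 N (slowBlock l) :=
  fun _ hk _ _ _ h _ _ ha he => motion_over h (slow_mem hk ha) he

/-- Equal time intervals, the first of which is divided into two. -/
noncomputable def splitClock (ℓ : ℕ) : ℕ → ℝ
  | 0 => 0
  | 1 => 1 / (2 * ℓ)
  | k + 2 => ((k : ℝ) + 1) / ℓ

theorem isClock_split (n : ℕ) : IsClock (2 + n) (splitClock (n + 1)) where
  pos := by omega
  zero := rfl
  last := by
    rw [Nat.add_comm 2 n]
    simp only [splitClock]
    push_cast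
    exact div_self (by positivity : (n : ℝ) + 1 ≠ 0)
  lt := by
    have hpos : (0 : ℝ) < ((n + 1 : ℕ) : ℝ) := by positivity
    rintro (_ | _ | k) _
    · simp only [splitClock]; positivity
    · simp only [splitClock]
      rw [Nat.cast_zero, zero_add]
      gcongr
      linarith
    · simp only [splitClock]
      push_cast
      gcongr
      linarith

theorem pieceLink_slowBlock (N : ℕ) (l : Option ℕ) (y : List (Option ℕ)) :
    pieceLink (2 + y.length) N (splitClock (y.length + 1)) (blockPieces 2 (slowBlock l) y) =
      optLink N (l :: y) := by
  have hpos : (0 : ℝ) < (y.length : ℝ) + 1 := by positivity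
  ext P
  simp only [optLink, pieceLink, mem_ofPred_eq, List.length_cons, nodeTime_uniform]
  constructor
  · rintro ⟨k, hk, j, hj, a, ha, rfl⟩
    rcases k with _ | _ | k
    · refine ⟨0, by omega, j, hj, _, slow_mem two_pos ha, ?_⟩
      simp only [blockPieces, two_pos, if_true, slowBlock, nodeTime, splitClock]
      congr 1
      push_cast; field_simp; ring
    · refine ⟨0, by omega, j, hj, _, slow_mem one_lt_two ha, ?_⟩
      simp only [blockPieces, zero_add, one_lt_two, if_true, slowBlock, nodeTime, splitClock]
      congr 1
      push_cast; field_simp; ring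
    · refine ⟨k + 1, by omega, j, hj, a, ha, ?_⟩
      simp only [blockPieces, nodeTime, splitClock]
      congr 1
      push_cast; field_simp; ring
  · rintro ⟨k, hk, j, hj, a, ha, rfl⟩
    rcases k with _ | k
    · rcases le_total a (1 / 2) with h | h
      · refine ⟨0, by omega, j, hj, 2 * a, ⟨by linarith [ha.1], by linarith⟩, ?_⟩
        simp only [blockPieces, two_pos, if_true, slowBlock, nodeTime, splitClock]
        congr 1
        · push_cast; field_simp; ring
        · simp
      · refine ⟨1, by omega, j, hj, 2 * a - 1, ⟨by linarith, by linarith [ha.2]⟩, ?_⟩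
        simp only [blockPieces, one_lt_two, if_true, slowBlock, nodeTime, splitClock]
        congr 1
        · push_cast; field_simp; ring
        · simp
    · refine ⟨k + 2, by omega, j, hj, a, ha, ?_⟩
      simp only [blockPieces, nodeTime, splitClock]
      congr 1
      push_cast; field_simp; ring

/-- Waiting and then performing a letter, and performing it at half speed, are layered blocks with
the same permutation. -/
theorem linkEquiv_idle {N : ℕ} {l : Option ℕ} {y : List (Option ℕ)} (hl : ValidLetter N l)
    (hy : ValidWord N y) : LinkEquiv (optLink N (none :: l :: y)) (optLink N (l :: y)) := by
  have hx : ValidWord N [none, l] := by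
    simp [ValidWord, validLetter_none, hl]
  have hB : IsBlock 2 N (step l) (wordBlock [none, l]) := isBlock_wordBlock hx (by simp)
  have hS := isBlock_slowBlock hl
  have hlay : IsLayered 2 N (wordBlock [none, l]) := by
    intro k hk j j' _ hjj _ a ha h
    interval_cases k
    · exact motion_over hjj ha h
    · exact motion_over hjj ha h
  have h1 := linkEquiv_of_isLayered hy hB hS hlay (isLayered_slowBlock N l)
  have h2 : optLink N (none :: l :: y) = blockLink 2 N (wordBlock [none, l]) y :=
    optLink_append hx y
  rw [h2, ← pieceLink_slowBlock]
  -- Here the pieces stay fixed in cross-section and only the clock moves, until the two halves of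
  -- the slow letter fill one ordinary interval.
  refine h1.trans (linkEquiv_pieceLink (isClock_uniform (by omega)) (isClock_split _)
    (fun k _ j => contDiff_blockPieces hS y k j) (fun k _ j => contDiff_blockPieces hS y k j)
    (fun k _ j h1 h2 a ha => ⟨blockPieces_pos hS hy k j h1 h2 a ha,
      blockPieces_pos hS hy k j h1 h2 a ha⟩)
    (fun k hk j h1 h2 => blockPieces_glue hy hk h1 h2 hS hS) ?_)
  intro s _ k _ j j' _ hjj _ a ha
  simp only [convex_self, blockPieces]
  split_ifs with hk
  · exact motion_ne hjj (slow_mem hk ha)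
  · exact motion_ne hjj ha

/-! ### The half-turn exchanging `σ_i` and `σ_{N-i}` -/

/-- The quarter-turn of the half-plane about the point `(x₀, 0)`. -/
def quarterTurn (x₀ : ℝ) (c : ℝ × ℝ) : ℝ × ℝ := (x₀ - c.2, c.1 - x₀)

/-- About the centre, the interpolation is multiplication by (1 - s) + s i, of determinant (1 - s)²
+ s² > 0, so it stays injective. A half-turn done at once would collapse at s = 1/2; hence two
quarter-turns. -/
theorem linkEquiv_quarterTurn {ℓ N : ℕ} {T : ℕ → ℝ} (hT : IsClock ℓ T) (x₀ : ℝ)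
    {c : ℕ → ℕ → ℝ → ℝ × ℝ} (hc : ∀ k < ℓ, ∀ j, ContDiff ℝ 2 (c k j))
    (hpos : ∀ k < ℓ, ∀ j, 1 ≤ j → j ≤ N → ∀ a ∈ Icc (0 : ℝ) 1,
      0 < (c k j a).1 ∧ 0 < (quarterTurn x₀ (c k j a)).1)
    (hglue : ∀ k < ℓ, ∀ j, 1 ≤ j → j ≤ N → ∃ j', (1 ≤ j' ∧ j' ≤ N) ∧
      c k j 1 = c ((k + 1) % ℓ) j' 0)
    (hinj : ∀ k < ℓ, ∀ j j', 1 ≤ j → j < j' → j' ≤ N → ∀ a ∈ Icc (0 : ℝ) 1, c k j a ≠ c k j' a) :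
    LinkEquiv (pieceLink ℓ N T c) (pieceLink ℓ N T fun k j a => quarterTurn x₀ (c k j a)) := by
  refine linkEquiv_pieceLink hT hT hc ?_ hpos ?_ ?_
  · intro k hk j
    exact (contDiff_const.sub (hc k hk j).snd).prodMk ((hc k hk j).fst.sub contDiff_const)
  · intro k hk j h1 h2
    obtain ⟨j', hj', h⟩ := hglue k hk j h1 h2
    exact ⟨j', hj', h, by rw [h]⟩
  · intro s _ k hk j j' h1 h2 h3 a ha heq
    have e1 := congrArg Prod.fst heq
    have e2 := congrArg Prod.snd heq
    simp only [quarterTurn, Prod.fst_add, Prod.smul_fst, Prod.snd_add, Prod.smul_snd,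
      smul_eq_mul] at e1 e2
    have hs : 0 < (1 - s) ^ 2 + s ^ 2 := by nlinarith [sq_nonneg (1 - 2 * s)]
    refine hinj k hk j j' h1 h2 h3 a ha (Prod.ext ?_ ?_)
    · apply mul_left_cancel₀ hs.ne'
      linear_combination (1 - s) * e1 + s * e2
    · apply mul_left_cancel₀ hs.ne'
      linear_combination (1 - s) * e2 - s * e1

theorem motion_snd_le_half (l : Option ℕ) (j : ℕ) (a : ℝ) : (motion l j a).2 ≤ 1 / 2 := by
  have h1 := Real.sin_le_one (Real.pi * a)
  have h2 := Real.neg_one_le_sin (Real.pi * a)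
  cases l with
  | none => norm_num [motion]
  | some i =>
    simp only [motion]
    split_ifs <;> dsimp only <;> linarith

theorem motion_fst_le {N : ℕ} {l : Option ℕ} (hl : ValidLetter N l) {j : ℕ} (hj : j ≤ N) (a : ℝ) :
    (motion l j a).1 ≤ N := by
  have hjR : (j : ℝ) ≤ N := by exact_mod_cast hj
  cases l with
  | none => exact hjR
  | some i =>
    have hi : (i : ℝ) + 1 ≤ N := by exact_mod_cast (hl i rfl).2
    by_cases h1 : j = i
    · subst h1; exact (motion_left_mem j a).2.trans hi
    by_cases h2 : j = i + 1
    · subst h2; exact (motion_right_mem i a).2.trans hi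
    rw [motion_other h1 h2]
    exact hjR

theorem optLink_glue {N : ℕ} {w : List (Option ℕ)} (hw : ValidWord N w) (k : ℕ) {j : ℕ}
    (h1 : 1 ≤ j) (h2 : j ≤ N) : ∃ j', (1 ≤ j' ∧ j' ≤ N) ∧
      motion (w.getD k none) j 1 = motion (w.getD ((k + 1) % w.length) none) j' 0 :=
  ⟨_, step_mem (hw.getD k) ⟨h1, h2⟩, by rw [motion_one, motion_zero]⟩

theorem quarterTurn_quarterTurn_motion {N : ℕ} {l : Option ℕ} (hl : ValidLetter N l) {j : ℕ}
    (hj' : j ≤ N) (a : ℝ) :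
    quarterTurn (((N : ℝ) + 1) / 2) (quarterTurn (((N : ℝ) + 1) / 2) (motion l j a)) =
      motion (l.map (N - ·)) (N + 1 - j) a := by
  have hsub : ((N + 1 - j : ℕ) : ℝ) = N + 1 - j := by
    rw [Nat.cast_sub (by omega)]; push_cast; ring
  cases l with
  | none =>
    simp only [motion, quarterTurn, Option.map_none, hsub]
    ext <;> dsimp only <;> ring
  | some i =>
    have hi := hl i rfl
    have hsub2 : ((N - i : ℕ) : ℝ) = N - i := Nat.cast_sub (by omega)
    rw [Option.map_some]
    by_cases h1 : j = i
    · subst h1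
      rw [show N + 1 - j = N - j + 1 by omega, motion_left, motion_right, hsub2]
      simp only [quarterTurn]
      ext <;> dsimp only <;> ring
    by_cases h2 : j = i + 1
    · subst h2
      rw [show N + 1 - (i + 1) = N - i by omega, motion_left, motion_right, hsub2]
      simp only [quarterTurn]
      ext <;> dsimp only <;> ring
    rw [motion_other h1 h2, motion_other (by omega) (by omega), hsub]
    simp only [quarterTurn]
    ext <;> dsimp only <;> ring

theorem linkEquiv_flip {N : ℕ} {w : List (Option ℕ)} (hw : ValidWord N w) (hne : w ≠ []) :
    LinkEquiv (optLink N w) (optLink N (w.map (Option.map (N - ·)))) := by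
  have hclock := isClock_uniform (List.length_pos_iff.2 hne)
  -- After one quarter-turn the radius is (N + 1)/2 minus the height, and heights are at most 1/2
  -- while the centre is at distance at least 1: the axis is not reached.
  have hpos2 : ∀ k j, 1 ≤ j → j ≤ N → ∀ a : ℝ,
      0 < (quarterTurn (((N : ℝ) + 1) / 2) (motion (w.getD k none) j a)).1 := by
    intro k j h1 h2 a
    have h3 := motion_snd_le_half (w.getD k none) j a
    have hN : (1 : ℝ) ≤ N := by exact_mod_cast h1.trans h2
    simp only [quarterTurn]
    linarith
  have e1 : LinkEquiv (optLink N w) _ := linkEquiv_quarterTurn hclock (((N : ℝ) + 1) / 2)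
    (c := fun k => motion (w.getD k none)) (fun k _ j => contDiff_motion _ _)
    (fun k _ j h1 h2 a _ => ⟨zero_lt_one.trans_le (motion_fst_ge (hw.getD k) h1 a),
      hpos2 k j h1 h2 a⟩)
    (fun k _ j h1 h2 => optLink_glue hw k h1 h2) (fun k _ j j' _ h _ a ha => motion_ne h ha)
  have hinjQ : ∀ c c' : ℝ × ℝ, quarterTurn (((N : ℝ) + 1) / 2) c =
      quarterTurn (((N : ℝ) + 1) / 2) c' → c = c' := by
    intro c c' h
    have h1 := congrArg Prod.fst h
    have h2 := congrArg Prod.snd h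
    simp only [quarterTurn] at h1 h2
    exact Prod.ext (by linarith) (by linarith)
  have e2 := linkEquiv_quarterTurn (N := N) hclock (((N : ℝ) + 1) / 2)
    (c := fun k j a => quarterTurn (((N : ℝ) + 1) / 2) (motion (w.getD k none) j a))
    (fun k _ j => (contDiff_const.sub (contDiff_motion _ _).snd).prodMk
      ((contDiff_motion _ _).fst.sub contDiff_const))
    (fun k _ j h1 h2 a _ => ⟨hpos2 k j h1 h2 a, by
      have := motion_fst_le (hw.getD k) h2 a
      simp only [quarterTurn]
      linarith⟩)
    (fun k _ j h1 h2 => by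
      obtain ⟨j', hj', h⟩ := optLink_glue hw k h1 h2
      exact ⟨j', hj', congrArg _ h⟩)
    (fun k _ j j' _ h _ a ha he => motion_ne h ha (hinjQ _ _ he))
  refine e1.trans ?_
  convert e2 using 1
  have hget : ∀ k, (w.map (Option.map (N - ·))).getD k none
      = (w.getD k none).map (N - ·) := by
    intro k
    rw [List.getD_eq_getElem?_getD, List.getD_eq_getElem?_getD, List.getElem?_map]
    cases w[k]? <;> rfl
  ext P
  simp only [optLink, pieceLink, mem_ofPred_eq, List.length_map, hget]
  constructor
  · rintro ⟨k, hk, j, hj, a, ha, rfl⟩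
    refine ⟨k, hk, N + 1 - j, by omega, a, ha, ?_⟩
    rw [quarterTurn_quarterTurn_motion (hw.getD k) (by omega),
      show N + 1 - (N + 1 - j) = j by omega]
  · rintro ⟨k, hk, j, hj, a, ha, rfl⟩
    refine ⟨k, hk, N + 1 - j, by omega, a, ha, ?_⟩
    rw [quarterTurn_quarterTurn_motion (hw.getD k) hj.2]

/-! ### Destabilization: tilting the innermost loop -/

/-- A word preceded by two idle time intervals. -/
def idleWord (w : List (Option ℕ)) : List (Option ℕ) := none :: none :: w

/-- The pieces of the closed braid of `σ₁`, an idle interval and the word `w` shifted by one. -/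
noncomputable def kinkPieces (w : List (Option ℕ)) (k j : ℕ) (a : ℝ) : ℝ × ℝ :=
  if k = 0 then motion (some 1) j a
  else if j = 1 then (1, 0)
  else motion ((idleWord w).getD k none) (j - 1) a + (1, 0)

/-- The pieces of the same braid, where the height increases along the innermost loop. -/
noncomputable def tiltedPieces (w : List (Option ℕ)) (k j : ℕ) (a : ℝ) : ℝ × ℝ :=
  if j = 1 then
    (if k = 0 then ((motion (some 1) 1 a).1, (w.length : ℝ) + 2 + a) else (1, (k : ℝ) + a))
  else if k = 0 then (if j = 2 then ((motion (some 1) 2 a).1, a) else motion (some 1) j a)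
  else if k = 1 ∧ j = 2 then (2, ((w.length : ℝ) + 3) * (1 - a))
  else motion ((idleWord w).getD k none) (j - 1) a + (1, 0)

/-- The pieces of the braid obtained by contracting the innermost loop. -/
noncomputable def contractedPieces (w : List (Option ℕ)) (k j : ℕ) (a : ℝ) : ℝ × ℝ :=
  if k = 0 ∧ j = 1 then (2, ((w.length : ℝ) + 3) * a)
  else if k = 1 ∧ j = 1 then (2, ((w.length : ℝ) + 3) * (1 - a))
  else motion ((idleWord w).getD k none) j a + (1, 0)

section
variable {N : ℕ} {w : List (Option ℕ)}

theorem validWord_idleWord (hw : ValidWord N w) : ValidWord N (idleWord w) := by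
  simp only [ValidWord, idleWord, List.mem_cons, forall_eq_or_imp]
  exact ⟨validLetter_none N, validLetter_none N, hw⟩

theorem idleWord_getD_zero : (idleWord w).getD 0 none = none := rfl

theorem idleWord_getD_one : (idleWord w).getD 1 none = none := rfl

theorem kinkPieces_zero (j : ℕ) (a : ℝ) : kinkPieces w 0 j a = motion (some 1) j a := rfl

theorem kinkPieces_one {k : ℕ} (hk : k ≠ 0) (a : ℝ) : kinkPieces w k 1 a = (1, 0) := by
  simp [kinkPieces, hk]

theorem kinkPieces_of_two_le {k j : ℕ} (hk : k ≠ 0) (hj : 2 ≤ j) (a : ℝ) : kinkPieces w k j a =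
    motion ((idleWord w).getD k none) (j - 1) a + (1, 0) := by
  rw [kinkPieces, if_neg hk, if_neg (by omega)]

theorem tiltedPieces_zero_one (a : ℝ) :
    tiltedPieces w 0 1 a = ((motion (some 1) 1 a).1, (w.length : ℝ) + 2 + a) := rfl

theorem tiltedPieces_zero_two (a : ℝ) : tiltedPieces w 0 2 a = ((motion (some 1) 2 a).1, a) := rfl

theorem tiltedPieces_zero {j : ℕ} (hj : 3 ≤ j) (a : ℝ) :
    tiltedPieces w 0 j a = ((j : ℝ), 0) := by
  rw [tiltedPieces, if_neg (by omega), if_pos rfl, if_neg (by omega),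
    motion_other (by omega) (by omega)]

theorem tiltedPieces_one {k : ℕ} (hk : k ≠ 0) (a : ℝ) :
    tiltedPieces w k 1 a = (1, (k : ℝ) + a) := by
  simp [tiltedPieces, hk]

theorem tiltedPieces_one_two (a : ℝ) :
    tiltedPieces w 1 2 a = (2, ((w.length : ℝ) + 3) * (1 - a)) := rfl

theorem tiltedPieces_of_two_le {k j : ℕ} (hk : k ≠ 0) (hj : 2 ≤ j) (h : ¬ (k = 1 ∧ j = 2)) (a : ℝ) :
    tiltedPieces w k j a = motion ((idleWord w).getD k none) (j - 1) a + (1, 0) := by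
  rw [tiltedPieces, if_neg (by omega), if_neg hk, if_neg h]

theorem tiltedPieces_fst (k j : ℕ) (a : ℝ) :
    (tiltedPieces w k j a).1 = (kinkPieces w k j a).1 := by
  by_cases hk : k = 0
  · subst hk
    simp only [tiltedPieces, kinkPieces]
    split_ifs <;> subst_vars <;> rfl
  · simp only [tiltedPieces, kinkPieces, hk, if_false]
    split_ifs with h1 h2
    · rfl
    · obtain ⟨rfl, rfl⟩ := h2
      rw [idleWord_getD_one]
      norm_num [motion]
    · rfl

theorem contDiff_add_const {f : ℝ → ℝ × ℝ} (hf : ContDiff ℝ 2 f) (c : ℝ × ℝ) :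
    ContDiff ℝ 2 fun a => f a + c := hf.add contDiff_const

theorem contDiff_kinkPieces (k j : ℕ) : ContDiff ℝ 2 (kinkPieces w k j) := by
  unfold kinkPieces
  split_ifs
  · exact contDiff_motion _ _
  · exact contDiff_const
  · exact contDiff_add_const (contDiff_motion _ _) _

theorem contDiff_tiltedPieces (k j : ℕ) : ContDiff ℝ 2 (tiltedPieces w k j) := by
  unfold tiltedPieces
  split_ifs
  · exact (contDiff_motion _ _).fst.prodMk (by fun_prop)
  · exact contDiff_const.prodMk (by fun_prop)
  · exact (contDiff_motion _ _).fst.prodMk contDiff_id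
  · exact contDiff_motion _ _
  · exact contDiff_const.prodMk (by fun_prop)
  · exact contDiff_add_const (contDiff_motion _ _) _

theorem contDiff_contractedPieces (k j : ℕ) : ContDiff ℝ 2 (contractedPieces w k j) := by
  unfold contractedPieces
  split_ifs
  · exact contDiff_const.prodMk (by fun_prop)
  · exact contDiff_const.prodMk (by fun_prop)
  · exact contDiff_add_const (contDiff_motion _ _) _

theorem validLetter_one (hN : 1 ≤ N) : ValidLetter (N + 1) (some 1) :=
  validLetter_some.2 ⟨le_rfl, by omega⟩

theorem kinkPieces_two_le (hw : ValidWord N w) {k j : ℕ} (hk : k ≠ 0) (hj : 2 ≤ j) (a : ℝ) :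
    2 ≤ (kinkPieces w k j a).1 := by
  rw [kinkPieces_of_two_le hk hj]
  have := motion_fst_ge ((validWord_idleWord hw).getD k) (show 1 ≤ j - 1 by omega) a
  simp only [Prod.fst_add]
  linarith

theorem kinkPieces_pos (hN : 1 ≤ N) (hw : ValidWord N w) {k j : ℕ} (hj : 1 ≤ j) (a : ℝ) :
    0 < (kinkPieces w k j a).1 := by
  by_cases hk : k = 0
  · subst hk
    exact zero_lt_one.trans_le (motion_fst_ge (validLetter_one hN) hj a)
  rcases hj.eq_or_lt with rfl | hj
  · rw [kinkPieces_one hk]; exact one_pos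
  · exact two_pos.trans_le (kinkPieces_two_le hw hk hj a)

theorem kinkPieces_over (hw : ValidWord N w) {k j j' : ℕ} (hj : 1 ≤ j) (hjj : j < j') {a : ℝ}
    (ha : a ∈ Icc (0 : ℝ) 1) (h : (kinkPieces w k j a).1 = (kinkPieces w k j' a).1) :
    (kinkPieces w k j' a).2 < (kinkPieces w k j a).2 ∧
      (tiltedPieces w k j' a).2 < (tiltedPieces w k j a).2 := by
  by_cases hk : k = 0
  · subst hk
    simp only [kinkPieces_zero] at h ⊢
    refine ⟨motion_over hjj ha h, ?_⟩
    by_cases hc : j = 1 ∧ j' = 2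
    · obtain ⟨rfl, rfl⟩ := hc
      rw [tiltedPieces_zero_one, tiltedPieces_zero_two]
      have : (0 : ℝ) ≤ w.length := Nat.cast_nonneg _
      dsimp only
      linarith
    · refine absurd h (motion_fst_lt hjj ?_ a a).ne
      rw [Option.some.injEq]
      omega
  rcases hj.eq_or_lt with rfl | hj2
  · have := kinkPieces_two_le hw hk (show 2 ≤ j' by omega) a
    rw [kinkPieces_one hk] at h
    dsimp only at h
    linarith
  · have h1 : 2 ≤ j := hj2
    have h2 : 2 ≤ j' := by omega
    have h3 := h
    rw [kinkPieces_of_two_le hk h1, kinkPieces_of_two_le hk h2, Prod.fst_add, Prod.fst_add] at h3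
    have h4 := motion_over (show j - 1 < j' - 1 by omega) ha (add_right_cancel h3)
    by_cases hk1 : k = 1
    · subst hk1
      rw [idleWord_getD_one] at h4
      exact absurd h4 (lt_irrefl _)
    · rw [tiltedPieces_of_two_le hk h1 (by omega), tiltedPieces_of_two_le hk h2 (by omega),
        kinkPieces_of_two_le hk h1, kinkPieces_of_two_le hk h2, Prod.snd_add, Prod.snd_add]
      exact ⟨add_lt_add_left h4 _, add_lt_add_left h4 _⟩

theorem next_cases {M k : ℕ} (hk : k < M) :
    (k + 1 < M ∧ (k + 1) % M = k + 1) ∨ (k + 1 = M ∧ (k + 1) % M = 0) := by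
  rcases (show k + 1 ≤ M from hk).lt_or_eq with h | h
  · exact .inl ⟨h, Nat.mod_eq_of_lt h⟩
  · exact .inr ⟨h, by rw [h, Nat.mod_self]⟩

theorem kinkPieces_start (k : ℕ) {j : ℕ} (hj : 1 ≤ j) : kinkPieces w k j 0 = ((j : ℝ), 0) := by
  by_cases hk : k = 0
  · subst hk
    rw [kinkPieces_zero, motion_zero]
  rcases hj.eq_or_lt with rfl | hj2
  · rw [kinkPieces_one hk, Nat.cast_one]
  · rw [kinkPieces_of_two_le hk hj2, motion_zero, Nat.cast_sub hj]
    ext <;> simp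

theorem tiltedPieces_start {k j : ℕ} (hk : k ≠ 1) (hj : 2 ≤ j) :
    tiltedPieces w k j 0 = ((j : ℝ), 0) := by
  by_cases hk0 : k = 0
  · subst hk0
    rcases hj.eq_or_lt with rfl | hj2
    · rw [tiltedPieces_zero_two, motion_zero]
    · exact tiltedPieces_zero hj2 0
  · rw [tiltedPieces_of_two_le hk0 hj (by omega), motion_zero, Nat.cast_sub (by omega)]
    ext <;> simp

theorem kinkPieces_glue (hN : 1 ≤ N) (hw : ValidWord N w) {k j : ℕ} (hk : k < w.length + 2) (hj : 1 ≤ j)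
    (hj' : j ≤ N + 1) : ∃ j', (1 ≤ j' ∧ j' ≤ N + 1) ∧
      kinkPieces w k j 1 = kinkPieces w ((k + 1) % (w.length + 2)) j' 0 ∧
      tiltedPieces w k j 1 = tiltedPieces w ((k + 1) % (w.length + 2)) j' 0 := by
  rcases Nat.eq_zero_or_pos k with rfl | hk0
  · have hmod : (0 + 1) % (w.length + 2) = 1 := Nat.mod_eq_of_lt (by omega)
    rw [hmod]
    rcases (show j = 1 ∨ j = 2 ∨ 3 ≤ j by omega) with rfl | rfl | h3
    · refine ⟨2, by omega, ?_, ?_⟩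
      · rw [kinkPieces_zero, kinkPieces_start 1 (by omega), motion_one]; rfl
      · rw [tiltedPieces_zero_one, tiltedPieces_one_two, motion_one]
        ext <;> simp [step]
        ring
    · refine ⟨1, by omega, ?_, ?_⟩
      · rw [kinkPieces_zero, kinkPieces_start 1 le_rfl, motion_one]; rfl
      · rw [tiltedPieces_zero_two, tiltedPieces_one one_ne_zero, motion_one]
        ext <;> simp [step]
    · refine ⟨j, by omega, ?_, ?_⟩
      · rw [kinkPieces_zero, kinkPieces_start 1 hj, motion_other (by omega) (by omega)]
      · rw [tiltedPieces_zero h3, tiltedPieces_of_two_le one_ne_zero (by omega) (by omega),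
          motion_zero, Nat.cast_sub hj]
        ext <;> simp
  have hk0' : k ≠ 0 := by omega
  have hnext : (k + 1) % (w.length + 2) ≠ 1 := by
    rcases next_cases hk with h | h <;> omega
  rcases hj.eq_or_lt with rfl | hj2
  · refine ⟨1, by omega, ?_, ?_⟩
    · rw [kinkPieces_one hk0', kinkPieces_start _ le_rfl, Nat.cast_one]
    · rw [tiltedPieces_one hk0']
      rcases next_cases hk with ⟨h, h'⟩ | ⟨h, h'⟩
      · rw [h', tiltedPieces_one (by omega)]
        push_cast
        ring_nf
      · rw [h', tiltedPieces_zero_one, motion_zero]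
        have : (k : ℝ) + 1 = w.length + 2 := by exact_mod_cast h
        ext <;> simp [this]
  · obtain ⟨h1, h2⟩ := step_mem ((validWord_idleWord hw).getD k)
      (show 1 ≤ j - 1 ∧ j - 1 ≤ N by omega)
    set i := step ((idleWord w).getD k none) (j - 1) with hi
    refine ⟨i + 1, by omega, ?_, ?_⟩
    · rw [kinkPieces_of_two_le hk0' hj2, kinkPieces_start _ (by omega), motion_one, ← hi]
      ext <;> simp
    · rw [tiltedPieces_start hnext (by omega)]
      by_cases hc : k = 1 ∧ j = 2
      · obtain ⟨rfl, rfl⟩ := hc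
        rw [tiltedPieces_one_two, hi, idleWord_getD_one]
        ext <;> norm_num [step]
      · rw [tiltedPieces_of_two_le hk0' hj2 hc, motion_one, ← hi]
        ext <;> simp

theorem motion_shift (l : Option ℕ) (j : ℕ) (a : ℝ) :
    motion (l.map (· + 1)) (j + 1) a = motion l j a + (1, 0) := by
  cases l with
  | none => simp [motion]
  | some i =>
    rw [Option.map_some]
    by_cases h1 : j = i
    · subst h1
      rw [motion_left, motion_left]
      ext <;> simp
      ring
    by_cases h2 : j = i + 1
    · subst h2
      rw [motion_right, motion_right]
      ext <;> simp
      ring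
    rw [motion_other h1 h2, motion_other (by omega) (by omega)]
    ext <;> simp

/-- The word `σ₁`, idle, `w` shifted by one. -/
def kinkWord (w : List (Option ℕ)) : List (Option ℕ) :=
  some 1 :: none :: w.map (Option.map (· + 1))

theorem kinkWord_getD {k : ℕ} (hk : k ≠ 0) :
    (kinkWord w).getD k none = ((idleWord w).getD k none).map (· + 1) := by
  rcases k with _ | _ | k
  · exact absurd rfl hk
  · rfl
  · simp only [kinkWord, idleWord, List.getD_cons_succ]
    rw [List.getD_eq_getElem?_getD, List.getD_eq_getElem?_getD, List.getElem?_map]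
    cases w[k]? <;> rfl

theorem motion_kinkWord (hw : ValidWord N w) {k j : ℕ} (hj : 1 ≤ j) (a : ℝ) :
    motion ((kinkWord w).getD k none) j a = kinkPieces w k j a := by
  by_cases hk : k = 0
  · subst hk; rfl
  rw [kinkWord_getD hk]
  rcases hj.eq_or_lt with rfl | hj2
  · rw [kinkPieces_one hk]
    have hv := (validWord_idleWord hw).getD k
    cases h : (idleWord w).getD k none with
    | none => simp [motion]
    | some i =>
      have := (hv i h).1
      rw [Option.map_some, motion_other (by omega) (by omega), Nat.cast_one]
  · rw [kinkPieces_of_two_le hk hj2, ← motion_shift, Nat.sub_add_cancel hj]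

/-- The plan is unchanged, and at each coincidence in plan the same strand is above before and
after, so heights can be interpolated. Afterwards the loop climbs steadily from 0 to `w.length` + 3
during more than one turn, and the idle interval following `σ₁` leaves room to come down at radius
2. -/
theorem linkEquiv_tiltedPieces (hN : 1 ≤ N) (hw : ValidWord N w) :
    LinkEquiv (optLink (N + 1) (kinkWord w)) (pieceLink (w.length + 2) (N + 1)
      (uniformClock (w.length + 2)) (tiltedPieces w)) := by
  have hlen : (kinkWord w).length = w.length + 2 := by simp [kinkWord]
  have h1 : optLink (N + 1) (kinkWord w) = pieceLink (w.length + 2) (N + 1)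
      (uniformClock (w.length + 2)) (kinkPieces w) := by
    rw [optLink, hlen]
    exact pieceLink_congr fun k _ j hj _ a _ => motion_kinkWord hw hj a
  rw [h1]
  have hclock := isClock_uniform (show 0 < w.length + 2 by omega)
  refine linkEquiv_pieceLink hclock hclock (fun k _ j => contDiff_kinkPieces k j)
    (fun k _ j => contDiff_tiltedPieces k j) (fun k _ j hj _ a _ => ?_)
    (fun k hk j hj hj' => kinkPieces_glue hN hw hk hj hj') ?_
  · rw [tiltedPieces_fst]
    exact ⟨kinkPieces_pos hN hw hj a, kinkPieces_pos hN hw hj a⟩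
  · intro s hs k _ j j' hj hjj _ a ha heq
    have e1 := congrArg Prod.fst heq
    have e2 := congrArg Prod.snd heq
    simp only [Prod.fst_add, Prod.smul_fst, Prod.snd_add, Prod.smul_snd, tiltedPieces_fst,
      smul_eq_mul] at e1 e2
    obtain ⟨h1, h2⟩ := kinkPieces_over hw hj hjj ha (by linarith)
    rcases hs.1.eq_or_lt with rfl | hs0
    · linarith
    · have h3 := mul_pos hs0 (sub_pos.2 h2)
      have h4 := mul_nonneg (by linarith [hs.2] : 0 ≤ 1 - s) (sub_pos.2 h1).le
      nlinarith

theorem contractedPieces_start {k j : ℕ} (hk : k ≠ 1 ∨ j ≠ 1) :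
    contractedPieces w k j 0 = ((j : ℝ) + 1, 0) := by
  rw [contractedPieces]
  split_ifs with h1 h2
  · obtain ⟨rfl, rfl⟩ := h1
    ext <;> simp
    norm_num
  · omega
  · rw [motion_zero]
    ext <;> simp

/-- Up to a radial shift by 1, only the heights of strand 1 in the first two pieces differ from
those of the word, and there all strands are idle at distinct radii. So the vertical detour can be
flattened. -/
theorem linkEquiv_contractedPieces (hw : ValidWord N w) :
    LinkEquiv (pieceLink (w.length + 2) N (uniformClock (w.length + 2)) (contractedPieces w))
      (optLink N (idleWord w)) := by
  have hclock := isClock_uniform (show 0 < w.length + 2 by omega)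
  have hv := validWord_idleWord hw
  refine linkEquiv_pieceLink hclock hclock (fun k _ j => contDiff_contractedPieces k j)
    (fun k _ j => contDiff_motion _ _) (fun k _ j hj _ a _ => ⟨?_, ?_⟩)
    (fun k hk j hj hj' => ?_) ?_
  · have := motion_fst_ge (hv.getD k) hj a
    rw [contractedPieces]
    split_ifs
    · exact two_pos
    · exact two_pos
    · simp only [Prod.fst_add]; linarith
  · exact zero_lt_one.trans_le (motion_fst_ge (hv.getD k) hj a)
  · obtain ⟨h1, h2⟩ := step_mem (hv.getD k) ⟨hj, hj'⟩
    refine ⟨_, ⟨h1, h2⟩, ?_, by rw [motion_one, motion_zero]⟩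
    by_cases hc : k = 0 ∧ j = 1
    · obtain ⟨rfl, rfl⟩ := hc
      rw [show (0 + 1) % (w.length + 2) = 1 from Nat.mod_eq_of_lt (by omega), idleWord_getD_zero]
      simp [contractedPieces, step]
    · rw [contractedPieces_start]
      · by_cases hc' : k = 1 ∧ j = 1
        · obtain ⟨rfl, rfl⟩ := hc'
          rw [idleWord_getD_one]
          simp [contractedPieces, step]
          norm_num
        · rw [contractedPieces, if_neg hc, if_neg hc', motion_one]
          ext <;> simp
      · by_contra hcon
        push Not at hcon
        obtain ⟨h3, h4⟩ := hcon
        have hk0 : k = 0 := by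
          rcases next_cases hk with h | h <;> omega
        subst hk0
        rw [idleWord_getD_zero] at h4
        exact hc ⟨rfl, h4⟩
  · intro s _ k _ j j' hj hjj _ a ha heq
    have hfst : ∀ i, (contractedPieces w k i a).1 =
        (motion ((idleWord w).getD k none) i a).1 + 1 := by
      intro i
      rw [contractedPieces]
      split_ifs with h1 h2
      · obtain ⟨rfl, rfl⟩ := h1
        rw [idleWord_getD_zero]
        norm_num [motion]
      · obtain ⟨rfl, rfl⟩ := h2
        rw [idleWord_getD_one]
        norm_num [motion]
      · rfl
    have e1 := congrArg Prod.fst heq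
    simp only [Prod.fst_add, Prod.smul_fst, hfst, smul_eq_mul] at e1
    have h1 := motion_over hjj ha (show (motion ((idleWord w).getD k none) j a).1 =
      (motion ((idleWord w).getD k none) j' a).1 by linarith)
    by_cases hk : k = 0 ∨ k = 1
    · rcases hk with rfl | rfl
      · rw [idleWord_getD_zero] at h1
        exact lt_irrefl _ h1
      · rw [idleWord_getD_one] at h1
        exact lt_irrefl _ h1
    · have e2 := congrArg Prod.snd heq
      simp only [contractedPieces, show ¬ (k = 0 ∧ j = 1) by omega,
        show ¬ (k = 1 ∧ j = 1) by omega, show ¬ (k = 0 ∧ j' = 1) by omega,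
        show ¬ (k = 1 ∧ j' = 1) by omega, if_false, Prod.snd_add, Prod.smul_snd, smul_eq_mul,
        add_zero] at e2
      linarith

end

/-! ### Contracting the tilted loop -/

/-- The radius along the innermost loop, before contraction. -/
noncomputable def loopRadius (w : List (Option ℕ)) (n : ℕ) (a : ℝ) : ℝ :=
  if n = 0 then (motion (some 1) 2 a).1
  else if n = w.length + 2 then (motion (some 1) 1 a).1 else 1

/-- The straight-line contraction of the innermost loop to a short arc. -/
noncomputable def loopArc (w : List (Option ℕ)) (s : ℝ) (n : ℕ) (a : ℝ) : Space :=
  (1 - s) • wrap (((n : ℝ) + a) / ((w.length : ℝ) + 2)) (loopRadius w n a, (n : ℝ) + a) +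
    s • wrap (((n : ℝ) + a) / (((w.length : ℝ) + 3) * ((w.length : ℝ) + 2))) (2, (n : ℝ) + a)

/-- The contraction of the innermost loop, the other strands being fixed. The arcs of the loop are
indexed by pairs `(n, 1)`. -/
noncomputable def loopHomotopy (w : List (Option ℕ)) (s : ℝ) (x : ℕ × ℕ) (a : ℝ) : Space :=
  if x.2 = 1 then loopArc w s x.1 a
  else wrap (nodeTime (uniformClock (w.length + 2)) x.1 a) (tiltedPieces w x.1 x.2 a)

/-- The indices of the arcs of the link. -/
def loopIndex (N : ℕ) (w : List (Option ℕ)) : Set (ℕ × ℕ) :=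
  {x | (x.2 = 1 ∧ x.1 ≤ w.length + 2) ∨
    (x.1 < w.length + 2 ∧ 2 ≤ x.2 ∧ x.2 ≤ N + 1 ∧ (x.1 = 0 → 3 ≤ x.2))}

section
variable {N : ℕ} {w : List (Option ℕ)}

theorem contDiff_loopRadius (n : ℕ) : ContDiff ℝ 2 (loopRadius w n) := by
  unfold loopRadius
  split_ifs
  · exact (contDiff_motion _ _).fst
  · exact (contDiff_motion _ _).fst
  · exact contDiff_const

theorem loopArc_snd (s : ℝ) (n : ℕ) (a : ℝ) : (loopArc w s n a).2 = n + a := by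
  simp only [loopArc, wrap, Prod.snd_add, Prod.smul_snd, smul_eq_mul]
  ring

theorem loopRadius_mem (n : ℕ) (a : ℝ) : 1 ≤ loopRadius w n a ∧ loopRadius w n a ≤ 2 := by
  have h1 := motion_left_mem 1 a
  have h2 := motion_right_mem 1 a
  norm_num at h1 h2
  unfold loopRadius
  split_ifs
  · exact h2
  · exact h1
  · norm_num

theorem ends_of_loopRadius {n : ℕ} {a : ℝ} (ha : a ∈ Icc (0 : ℝ) 1) (h : 2 ≤ loopRadius w n a) :
    (n = 0 ∧ a = 0) ∨ (n = w.length + 2 ∧ a = 1) := by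
  have hmem : Real.pi * a ∈ Icc 0 Real.pi :=
    ⟨mul_nonneg Real.pi_pos.le ha.1, by nlinarith [Real.pi_pos, ha.2]⟩
  unfold loopRadius at h
  split_ifs at h with h1 h2
  · left
    refine ⟨h1, ?_⟩
    rw [show (2 : ℕ) = 1 + 1 from rfl, motion_right] at h
    have hc : Real.cos (Real.pi * a) = Real.cos 0 := by
      rw [Real.cos_zero]
      apply le_antisymm (Real.cos_le_one _)
      push_cast at h
      linarith
    have := Real.injOn_cos hmem ⟨le_rfl, Real.pi_pos.le⟩ hc
    exact (mul_eq_zero.1 this).resolve_left Real.pi_pos.ne'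
  · right
    refine ⟨h2, ?_⟩
    rw [motion_left] at h
    have hc : Real.cos (Real.pi * a) = Real.cos Real.pi := by
      rw [Real.cos_pi]
      apply le_antisymm _ (Real.neg_one_le_cos _)
      push_cast at h
      linarith
    have := Real.injOn_cos hmem ⟨Real.pi_pos.le, le_rfl⟩ hc
    exact mul_left_cancel₀ Real.pi_pos.ne' (this.trans (mul_one _).symm)
  · norm_num at h

theorem loopRadius_glue {n : ℕ} (hn : n < w.length + 2) :
    loopRadius w n 1 = loopRadius w (n + 1) 0 := by
  have h1 : (motion (some 1) 2 1).1 = 1 := by rw [motion_one]; simp [step]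
  have h2 : (motion (some 1) 1 0).1 = 1 := by rw [motion_zero]; simp
  have e1 : loopRadius w n 1 = 1 := by
    unfold loopRadius
    split_ifs
    · exact h1
    · omega
    · rfl
  have e2 : loopRadius w (n + 1) 0 = 1 := by
    rw [loopRadius, if_neg (by omega)]
    split_ifs
    · exact h2
    · rfl
  rw [e1, e2]

theorem convex_self_space (s : ℝ) (P : Space) : (1 - s) • P + s • P = P := by
  rw [← add_smul, sub_add_cancel, one_smul]

theorem loopArc_glue (s : ℝ) {n : ℕ} (hn : n < w.length + 2) :
    loopArc w s n 1 = loopArc w s (n + 1) 0 := by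
  simp only [loopArc, loopRadius_glue hn]
  push_cast
  simp only [add_zero]

theorem loopRadius_start : loopRadius w 0 0 = 2 := by
  simp [loopRadius, motion_zero]

theorem loopRadius_end : loopRadius w (w.length + 2) 1 = 2 := by
  simp [loopRadius, motion_one, step]

theorem loopArc_start (s : ℝ) : loopArc w s 0 0 = wrap 0 (2, 0) := by
  simp only [loopArc, loopRadius_start, Nat.cast_zero, zero_add, zero_div, convex_self_space]

theorem loopArc_end (s : ℝ) : loopArc w s (w.length + 2) 1 =
    wrap (1 / ((w.length : ℝ) + 2)) (2, (w.length : ℝ) + 3) := by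
  have hpos : (0 : ℝ) < (w.length : ℝ) + 2 := by positivity
  have hpos3 : (0 : ℝ) < (w.length : ℝ) + 3 := by positivity
  have h1 : (((w.length + 2 : ℕ) : ℝ) + 1) / ((w.length : ℝ) + 2)
      = 1 / ((w.length : ℝ) + 2) + 1 := by
    push_cast; field_simp; ring
  have h2 : (((w.length + 2 : ℕ) : ℝ) + 1) / (((w.length : ℝ) + 3) * ((w.length : ℝ) + 2))
      = 1 / ((w.length : ℝ) + 2) := by
    push_cast; field_simp; ring
  have h3 : ((w.length + 2 : ℕ) : ℝ) + 1 = (w.length : ℝ) + 3 := by push_cast; ring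
  rw [loopArc, h1, h2, wrap_add_one, loopRadius_end, convex_self_space, h3]

theorem norm_loopArc_le {s : ℝ} (hs : s ∈ Icc (0 : ℝ) 1) (n : ℕ) (a : ℝ) :
    ‖(loopArc w s n a).1‖ ≤ (1 - s) * loopRadius w n a + s * 2 := by
  simp only [loopArc, Prod.fst_add, Prod.smul_fst]
  refine (norm_add_le _ _).trans ?_
  rw [norm_smul, norm_smul, norm_wrap_fst, norm_wrap_fst, Real.norm_of_nonneg hs.1,
    Real.norm_of_nonneg (by linarith [hs.2] : 0 ≤ 1 - s)]
  dsimp only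
  rw [abs_of_nonneg (by linarith [(loopRadius_mem (w := w) n a).1]), abs_two]

/-- Away from the target arc, the loop stays inside the cylinder of radius `2`. -/
theorem loopArc_eq_of_norm {s : ℝ} (hs : s ∈ Icc (0 : ℝ) 1) {n : ℕ} {a : ℝ}
    (ha : a ∈ Icc (0 : ℝ) 1) (h : 2 ≤ ‖(loopArc w s n a).1‖) :
    loopArc w s n a = wrap (((n : ℝ) + a) / (((w.length : ℝ) + 3) * ((w.length : ℝ) + 2)))
      (2, (n : ℝ) + a) := by
  have h1 := h.trans (norm_loopArc_le hs n a)
  rcases hs.2.eq_or_lt with rfl | hs1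
  · simp [loopArc]
  · have h2 : 2 ≤ loopRadius w n a := by
      by_contra hlt
      push Not at hlt
      have := mul_pos (sub_pos.2 hs1) (sub_pos.2 hlt)
      nlinarith
    rcases ends_of_loopRadius ha h2 with ⟨rfl, rfl⟩ | ⟨rfl, rfl⟩
    · rw [loopArc_start]
      simp
    · rw [loopArc_end]
      have hpos : (0 : ℝ) < (w.length : ℝ) + 2 := by positivity
      have hpos3 : (0 : ℝ) < (w.length : ℝ) + 3 := by positivity
      congr 1
      · push_cast; field_simp; ring
      · ext <;> simp; ring

theorem tiltedPieces_two_le (hw : ValidWord N w) {k j : ℕ} (hk : k ≠ 0) (hj : 2 ≤ j) (a : ℝ) :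
    2 ≤ (tiltedPieces w k j a).1 := by
  rw [tiltedPieces_fst]
  exact kinkPieces_two_le hw hk hj a

theorem tiltedPieces_fixed (hw : ValidWord N w) {k j : ℕ} (hj : 2 ≤ j) (h : k = 0 → 3 ≤ j)
    (a : ℝ) : 2 ≤ (tiltedPieces w k j a).1 ∧ ((tiltedPieces w k j a).1 = 2 → k ≠ 0) := by
  by_cases hk : k = 0
  · subst hk
    have h3 := h rfl
    rw [tiltedPieces_zero h3]
    have : (3 : ℝ) ≤ j := by exact_mod_cast h3
    exact ⟨by dsimp only; linarith, fun h' => by dsimp only at h'; linarith⟩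
  · exact ⟨tiltedPieces_two_le hw hk hj a, fun _ => hk⟩

theorem natCast_add_eq {n n' : ℕ} {a b : ℝ} (ha : a ∈ Icc (0 : ℝ) 1) (hb : b ∈ Icc (0 : ℝ) 1)
    (h : (n : ℝ) + a = n' + b) :
    (n = n' ∧ a = b) ∨ (n' = n + 1 ∧ a = 1 ∧ b = 0) ∨ (n = n' + 1 ∧ a = 0 ∧ b = 1) := by
  have key : ∀ {n n' : ℕ} {a b : ℝ}, a ∈ Icc (0 : ℝ) 1 → b ∈ Icc (0 : ℝ) 1 →
      (n : ℝ) + a = n' + b → n < n' → n' = n + 1 ∧ a = 1 ∧ b = 0 := by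
    intro n n' a b ha hb h hlt
    have h1 : (n : ℝ) + 1 ≤ n' := by exact_mod_cast hlt
    have h2 : a = 1 := by linarith [ha.2, hb.1]
    have h3 : b = 0 := by linarith [ha.2, hb.1]
    subst h2 h3
    refine ⟨?_, rfl, rfl⟩
    rw [add_zero] at h
    exact_mod_cast h.symm
  rcases lt_trichotomy n n' with hlt | rfl | hlt
  · exact .inr (.inl (key ha hb h hlt))
  · exact .inl ⟨rfl, add_left_cancel h⟩
  · have := key hb ha h.symm hlt
    exact .inr (.inr ⟨this.1, this.2.2, this.2.1⟩)

/-- The fixed strands have radius at least 2, and the loop reaches radius 2 only at its ends or at s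
= 1. It then agrees with the target arc over the first time interval, where the fixed strands have
radius at least 3; contact is thus possible only at the two ends of that interval. -/
theorem loopArc_meets_fixed (hw : ValidWord N w) {s : ℝ} (hs : s ∈ Icc (0 : ℝ) 1) {n k j : ℕ}
    {a b : ℝ} (ha : a ∈ Icc (0 : ℝ) 1) (hb : b ∈ Icc (0 : ℝ) 1) (hn : n ≤ w.length + 2)
    (hk : k < w.length + 2) (hj : 2 ≤ j) (hkj : k = 0 → 3 ≤ j)
    (h : loopArc w s n a =
      wrap (nodeTime (uniformClock (w.length + 2)) k b) (tiltedPieces w k j b)) :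
    ((n = 0 ∧ a = 0) ∧ (k + 1 = w.length + 2 ∧ b = 1) ∧ tiltedPieces w k j 1 = (2, 0)) ∨
    ((n = w.length + 2 ∧ a = 1) ∧ (k = 1 ∧ b = 0) ∧
      tiltedPieces w k j 0 = (2, (w.length : ℝ) + 3)) := by
  have hclock := isClock_uniform (show 0 < w.length + 2 by omega)
  obtain ⟨h1, h2⟩ := tiltedPieces_fixed hw hj hkj b
  have hnorm : 2 ≤ ‖(loopArc w s n a).1‖ := by
    rw [h, norm_wrap_fst, abs_of_nonneg (by linarith)]
    exact h1
  rw [loopArc_eq_of_norm hs ha hnorm] at h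
  have hpos : (0 : ℝ) < (w.length : ℝ) + 2 := by positivity
  have hpos3 : (0 : ℝ) < (w.length : ℝ) + 3 := by positivity
  have hnR : (n : ℝ) ≤ (w.length : ℝ) + 2 := by exact_mod_cast hn
  have hn0 : (0 : ℝ) ≤ n := n.cast_nonneg
  have htime : ((n : ℝ) + a) / (((w.length : ℝ) + 3) * ((w.length : ℝ) + 2)) ∈ Icc (0 : ℝ) 1 := by
    refine ⟨div_nonneg (by linarith [ha.1]) (by positivity), (div_le_one (by positivity)).2 ?_⟩
    nlinarith [ha.2]
  obtain ⟨h3, h4⟩ := wrap_inj htime (hclock.nodeTime_mem_Icc hk hb) two_pos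
    (two_pos.trans_le h1) h
  have hk0 : k ≠ 0 := h2 (by rw [← h3])
  have hk1 : (1 : ℝ) ≤ k := by exact_mod_cast Nat.one_le_iff_ne_zero.2 hk0
  rcases h4 with h4 | ⟨-, h4⟩ | ⟨h4, h5⟩
  · right
    rw [nodeTime_uniform] at h4
    push_cast at h4
    have h5 : (n : ℝ) + a = ((w.length : ℝ) + 3) * (k + b) := by
      field_simp at h4
      linarith
    -- The target arc takes up exactly the first interval, so equality of times with k ≥ 1 forces
    -- its end point.
    have h6 : (k : ℝ) + b = 1 := by
      refine le_antisymm ?_ (by linarith [hb.1])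
      by_contra hlt
      push Not at hlt
      nlinarith [ha.2]
    have hb0 : b = 0 := by linarith [hb.1]
    have hk1' : (k : ℝ) = 1 := by linarith
    have ha1 : a = 1 := by
      rw [h6] at h5
      linarith [ha.2]
    have hn' : (n : ℝ) = (w.length : ℝ) + 2 := by
      rw [h6] at h5
      linarith [ha.2]
    have h7 : (n : ℝ) + a = (w.length : ℝ) + 3 := by rw [h5, h6, mul_one]
    rw [h7, hb0] at h3
    exact ⟨⟨by exact_mod_cast hn', ha1⟩, ⟨by exact_mod_cast hk1', hb0⟩, h3.symm⟩
  · exact absurd (hclock.first_of_nodeTime hk hb h4).1 hk0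
  · left
    have h6 : (n : ℝ) + a = 0 := by
      rcases div_eq_zero_iff.1 h4 with h | h
      · exact h
      · exact absurd h (by positivity)
    have ha0 : a = 0 := by linarith [ha.1]
    have hn' : (n : ℝ) = 0 := by linarith [ha.1]
    obtain ⟨h7, h8⟩ := hclock.last_of_nodeTime hk hb h5
    rw [h6, h8] at h3
    exact ⟨⟨by exact_mod_cast hn', ha0⟩, ⟨h7, h8⟩, h3.symm⟩

theorem contDiff_loopHomotopy (x : ℕ × ℕ) :
    ContDiff ℝ 2 fun p : ℝ × ℝ => loopHomotopy w p.1 x p.2 := by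
  by_cases hx : x.2 = 1
  · simp only [loopHomotopy, hx, if_true, loopArc]
    have h1 : ContDiff ℝ 2 fun p : ℝ × ℝ => (loopRadius w x.1 p.2, (x.1 : ℝ) + p.2) :=
      ((contDiff_loopRadius (w := w) x.1).comp (contDiff_snd (𝕜 := ℝ) (E := ℝ) (F := ℝ))).prodMk
        (by fun_prop)
    have h2 : ContDiff ℝ 2 fun p : ℝ × ℝ => ((2 : ℝ), (x.1 : ℝ) + p.2) := by fun_prop
    exact ((contDiff_const.sub contDiff_fst).smul (contDiff_wrap (by fun_prop) h1)).add
      (contDiff_fst.smul (contDiff_wrap (by fun_prop) h2))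
  · simp only [loopHomotopy, hx, if_false]
    refine contDiff_wrap ?_ ((contDiff_tiltedPieces x.1 x.2).comp
      (contDiff_snd (𝕜 := ℝ) (E := ℝ) (F := ℝ)))
    simp only [nodeTime]
    fun_prop

theorem differentiableAt_loopHomotopy (s : ℝ) (x : ℕ × ℕ) (a : ℝ) :
    DifferentiableAt ℝ (loopHomotopy w s x) a :=
  (deriv_slice (A := fun s a => loopHomotopy w s x a) (contDiff_loopHomotopy x) s a).differentiableAt

/-- The straight-line contraction does not change the height and need not keep turning about the
axis, so regularity of the loop is read off from its height. -/
theorem snd_deriv_loopHomotopy (s : ℝ) {x : ℕ × ℕ} (hx : x.2 = 1) (a : ℝ) :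
    ContinuousLinearMap.snd ℝ ℂ ℝ (deriv (loopHomotopy w s x) a) = 1 := by
  have h1 : HasDerivAt (fun b => (loopHomotopy w s x b).2)
      (ContinuousLinearMap.snd ℝ ℂ ℝ (deriv (loopHomotopy w s x) a)) a :=
    (hasFDerivAt_snd (𝕜 := ℝ) (p := loopHomotopy w s x a)).comp_hasDerivAt a
      (differentiableAt_loopHomotopy s x a).hasDerivAt
  have h2 : (fun b => (loopHomotopy w s x b).2) = fun b => (x.1 : ℝ) + b := by
    funext b
    simp only [loopHomotopy, hx, if_true, loopArc_snd]
  rw [h2] at h1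
  exact h1.unique ((hasDerivAt_id' a).const_add (x.1 : ℝ))

theorem angular_deriv_fixed (hw : ValidWord N w) (s : ℝ) {x : ℕ × ℕ} (hx : x.2 ≠ 1)
    (hk : x.1 < w.length + 2) (hj : 2 ≤ x.2) (hkj : x.1 = 0 → 3 ≤ x.2) (a : ℝ) :
    0 < angularFunctional (nodeTime (uniformClock (w.length + 2)) x.1 a)
      (deriv (loopHomotopy w s x) a) := by
  have hclock := isClock_uniform (show 0 < w.length + 2 by omega)
  have h1 : loopHomotopy w s x = fun b =>
      wrap (nodeTime (uniformClock (w.length + 2)) x.1 b) (tiltedPieces w x.1 x.2 b) := by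
    funext b
    simp only [loopHomotopy, hx, if_false]
  rw [h1, angularFunctional_deriv_wrap (hasDerivAt_nodeTime _ _ _)
    (((contDiff_tiltedPieces x.1 x.2).differentiable (by norm_num)) a)]
  have h2 := (tiltedPieces_fixed hw hj hkj a).1
  have h3 := sub_pos.2 (hclock.lt x.1 hk)
  have := Real.pi_pos
  have h4 : 0 < (tiltedPieces w x.1 x.2 a).1 := by linarith
  positivity

theorem angularFunctional_add_one (t : ℝ) : angularFunctional (t + 1) = angularFunctional t := by
  have : Complex.exp (-(2 * Real.pi * ((t + 1 : ℝ) : ℂ) * Complex.I))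
      = Complex.exp (-(2 * Real.pi * t * Complex.I)) := by
    have h : (-(2 * Real.pi * ((t + 1 : ℝ) : ℂ) * Complex.I) : ℂ)
        = -(2 * Real.pi * t * Complex.I) - 2 * Real.pi * Complex.I := by push_cast; ring
    rw [h, Complex.exp_sub, Complex.exp_two_pi_mul_I, div_one]
  rw [angularFunctional, angularFunctional, this]

/-- At an end of the loop its angular velocity is positive. -/
theorem angular_deriv_loop {s : ℝ} (hs : s ∈ Icc (0 : ℝ) 1) {n : ℕ} {a t : ℝ}
    (h1 : angularFunctional (((n : ℝ) + a) / ((w.length : ℝ) + 2)) = angularFunctional t)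
    (h2 : ((n : ℝ) + a) / (((w.length : ℝ) + 3) * ((w.length : ℝ) + 2)) = t) :
    0 < angularFunctional t (deriv (loopHomotopy w s (n, 1)) a) := by
  have hd : ∀ c : ℝ, HasDerivAt (fun b : ℝ => ((n : ℝ) + b) / c) (1 / c) a := fun c =>
    ((hasDerivAt_id' a).const_add (n : ℝ)).div_const c
  have hp1 : DifferentiableAt ℝ (fun b => (loopRadius w n b, (n : ℝ) + b)) a :=
    (((contDiff_loopRadius n).differentiable (by norm_num)) a).prodMk (by fun_prop)
  have hp2 : DifferentiableAt ℝ (fun b : ℝ => ((2 : ℝ), (n : ℝ) + b)) a := by fun_prop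
  have e1 := angularFunctional_deriv_wrap (hd ((w.length : ℝ) + 2)) hp1
  have e2 := angularFunctional_deriv_wrap (hd (((w.length : ℝ) + 3) * ((w.length : ℝ) + 2))) hp2
  have hw1 := (hasDerivAt_wrap (hd ((w.length : ℝ) + 2)) hp1.hasDerivAt).differentiableAt
  have hw2 := (hasDerivAt_wrap (hd (((w.length : ℝ) + 3) * ((w.length : ℝ) + 2)))
    hp2.hasDerivAt).differentiableAt
  have hder : deriv (loopHomotopy w s (n, 1)) a = _ :=
    ((hw1.hasDerivAt.const_smul (1 - s)).add (hw2.hasDerivAt.const_smul s)).deriv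
  rw [h1] at e1
  rw [h2] at e2
  rw [hder, map_add, map_smul, map_smul, e1, e2, smul_eq_mul, smul_eq_mul]
  have hr := (loopRadius_mem (w := w) n a).1
  have hpi := Real.pi_pos
  have hpos : (0 : ℝ) < (w.length : ℝ) + 2 := by positivity
  have hpos3 : (0 : ℝ) < (w.length : ℝ) + 3 := by positivity
  have hA : 0 < 2 * Real.pi * (1 / ((w.length : ℝ) + 2)) * loopRadius w n a := by positivity
  have hB : 0 < 2 * Real.pi * (1 / (((w.length : ℝ) + 3) * ((w.length : ℝ) + 2))) * 2 := by
    positivity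
  rcases hs.1.eq_or_lt with rfl | hs0
  · rw [zero_mul, add_zero, sub_zero, one_mul]
    exact hA
  · exact add_pos_of_nonneg_of_pos (mul_nonneg (by linarith [hs.2]) hA.le) (mul_pos hs0 hB)

/-- The ends of arcs that are glued together. -/
def loopJunction (w : List (Option ℕ)) (x y : ℕ × ℕ) : Prop :=
  (x.2 = 1 ∧ y.2 = 1 ∧ y.1 = x.1 + 1) ∨
  (x.2 ≠ 1 ∧ y.2 ≠ 1 ∧ y.1 = (x.1 + 1) % (w.length + 2) ∧
    tiltedPieces w x.1 x.2 1 = tiltedPieces w y.1 y.2 0) ∨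
  (x.2 ≠ 1 ∧ y = (0, 1) ∧ x.1 + 1 = w.length + 2 ∧ tiltedPieces w x.1 x.2 1 = (2, 0)) ∨
  (x = (w.length + 2, 1) ∧ y.2 ≠ 1 ∧ y.1 = 1 ∧
    tiltedPieces w y.1 y.2 0 = (2, (w.length : ℝ) + 3))

theorem nodeTime_one_zero (M : ℕ) : nodeTime (uniformClock M) 1 0 = 1 / M := by
  rw [nodeTime_uniform]; simp

theorem nodeTime_last {M k : ℕ} (h : k + 1 = M) : nodeTime (uniformClock M) k 1 = 1 := by
  subst h
  rw [nodeTime_uniform]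
  push_cast
  exact div_self (by positivity)

theorem angularFunctional_loop_end : angularFunctional
    ((((w.length + 2 : ℕ) : ℝ) + 1) / ((w.length : ℝ) + 2)) =
      angularFunctional (1 / ((w.length : ℝ) + 2)) := by
  rw [← angularFunctional_add_one (1 / _)]
  congr 1
  have hpos : (0 : ℝ) < (w.length : ℝ) + 2 := by positivity
  push_cast; field_simp; ring

/-- Points of the loop are separated from each other by height and from the other strands by radius,
while those strands are at rest. At junctions inside the loop the common functional is the height;
elsewhere it is the angular one, since the ends of the loop start and finish with positive angular
velocity. -/
theorem linkEquiv_loopHomotopy (hw : ValidWord N w) :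
    LinkEquiv {P | ∃ x ∈ loopIndex N w, ∃ a ∈ Icc (0 : ℝ) 1, loopHomotopy w 0 x a = P}
      {P | ∃ x ∈ loopIndex N w, ∃ a ∈ Icc (0 : ℝ) 1, loopHomotopy w 1 x a = P} := by
  have hclock := isClock_uniform (show 0 < w.length + 2 by omega)
  have hfin : (loopIndex N w).Finite := by
    refine ((Set.finite_Iic (w.length + 2)).prod (Set.finite_Iic (N + 1))).union
      ((Set.finite_Iic (w.length + 2)).prod (Set.finite_Iic 1)) |>.subset ?_
    rintro x (hx | hx)
    · exact .inr ⟨hx.2, hx.1.le⟩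
    · exact .inl ⟨hx.1.le, hx.2.2.1⟩
  have harc : ∀ s (x : ℕ × ℕ) a, x.2 = 1 → loopHomotopy w s x a = loopArc w s x.1 a := by
    intro s x a hx
    simp only [loopHomotopy, hx, if_true]
  have hfix : ∀ s (x : ℕ × ℕ) a, x.2 ≠ 1 → loopHomotopy w s x a =
      wrap (nodeTime (uniformClock (w.length + 2)) x.1 a) (tiltedPieces w x.1 x.2 a) := by
    intro s x a hx
    simp only [loopHomotopy, hx, if_false]
  have hmem : ∀ x ∈ loopIndex N w, x.2 ≠ 1 →
      x.1 < w.length + 2 ∧ 2 ≤ x.2 ∧ x.2 ≤ N + 1 ∧ (x.1 = 0 → 3 ≤ x.2) :=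
    fun x hx h => hx.resolve_left fun h' => h h'.1
  have hmem' : ∀ x ∈ loopIndex N w, x.2 = 1 → x.1 ≤ w.length + 2 := by
    rintro x (hx | hx) h
    · exact hx.2
    · exact hx.1.le
  have hcast : ((w.length + 2 : ℕ) : ℝ) = (w.length : ℝ) + 2 := by push_cast; ring
  refine linkEquiv_of_arc_homotopy hfin (loopHomotopy w) (fun x _ => contDiff_loopHomotopy x)
    (loopJunction w) ?_ ?_ ?_ ?_
  · rintro x hx y hy (⟨h1, h2, h3⟩ | ⟨h1, h2, h3, h4⟩ | ⟨h1, rfl, h3, h4⟩ | ⟨rfl, h2, h3, h4⟩) s hs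
    · rw [harc s x 1 h1, harc s y 0 h2, h3, loopArc_glue]
      have := hmem' y hy h2
      omega
    · rw [hfix s x 1 h1, hfix s y 0 h2, h4, hclock.wrap_nodeTime_succ (hmem x hx h1).1, h3]
    · rw [hfix s x 1 h1, harc s _ 0 rfl, h4, loopArc_start, nodeTime_last h3, wrap_one]
    · rw [harc s _ 1 rfl, hfix s y 0 h2, h4, loopArc_end, h3, nodeTime_one_zero, hcast]
  · intro s hs x hx y hy a ha b hb h
    by_cases h1 : x.2 = 1 <;> by_cases h2 : y.2 = 1
    · rw [harc s x a h1, harc s y b h2] at h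
      have h3 := congrArg (fun P : Space => P.2) h
      simp only [loopArc_snd] at h3
      rcases natCast_add_eq ha hb h3 with ⟨h4, h5⟩ | ⟨h4, h5⟩ | ⟨h4, h5⟩
      · exact .inl ⟨Prod.ext h4 (h1.trans h2.symm), h5⟩
      · exact .inr (.inl ⟨.inl ⟨h1, h2, h4⟩, h5⟩)
      · exact .inr (.inr ⟨.inl ⟨h2, h1, h4⟩, h5⟩)
    · rw [harc s x a h1, hfix s y b h2] at h
      obtain ⟨g1, g2, -, g3⟩ := hmem y hy h2
      rcases loopArc_meets_fixed hw hs ha hb (hmem' x hx h1) g1 g2 g3 h with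
        ⟨⟨e1, e2⟩, ⟨e3, e4⟩, e5⟩ | ⟨⟨e1, e2⟩, ⟨e3, e4⟩, e5⟩
      · exact .inr (.inr ⟨.inr (.inr (.inl ⟨h2, Prod.ext e1 h1, e3, e5⟩)), e2, e4⟩)
      · exact .inr (.inl ⟨.inr (.inr (.inr ⟨Prod.ext e1 h1, h2, e3, e5⟩)), e2, e4⟩)
    · rw [hfix s x a h1, harc s y b h2] at h
      obtain ⟨g1, g2, -, g3⟩ := hmem x hx h1
      rcases loopArc_meets_fixed hw hs hb ha (hmem' y hy h2) g1 g2 g3 h.symm with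
        ⟨⟨e1, e2⟩, ⟨e3, e4⟩, e5⟩ | ⟨⟨e1, e2⟩, ⟨e3, e4⟩, e5⟩
      · exact .inr (.inl ⟨.inr (.inr (.inl ⟨h1, Prod.ext e1 h2, e3, e5⟩)), e4, e2⟩)
      · exact .inr (.inr ⟨.inr (.inr (.inr ⟨Prod.ext e1 h2, h1, e3, e5⟩)), e4, e2⟩)
    · rw [hfix s x a h1, hfix s y b h2] at h
      obtain ⟨f1, f2, -, f3⟩ := hmem x hx h1
      obtain ⟨g1, g2, -, g3⟩ := hmem y hy h2
      obtain ⟨h3, h4⟩ := hclock.wrap_nodeTime_inj f1 g1 ha hb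
        (two_pos.trans_le (tiltedPieces_fixed hw f2 f3 a).1)
        (two_pos.trans_le (tiltedPieces_fixed hw g2 g3 b).1) h
      rcases h4 with ⟨h4, h5⟩ | ⟨h4, h5, h6⟩ | ⟨h4, h5, h6⟩
      · left
        refine ⟨Prod.ext h4 ?_, h5⟩
        rw [← h4, ← h5] at h3
        have key : ∀ j j', 2 ≤ j → j < j' → tiltedPieces w x.1 j a ≠ tiltedPieces w x.1 j' a := by
          intro j j' hj hjj he
          have := (kinkPieces_over hw (k := x.1) (show 1 ≤ j by omega) hjj ha (by
            rw [← tiltedPieces_fst, ← tiltedPieces_fst, he])).2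
          rw [he] at this
          exact lt_irrefl _ this
        rcases lt_trichotomy x.2 y.2 with hlt | heq | hlt
        · exact absurd h3 (key _ _ f2 hlt)
        · exact heq
        · exact absurd h3.symm (key _ _ g2 hlt)
      · rw [h5, h6] at h3
        exact .inr (.inl ⟨.inr (.inl ⟨h1, h2, h4, h3⟩), h5, h6⟩)
      · rw [h5, h6] at h3
        exact .inr (.inr ⟨.inr (.inl ⟨h2, h1, h4, h3.symm⟩), h5, h6⟩)
  · intro s hs x hx a ha h0
    by_cases h1 : x.2 = 1
    · have := snd_deriv_loopHomotopy (w := w) s h1 a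
      rw [h0, map_zero] at this
      exact zero_ne_one this
    · obtain ⟨f1, f2, -, f3⟩ := hmem x hx h1
      have := angular_deriv_fixed hw s h1 f1 f2 f3 a
      rw [h0, map_zero] at this
      exact lt_irrefl _ this
  · rintro x hx y hy (⟨h1, h2, h3⟩ | ⟨h1, h2, h3, h4⟩ | ⟨h1, rfl, h3, h4⟩ | ⟨rfl, h2, h3, h4⟩) s hs
    · refine ⟨ContinuousLinearMap.snd ℝ ℂ ℝ, ?_, ?_⟩
      · rw [snd_deriv_loopHomotopy s h1]; exact one_pos
      · rw [snd_deriv_loopHomotopy s h2]; exact one_pos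
    · obtain ⟨f1, f2, -, f3⟩ := hmem x hx h1
      obtain ⟨g1, g2, -, g3⟩ := hmem y hy h2
      refine ⟨_, angular_deriv_fixed hw s h1 f1 f2 f3 1, ?_⟩
      rw [hclock.angularFunctional_nodeTime_succ f1, ← h3]
      exact angular_deriv_fixed hw s h2 g1 g2 g3 0
    · obtain ⟨f1, f2, -, f3⟩ := hmem x hx h1
      refine ⟨angularFunctional 0, ?_, ?_⟩
      · have := angular_deriv_fixed hw s h1 f1 f2 f3 1
        rwa [nodeTime_last h3, angularFunctional_one] at this
      · exact angular_deriv_loop hs (by simp) (by simp)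
    · obtain ⟨g1, g2, -, g3⟩ := hmem y hy h2
      refine ⟨angularFunctional (1 / ((w.length : ℝ) + 2)), ?_, ?_⟩
      · refine angular_deriv_loop hs angularFunctional_loop_end ?_
        have hpos : (0 : ℝ) < (w.length : ℝ) + 2 := by positivity
        have hpos3 : (0 : ℝ) < (w.length : ℝ) + 3 := by positivity
        push_cast; field_simp; ring
      · have := angular_deriv_fixed hw s h2 g1 g2 g3 0
        rwa [h3, nodeTime_one_zero, hcast] at this

end

section
variable {N : ℕ} {w : List (Option ℕ)}

theorem loopArc_zero (n : ℕ) (a : ℝ) : loopArc w 0 n a =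
    wrap (((n : ℝ) + a) / ((w.length : ℝ) + 2)) (loopRadius w n a, (n : ℝ) + a) := by
  simp [loopArc]

theorem loopArc_one (n : ℕ) (a : ℝ) : loopArc w 1 n a =
    wrap (((n : ℝ) + a) / (((w.length : ℝ) + 3) * ((w.length : ℝ) + 2))) (2, (n : ℝ) + a) := by
  simp [loopArc]

theorem loopHomotopy_arc (s : ℝ) (n : ℕ) (a : ℝ) : loopHomotopy w s (n, 1) a = loopArc w s n a := by
  simp [loopHomotopy]

theorem loopHomotopy_fixed (s : ℝ) {k j : ℕ} (hj : j ≠ 1) (a : ℝ) : loopHomotopy w s (k, j) a =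
    wrap (nodeTime (uniformClock (w.length + 2)) k a) (tiltedPieces w k j a) := by
  simp [loopHomotopy, hj]

/-- A relabelling: the loop passes twice over the interval of `σ₁`, first as strand 2 going inwards,
and at the end, one turn later, as strand 1 going outwards. -/
theorem loopHomotopy_zero_range (hN : 1 ≤ N) :
    {P | ∃ x ∈ loopIndex N w, ∃ a ∈ Icc (0 : ℝ) 1, loopHomotopy w 0 x a = P} =
      pieceLink (w.length + 2) (N + 1) (uniformClock (w.length + 2)) (tiltedPieces w) := by
  have hpos : (0 : ℝ) < (w.length : ℝ) + 2 := by positivity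
  have hcast : ((w.length + 2 : ℕ) : ℝ) = (w.length : ℝ) + 2 := by push_cast; ring
  have hfirst : ∀ a : ℝ, wrap (nodeTime (uniformClock (w.length + 2)) 0 a)
      (tiltedPieces w 0 2 a) = loopArc w 0 0 a := by
    intro a
    rw [loopArc_zero, nodeTime_uniform, hcast, tiltedPieces_zero_two, loopRadius, if_pos rfl]
    simp
  have hlast : ∀ a : ℝ, wrap (nodeTime (uniformClock (w.length + 2)) 0 a)
      (tiltedPieces w 0 1 a) = loopArc w 0 (w.length + 2) a := by
    intro a
    rw [loopArc_zero, nodeTime_uniform, hcast, tiltedPieces_zero_one, loopRadius,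
      if_neg (by omega), if_pos rfl, ← wrap_add_one]
    congr 1
    push_cast; field_simp; ring
  have hmid : ∀ (k : ℕ) (a : ℝ), k ≠ 0 → k < w.length + 2 →
      wrap (nodeTime (uniformClock (w.length + 2)) k a) (tiltedPieces w k 1 a) =
        loopArc w 0 k a := by
    intro k a h1 h2
    rw [loopArc_zero, nodeTime_uniform, hcast, tiltedPieces_one h1, loopRadius, if_neg h1,
      if_neg h2.ne]
  ext P
  constructor
  · rintro ⟨⟨k, j⟩, hx, a, ha, rfl⟩
    by_cases hj : j = 1
    · subst hj
      have hk : k ≤ w.length + 2 := by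
        rcases hx with hx | hx
        · exact hx.2
        · exact hx.1.le
      rw [loopHomotopy_arc]
      rcases Nat.eq_zero_or_pos k with rfl | hk0
      · exact ⟨0, by omega, 2, by omega, a, ha, hfirst a⟩
      · rcases hk.eq_or_lt with rfl | hk
        · exact ⟨0, by omega, 1, by omega, a, ha, hlast a⟩
        · exact ⟨k, hk, 1, by omega, a, ha, hmid k a (by omega) hk⟩
    · rw [loopHomotopy_fixed 0 hj]
      rcases hx with hx | hx
      · exact absurd hx.1 hj
      · exact ⟨k, hx.1, j, ⟨by have := hx.2.1; dsimp only at this; omega, hx.2.2.1⟩, a, ha, rfl⟩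
  · rintro ⟨k, hk, j, hj, a, ha, rfl⟩
    by_cases hj1 : j = 1
    · subst hj1
      by_cases hk0 : k = 0
      · subst hk0
        exact ⟨(w.length + 2, 1), .inl ⟨rfl, le_rfl⟩, a, ha, by rw [loopHomotopy_arc, hlast]⟩
      · exact ⟨(k, 1), .inl ⟨rfl, hk.le⟩, a, ha, by rw [loopHomotopy_arc, hmid k a hk0 hk]⟩
    · by_cases hc : k = 0 ∧ j = 2
      · obtain ⟨rfl, rfl⟩ := hc
        exact ⟨(0, 1), .inl ⟨rfl, Nat.zero_le _⟩, a, ha, by rw [loopHomotopy_arc, hfirst]⟩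
      · exact ⟨(k, j), .inr ⟨hk, by dsimp only; omega, hj.2, fun h => by dsimp only at h ⊢; omega⟩,
          a, ha, loopHomotopy_fixed 0 hj1 a⟩

theorem contractedPieces_eq_tiltedPieces {k j : ℕ} (hj : 2 ≤ j) (hkj : k = 0 → 3 ≤ j) (a : ℝ) :
    contractedPieces w k (j - 1) a = tiltedPieces w k j a := by
  by_cases hk : k = 0
  · subst hk
    have h3 := hkj rfl
    rw [tiltedPieces_zero h3, contractedPieces, if_neg (by omega), if_neg (by omega),
      idleWord_getD_zero]
    simp only [motion]
    rw [Nat.cast_sub (by omega)]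
    ext <;> simp
  · by_cases hc : k = 1 ∧ j = 2
    · obtain ⟨rfl, rfl⟩ := hc
      rfl
    · rw [tiltedPieces_of_two_le hk hj hc, contractedPieces, if_neg (by omega), if_neg (by omega)]

/-- At the end of the contraction the `w.length` + 3 arcs of the loop are consecutive portions of
the single rising strand in the first piece. -/
theorem loopHomotopy_one_range (hN : 1 ≤ N) :
    {P | ∃ x ∈ loopIndex N w, ∃ a ∈ Icc (0 : ℝ) 1, loopHomotopy w 1 x a = P} =
      pieceLink (w.length + 2) N (uniformClock (w.length + 2)) (contractedPieces w) := by
  have hpos : (0 : ℝ) < (w.length : ℝ) + 2 := by positivity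
  have hpos3 : (0 : ℝ) < (w.length : ℝ) + 3 := by positivity
  have hcast : ((w.length + 2 : ℕ) : ℝ) = (w.length : ℝ) + 2 := by push_cast; ring
  have harc : ∀ (n : ℕ) (a b : ℝ), (n : ℝ) + a = ((w.length : ℝ) + 3) * b →
      wrap (nodeTime (uniformClock (w.length + 2)) 0 b) (contractedPieces w 0 1 b)
        = loopArc w 1 n a := by
    intro n a b h
    rw [loopArc_one, nodeTime_uniform, hcast, contractedPieces, if_pos ⟨rfl, rfl⟩, h]
    congr 1
    push_cast; field_simp; ring
  ext P
  constructor
  · rintro ⟨⟨k, j⟩, hx, a, ha, rfl⟩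
    by_cases hj : j = 1
    · subst hj
      have hk : k ≤ w.length + 2 := by
        rcases hx with hx | hx
        · exact hx.2
        · exact hx.1.le
      have hkR : (k : ℝ) ≤ (w.length : ℝ) + 2 := by exact_mod_cast hk
      rw [loopHomotopy_arc]
      refine ⟨0, by omega, 1, ⟨le_rfl, hN⟩, ((k : ℝ) + a) / ((w.length : ℝ) + 3),
        ⟨div_nonneg (add_nonneg k.cast_nonneg ha.1) hpos3.le,
          (div_le_one hpos3).2 (by linarith [ha.2])⟩, harc _ _ _ (by field_simp)⟩
    · rw [loopHomotopy_fixed 1 hj]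
      rcases hx with hx | hx
      · exact absurd hx.1 hj
      · obtain ⟨h1, h2, h3, h4⟩ := hx
        dsimp only at h1 h2 h3 h4
        exact ⟨k, h1, j - 1, by omega, a, ha, by rw [contractedPieces_eq_tiltedPieces h2 h4]⟩
  · rintro ⟨k, hk, j, hj, a, ha, rfl⟩
    by_cases hc : k = 0 ∧ j = 1
    · obtain ⟨rfl, rfl⟩ := hc
      have h0 : 0 ≤ ((w.length : ℝ) + 3) * a := mul_nonneg hpos3.le ha.1
      -- The arc through a point of that strand is found by a floor; at a = 1 it would name an arc
      -- beyond the last, whence the separate case.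
      rcases ha.2.eq_or_lt with rfl | ha1
      · refine ⟨(w.length + 2, 1), .inl ⟨rfl, le_rfl⟩, 1, ⟨zero_le_one, le_rfl⟩, ?_⟩
        rw [loopHomotopy_arc, harc]
        push_cast
        ring
      · have hfl : ⌊((w.length : ℝ) + 3) * a⌋₊ < w.length + 3 := by
          rw [Nat.floor_lt h0]
          push_cast
          nlinarith
        refine ⟨(⌊((w.length : ℝ) + 3) * a⌋₊, 1), .inl ⟨rfl, by dsimp only; omega⟩,
          ((w.length : ℝ) + 3) * a - ⌊((w.length : ℝ) + 3) * a⌋₊,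
          ⟨sub_nonneg.2 (Nat.floor_le h0), ?_⟩, ?_⟩
        · linarith [Nat.lt_floor_add_one (((w.length : ℝ) + 3) * a)]
        · rw [loopHomotopy_arc, harc]
          ring
    · refine ⟨(k, j + 1), .inr ⟨hk, by dsimp only; omega, by dsimp only; omega,
        fun h => by dsimp only at h ⊢; omega⟩, a, ha, ?_⟩
      rw [loopHomotopy_fixed 1 (by omega), ← contractedPieces_eq_tiltedPieces (by omega)
        (fun h => by omega), Nat.add_sub_cancel]

/-- Markov destabilization at the innermost strand. -/
theorem linkEquiv_kinkWord (hN : 1 ≤ N) (hw : ValidWord N w) :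
    LinkEquiv (optLink (N + 1) (kinkWord w)) (optLink N (idleWord w)) := by
  have := linkEquiv_loopHomotopy (N := N) hw
  rw [loopHomotopy_zero_range hN, loopHomotopy_one_range hN] at this
  exact (linkEquiv_tiltedPieces hN hw).trans (this.trans (linkEquiv_contractedPieces hw))

end

/-! ### Moves on closed positive braids -/

/-- Words whose letters are generators of the braid group on `N` strands. -/
def IsBraidWord (N : ℕ) (w : List ℕ) : Prop := ∀ i ∈ w, 1 ≤ i ∧ i < N

theorem IsBraidWord.valid {N : ℕ} {w : List ℕ} (hw : IsBraidWord N w) :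
    ValidWord N (w.map some) := validWord_map_some.2 hw

theorem isBraidWord_append {N : ℕ} {x y : List ℕ} :
    IsBraidWord N (x ++ y) ↔ IsBraidWord N x ∧ IsBraidWord N y := by
  simp only [IsBraidWord, List.forall_mem_append]

theorem isBraidWord_cons {N i : ℕ} {y : List ℕ} :
    IsBraidWord N (i :: y) ↔ (1 ≤ i ∧ i < N) ∧ IsBraidWord N y := by
  simp only [IsBraidWord, List.forall_mem_cons]

theorem isBraidWord_nil (N : ℕ) : IsBraidWord N [] := by simp [IsBraidWord]

theorem IsBraidWord.mono {N N' : ℕ} {w : List ℕ} (hw : IsBraidWord N w) (h : N ≤ N') :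
    IsBraidWord N' w := fun i hi => ⟨(hw i hi).1, (hw i hi).2.trans_le h⟩

theorem closedBraid_cons_comm {N i : ℕ} {x : List ℕ} (h : IsBraidWord N (i :: x)) :
    LinkEquiv (closedBraid N (i :: x)) (closedBraid N (x ++ [i])) := by
  have h' : IsBraidWord N (x ++ [i]) := by
    rw [isBraidWord_append, isBraidWord_cons]
    rw [isBraidWord_cons] at h
    exact ⟨h.2, h.1, isBraidWord_nil N⟩
  rw [closedBraid_eq_optLink h (by simp), closedBraid_eq_optLink h' (by simp)]
  simpa using linkEquiv_optLink_rotate N (some i) (x.map some)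

theorem closedBraid_append_comm {N : ℕ} {x y : List ℕ} (h : IsBraidWord N (x ++ y)) :
    LinkEquiv (closedBraid N (x ++ y)) (closedBraid N (y ++ x)) := by
  induction x generalizing y with
  | nil => simpa using LinkEquiv.refl _
  | cons i x ih =>
    have h1 := closedBraid_cons_comm (x := x ++ y) h
    have h2 : IsBraidWord N (x ++ (y ++ [i])) := by
      rw [List.cons_append, isBraidWord_cons, isBraidWord_append] at h
      simp only [isBraidWord_append, isBraidWord_cons]
      exact ⟨h.2.1, h.2.2, h.1, isBraidWord_nil N⟩
    have h3 := ih h2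
    rw [List.append_assoc] at h1
    simpa using h1.trans h3

theorem linkEquiv_optLink_none {N : ℕ} {x : List (Option ℕ)} (hx : ValidWord N x) (hne : x ≠ []) :
    LinkEquiv (optLink N (none :: x)) (optLink N x) := by
  obtain ⟨l, y, rfl⟩ := List.exists_cons_of_ne_nil hne
  have h := hx
  simp only [ValidWord, List.mem_cons, forall_eq_or_imp] at h
  exact linkEquiv_idle h.1 h.2

theorem linkEquiv_idleWord {N : ℕ} {x : List ℕ} (hx : IsBraidWord N x) :
    LinkEquiv (optLink N (idleWord (x.map some))) (closedBraid N x) := by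
  have hv : ValidWord N (none :: x.map some) := by
    simp only [ValidWord, List.mem_cons, forall_eq_or_imp]
    exact ⟨validLetter_none N, hx.valid⟩
  refine (linkEquiv_optLink_none hv (by simp)).trans ?_
  rcases eq_or_ne x [] with rfl | hne
  · rw [closedBraid_nil]
    exact LinkEquiv.refl _
  · rw [closedBraid_eq_optLink hx hne]
    exact linkEquiv_optLink_none hx.valid (by simpa using hne)

/-- The mirror word, in which `σ_i` is replaced by `σ_{N-i}`. -/
def flipWord (N : ℕ) (w : List ℕ) : List ℕ := w.map (N - ·)

theorem isBraidWord_flipWord {N : ℕ} {w : List ℕ} (hw : IsBraidWord N w) :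
    IsBraidWord N (flipWord N w) := by
  intro i hi
  obtain ⟨j, hj, rfl⟩ := List.mem_map.1 hi
  have := hw j hj
  omega

theorem closedBraid_flip {N : ℕ} {w : List ℕ} (hw : IsBraidWord N w) :
    LinkEquiv (closedBraid N w) (closedBraid N (flipWord N w)) := by
  rcases eq_or_ne w [] with rfl | hne
  · exact LinkEquiv.refl _
  · rw [closedBraid_eq_optLink hw hne,
      closedBraid_eq_optLink (isBraidWord_flipWord hw) (by simpa [flipWord] using hne)]
    have := linkEquiv_flip hw.valid (by simpa using hne)
    simpa [flipWord, Function.comp_def] using this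

/-- This is `linkEquiv_kinkWord` once the idle intervals have been dealt with. -/
theorem closedBraid_inner_destabilize {N : ℕ} (hN : 1 ≤ N) {w : List ℕ} (hw : IsBraidWord N w) :
    LinkEquiv (closedBraid (N + 1) (1 :: w.map (· + 1))) (closedBraid N w) := by
  have h1 : IsBraidWord (N + 1) (1 :: w.map (· + 1)) := by
    rw [isBraidWord_cons]
    refine ⟨by omega, fun i hi => ?_⟩
    obtain ⟨j, hj, rfl⟩ := List.mem_map.1 hi
    have := hw j hj
    omega
  rw [closedBraid_eq_optLink h1 (by simp)]
  have h2 := linkEquiv_kinkWord hN hw.valid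
  refine LinkEquiv.trans ?_ (h2.trans (linkEquiv_idleWord hw))
  have hmap : (w.map some).map (Option.map (· + 1)) = (w.map (· + 1)).map some := by simp
  have hv := (validWord_map_some (w := 1 :: w.map (· + 1))).2 h1
  have hv' : ValidWord (N + 1) ((w.map (· + 1)).map some ++ [some 1]) := by
    intro l hl
    apply hv l
    simpa [or_comm] using hl
  rw [kinkWord, hmap]
  -- Idle intervals can be inserted only at the front of a word, so `σ₁` is first moved to the back
  -- and later returned.
  refine (linkEquiv_optLink_rotate (N + 1) (some 1) ((w.map (· + 1)).map some)).trans
    (LinkEquiv.trans ?_ (linkEquiv_optLink_rotate (N + 1) (some 1)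
      (none :: (w.map (· + 1)).map some)).symm)
  exact (linkEquiv_optLink_none hv' (by simp)).symm

/-- Markov destabilization. -/
theorem closedBraid_destabilize {N : ℕ} (hN : 1 ≤ N) {w : List ℕ} (hw : IsBraidWord N w) :
    LinkEquiv (closedBraid (N + 1) (N :: w)) (closedBraid N w) := by
  have h1 : IsBraidWord (N + 1) (N :: w) := by
    rw [isBraidWord_cons]
    exact ⟨by omega, hw.mono (Nat.le_succ N)⟩
  refine (closedBraid_flip h1).trans (LinkEquiv.trans ?_ (closedBraid_flip hw).symm)
  have h2 : flipWord (N + 1) (N :: w) = 1 :: (flipWord N w).map (· + 1) := by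
    simp only [flipWord, List.map_cons, List.map_map, List.cons.injEq]
    refine ⟨by omega, List.map_congr_left fun i hi => ?_⟩
    have := hw i hi
    simp only [Function.comp]
    omega
  rw [h2]
  exact closedBraid_inner_destabilize hN (isBraidWord_flipWord hw)

/-! ### The positive braid monoid -/

/-- The defining relations of the positive braid monoid. -/
inductive BraidRel : FreeMonoid ℕ → FreeMonoid ℕ → Prop
  | comm (i j : ℕ) (h : i + 2 ≤ j) : BraidRel (FreeMonoid.ofList [i, j]) (FreeMonoid.ofList [j, i])
  | braid (i : ℕ) :
    BraidRel (FreeMonoid.ofList [i, i + 1, i]) (FreeMonoid.ofList [i + 1, i, i + 1])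

/-- The monoid of positive braids on infinitely many strands. -/
abbrev PosBraid : Type := PresentedMonoid BraidRel

/-- The positive braid of a word. -/
def braidOf (w : List ℕ) : PosBraid := PresentedMonoid.mk BraidRel (FreeMonoid.ofList w)

theorem braidOf_append (x y : List ℕ) : braidOf (x ++ y) = braidOf x * braidOf y := rfl

theorem braidOf_cons (i : ℕ) (y : List ℕ) : braidOf (i :: y) = braidOf [i] * braidOf y := rfl

/-- Words that can be exchanged inside any closed braid. -/
def Exchangeable (w w' : List ℕ) : Prop :=
  (∀ N, IsBraidWord N w ↔ IsBraidWord N w') ∧ ∀ N x y, IsBraidWord N (x ++ w ++ y) →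
    LinkEquiv (closedBraid N (x ++ w ++ y)) (closedBraid N (x ++ w' ++ y))

theorem Exchangeable.isBraidWord {w w' : List ℕ} (h : Exchangeable w w') {N : ℕ} {x y : List ℕ}
    (hw : IsBraidWord N (x ++ w ++ y)) : IsBraidWord N (x ++ w' ++ y) := by
  simpa only [isBraidWord_append, h.1] using hw

/-- Conjugation carries the left context behind the right one, so an exchange at the front of a word
is enough. -/
theorem exchangeable_of_prefix {w w' : List ℕ} (hne : w ≠ []) (hne' : w' ≠ [])
    (h : ∀ N, IsBraidWord N w ↔ IsBraidWord N w')
    (he : ∀ N y, IsBraidWord N w → IsBraidWord N y →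
      LinkEquiv (optLink N (w.map some ++ y.map some)) (optLink N (w'.map some ++ y.map some))) :
    Exchangeable w w' := by
  refine ⟨h, fun N x y hN => ?_⟩
  have h1 : IsBraidWord N (w ++ (y ++ x)) := by
    simp only [isBraidWord_append] at hN ⊢
    exact ⟨hN.1.2, hN.2, hN.1.1⟩
  have h2 : IsBraidWord N (w' ++ (y ++ x)) := by
    simpa only [isBraidWord_append, h] using h1
  have h3 := he N (y ++ x) (isBraidWord_append.1 h1).1 (isBraidWord_append.1 h1).2
  rw [← List.map_append, ← List.map_append, ← closedBraid_eq_optLink h1 (by simp [hne]),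
    ← closedBraid_eq_optLink h2 (by simp [hne'])] at h3
  have e1 := closedBraid_append_comm (N := N) (x := w ++ y) (y := x) (by rwa [List.append_assoc])
  have e2 := closedBraid_append_comm (N := N) (x := w' ++ y) (y := x) (by rwa [List.append_assoc])
  simp only [List.append_assoc] at e1 e2 h3 ⊢
  exact e1.symm.trans (h3.trans e2)

theorem exchangeable_of_rel {a b : FreeMonoid ℕ} (h : BraidRel a b) :
    Exchangeable (FreeMonoid.toList a) (FreeMonoid.toList b) := by
  cases h with
  | comm i j h =>
    refine exchangeable_of_prefix (w := [i, j]) (w' := [j, i]) (by simp) (by simp) ?_ ?_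
    · intro N
      simp only [isBraidWord_cons]
      tauto
    · intro N y hw hy
      simp only [isBraidWord_cons] at hw
      exact linkEquiv_far_comm hw.1 hw.2.1 h hy.valid
  | braid i =>
    refine exchangeable_of_prefix (w := [i, i + 1, i]) (w' := [i + 1, i, i + 1])
      (by simp) (by simp) ?_ ?_
    · intro N
      simp only [isBraidWord_cons]
      tauto
    · intro N y hw hy
      simp only [isBraidWord_cons] at hw
      exact linkEquiv_braid_rel ⟨hw.1.1, hw.2.1.2⟩ hy.valid

theorem Exchangeable.trans {w w' w'' : List ℕ} (h : Exchangeable w w') (h' : Exchangeable w' w'') :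
    Exchangeable w w'' :=
  ⟨fun N => (h.1 N).trans (h'.1 N),
    fun N x y hN => (h.2 N x y hN).trans (h'.2 N x y (h.isBraidWord hN))⟩

theorem Exchangeable.symm {w w' : List ℕ} (h : Exchangeable w w') : Exchangeable w' w := by
  refine ⟨fun N => (h.1 N).symm, fun N x y hN => (h.2 N x y ?_).symm⟩
  simpa only [isBraidWord_append, h.1] using hN

theorem Exchangeable.append {w w' v v' : List ℕ} (h : Exchangeable w w') (h' : Exchangeable v v') :
    Exchangeable (w ++ v) (w' ++ v') := by
  refine ⟨fun N => by rw [isBraidWord_append, isBraidWord_append, h.1, h'.1], fun N x y hN => ?_⟩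
  have h1 : IsBraidWord N (x ++ w ++ (v ++ y)) := by simpa only [List.append_assoc] using hN
  have h2 := h.isBraidWord h1
  have h3 : IsBraidWord N (x ++ w' ++ v ++ y) := by simpa only [List.append_assoc] using h2
  have e1 := h.2 N x (v ++ y) h1
  have e2 := h'.2 N (x ++ w') y h3
  simp only [List.append_assoc] at e1 e2 ⊢
  exact e1.trans e2

/-- Exchangeability is a congruence containing the braid relations, hence contains the congruence
they generate. -/
theorem exchangeable_of_braidOf_eq {w w' : List ℕ} (h : braidOf w = braidOf w') :
    Exchangeable w w' := by
  have h1 : conGen BraidRel (FreeMonoid.ofList w) (FreeMonoid.ofList w') := (Con.eq _).1 h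
  have key : ∀ a b : FreeMonoid ℕ, ConGen.Rel BraidRel a b →
      Exchangeable (FreeMonoid.toList a) (FreeMonoid.toList b) := by
    intro a b hab
    induction hab with
    | of a b h => exact exchangeable_of_rel h
    | refl a => exact ⟨fun _ => Iff.rfl, fun _ _ _ _ => LinkEquiv.refl _⟩
    | symm _ ih => exact ih.symm
    | trans _ _ ih ih' => exact ih.trans ih'
    | mul _ _ ih ih' => exact ih.append ih'
  exact key _ _ h1

theorem closedBraid_congr {N : ℕ} {w w' : List ℕ} (hw : IsBraidWord N w)
    (h : braidOf w = braidOf w') : LinkEquiv (closedBraid N w) (closedBraid N w') := by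
  have := (exchangeable_of_braidOf_eq h).2 N [] [] (by simpa using hw)
  simpa using this

theorem braidOf_comm {i j : ℕ} (h : i + 2 ≤ j) : Commute (braidOf [i]) (braidOf [j]) :=
  (Con.eq _).2 (ConGen.Rel.of _ _ (BraidRel.comm i j h))

theorem braidOf_braid (i : ℕ) : braidOf [i] * braidOf [i + 1] * braidOf [i] =
    braidOf [i + 1] * braidOf [i] * braidOf [i + 1] :=
  (Con.eq _).2 (ConGen.Rel.of _ _ (BraidRel.braid i))

theorem braidOf_wordPow (w : List ℕ) (s : ℕ) : braidOf (wordPow w s) = braidOf w ^ s := by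
  induction s with
  | zero => rfl
  | succ s ih =>
    rw [wordPow, List.replicate_succ, List.flatten_cons, braidOf_append, pow_succ', ← ih]
    rfl

theorem commute_braidOf {w : List ℕ} {x : PosBraid} (h : ∀ i ∈ w, Commute (braidOf [i]) x) :
    Commute (braidOf w) x := by
  induction w with
  | nil => exact Commute.one_left x
  | cons i w ih =>
    rw [List.forall_mem_cons] at h
    rw [braidOf_cons]
    exact h.1.mul_left (ih h.2)

theorem commute_far {w : List ℕ} {n : ℕ} (h : ∀ i ∈ w, i + 2 ≤ n) :
    Commute (braidOf w) (braidOf [n]) := commute_braidOf fun i hi => braidOf_comm (h i hi)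

/-- A braid moving each letter of a word by one step moves the word. -/
theorem semiconjBy_succ {x : PosBraid} {w : List ℕ}
    (h : ∀ i ∈ w, SemiconjBy x (braidOf [i]) (braidOf [i + 1])) :
    SemiconjBy x (braidOf w) (braidOf (w.map (· + 1))) := by
  induction w with
  | nil => exact SemiconjBy.one_right x
  | cons i w ih =>
    rw [List.forall_mem_cons] at h
    rw [List.map_cons, braidOf_cons, braidOf_cons (i + 1)]
    exact h.1.mul_right (ih h.2)

theorem semiconjBy_pred {x : PosBraid} {w : List ℕ}
    (h : ∀ i ∈ w, SemiconjBy x (braidOf [i + 1]) (braidOf [i])) :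
    SemiconjBy x (braidOf (w.map (· + 1))) (braidOf w) := by
  induction w with
  | nil => exact SemiconjBy.one_right x
  | cons i w ih =>
    rw [List.forall_mem_cons] at h
    rw [List.map_cons, braidOf_cons i, braidOf_cons (i + 1)]
    exact h.1.mul_right (ih h.2)

/-! ### Powers of `σ_1⋯σ_{n-1}` and the full twist -/

theorem ascWord_succ {n : ℕ} (hn : 1 ≤ n) : ascWord (n + 1) = ascWord n ++ [n] := by
  obtain ⟨m, rfl⟩ : ∃ m, n = m + 1 := ⟨n - 1, by omega⟩
  simp only [ascWord, Nat.add_sub_cancel]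
  rw [List.range'_1_concat, Nat.add_comm]

theorem mem_ascWord {i n : ℕ} : i ∈ ascWord n ↔ 1 ≤ i ∧ i < n := by
  rw [ascWord, List.mem_range'_1]
  omega

theorem mem_descWord {i p u : ℕ} (h1 : 1 ≤ u) (h2 : u ≤ p) :
    i ∈ descWord p u ↔ p - u + 1 ≤ i ∧ i < p := by
  rw [descWord, List.mem_reverse, List.mem_range'_1]
  omega

theorem descWord_succ_succ {p u : ℕ} (h1 : 1 ≤ u) (h2 : u ≤ p) :
    descWord (p + 1) (u + 1) = p :: descWord p u := by
  obtain ⟨m, rfl⟩ : ∃ m, u = m + 1 := ⟨u - 1, by omega⟩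
  rw [descWord, descWord]
  simp only [Nat.add_sub_cancel]
  rw [List.range'_1_concat, List.reverse_append, List.reverse_singleton, List.singleton_append,
    show p + 1 - (m + 1 + 1) + 1 + m = p by omega,
    show p + 1 - (m + 1 + 1) + 1 = p - (m + 1) + 1 by omega]

theorem map_succ_range' (a n : ℕ) :
    (List.range' a n).map (· + 1) = List.range' (a + 1) n := by
  rw [Nat.add_comm a 1, ← List.map_add_range']
  exact List.map_congr_left fun i _ => Nat.add_comm i 1

theorem descWord_succ {p u : ℕ} (h2 : u ≤ p) :
    descWord (p + 1) u = (descWord p u).map (· + 1) := by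
  rw [descWord, descWord, List.map_reverse, map_succ_range',
    show p + 1 - u + 1 = p - u + 1 + 1 by omega]

theorem descWord_self (p : ℕ) : descWord p p = (ascWord p).reverse := by
  rw [descWord, ascWord, Nat.sub_self, zero_add]

/-- For n = i + 2 this is the braid relation on the last two letters, `σ_{i+1}` having commuted past
the earlier ones; all further letters of the sweep commute with `σ_i`. -/
theorem semiconjBy_asc {n i : ℕ} (h1 : 1 ≤ i) (h2 : i + 1 < n) :
    SemiconjBy (braidOf (ascWord n)) (braidOf [i]) (braidOf [i + 1]) := by
  obtain ⟨m, rfl⟩ : ∃ m, n = i + 2 + m := ⟨n - (i + 2), by omega⟩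
  clear h2
  induction m with
  | zero =>
    have hA : braidOf (ascWord (i + 2)) = braidOf (ascWord i) * braidOf [i] * braidOf [i + 1] := by
      rw [ascWord_succ (by omega), ascWord_succ h1, braidOf_append, braidOf_append]
    have hc : Commute (braidOf (ascWord i)) (braidOf [i + 1]) :=
      commute_far fun j hj => by rw [mem_ascWord] at hj; omega
    rw [Nat.add_zero, SemiconjBy, hA]
    calc _ = braidOf (ascWord i) * (braidOf [i] * braidOf [i + 1] * braidOf [i]) := by
          simp only [mul_assoc]
      _ = braidOf (ascWord i) * braidOf [i + 1] * (braidOf [i] * braidOf [i + 1]) := by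
          rw [braidOf_braid]; simp only [mul_assoc]
      _ = _ := by rw [hc.eq]; simp only [mul_assoc]
  | succ m ih =>
    rw [show i + 2 + (m + 1) = i + 2 + m + 1 by omega, ascWord_succ (by omega), braidOf_append]
    exact ih.mul_left (braidOf_comm (by omega)).symm

theorem semiconjBy_desc {n u i : ℕ} (hu : u ≤ n) (h1 : n - u + 1 ≤ i) (h2 : i < n) :
    SemiconjBy (braidOf (descWord (n + 1) (u + 1))) (braidOf [i + 1]) (braidOf [i]) := by
  obtain ⟨m, rfl⟩ : ∃ m, n = i + 1 + m := ⟨n - (i + 1), by omega⟩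
  clear h2
  induction m generalizing u with
  | zero =>
    obtain ⟨t, rfl⟩ : ∃ t, u = t + 2 := ⟨u - 2, by omega⟩
    have hD : braidOf (descWord (i + 1 + 1) (t + 2 + 1)) =
        braidOf [i + 1] * (braidOf [i] * braidOf (descWord i (t + 1))) := by
      rw [descWord_succ_succ (by omega) (by omega), descWord_succ_succ (by omega) (by omega),
        braidOf_cons, braidOf_cons i]
    have hc : Commute (braidOf (descWord i (t + 1))) (braidOf [i + 1]) :=
      commute_far fun j hj => by
        rw [mem_descWord (by omega) (by omega)] at hj
        omega
    rw [Nat.add_zero, SemiconjBy, hD]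
    calc _ = braidOf [i + 1] * braidOf [i] * (braidOf (descWord i (t + 1)) * braidOf [i + 1]) := by
          simp only [mul_assoc]
      _ = braidOf [i + 1] * braidOf [i] * braidOf [i + 1] * braidOf (descWord i (t + 1)) := by
          rw [hc.eq]; simp only [mul_assoc]
      _ = _ := by rw [← braidOf_braid]; simp only [mul_assoc]
  | succ m ih =>
    obtain ⟨t, rfl⟩ : ∃ t, u = t + 1 := ⟨u - 1, by omega⟩
    rw [descWord_succ_succ (by omega) (by omega), braidOf_cons]
    have hc : SemiconjBy (braidOf [i + 1 + (m + 1)]) (braidOf [i]) (braidOf [i]) :=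
      (braidOf_comm (by omega)).symm
    exact SemiconjBy.mul_left hc (ih (u := t) (by omega) (by omega))

/-- Induction: A_n^u D_{n+1,u+1} A_{n+1} = A_n^u A_{n+1} D_{n,u+1}, because A_{n+1} raises indices
by one; then A_{n+1} = A_n σ_n, and σ_n D_{n,u+1} = D_{n+1,u+2}. -/
theorem asc_pow {n u : ℕ} (hn : 1 ≤ n) (hu : u ≤ n) : braidOf (ascWord (n + 1)) ^ u =
    braidOf (ascWord n) ^ u * braidOf (descWord (n + 1) (u + 1)) := by
  induction u with
  | zero => rw [pow_zero, pow_zero, one_mul]; rfl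
  | succ u ih =>
    have h1 : SemiconjBy (braidOf (ascWord (n + 1))) (braidOf (descWord n (u + 1)))
        (braidOf (descWord (n + 1) (u + 1))) := by
      rw [descWord_succ hu]
      refine semiconjBy_succ fun i hi => ?_
      rw [mem_descWord (by omega) hu] at hi
      exact semiconjBy_asc (by omega) (by omega)
    rw [pow_succ, ih (by omega), mul_assoc, ← h1.eq, ascWord_succ hn, braidOf_append,
      descWord_succ_succ (by omega) hu, braidOf_cons n (descWord n (u + 1)), pow_succ]
    simp only [mul_assoc]

/-- The reversal of positive braids. -/
def braidReverse : PosBraid →* PosBraidᵐᵒᵖ :=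
  PresentedMonoid.lift (fun i => MulOpposite.op (braidOf [i])) (by
    intro a b h
    cases h with
    | comm i j h =>
      exact congrArg MulOpposite.op (braidOf_comm h).eq.symm
    | braid i =>
      refine congrArg MulOpposite.op ?_
      change braidOf [i] * (braidOf [i + 1] * braidOf [i]) =
        braidOf [i + 1] * (braidOf [i] * braidOf [i + 1])
      simpa only [mul_assoc] using braidOf_braid i)

theorem braidReverse_braidOf (w : List ℕ) :
    braidReverse (braidOf w) = MulOpposite.op (braidOf w.reverse) := by
  induction w with
  | nil => exact map_one _
  | cons i w ih =>
    rw [braidOf_cons, map_mul, ih, List.reverse_cons, braidOf_append, MulOpposite.op_mul]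
    rfl

/-- The reversal of `asc_pow` at u = n. -/
theorem desc_pow {n : ℕ} (hn : 1 ≤ n) : braidOf (descWord (n + 1) (n + 1)) ^ n =
    braidOf (ascWord (n + 1)) * braidOf (descWord n n) ^ n := by
  have h := congrArg braidReverse (asc_pow hn le_rfl)
  rw [map_mul, map_pow, map_pow, braidReverse_braidOf, braidReverse_braidOf, braidReverse_braidOf,
    descWord_self, List.reverse_reverse, ← MulOpposite.op_pow, ← MulOpposite.op_pow,
    ← MulOpposite.op_mul, MulOpposite.op_inj] at h
  rw [descWord_self, descWord_self, h]

/-- The two expressions of the full twist. -/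
theorem desc_pow_self {p : ℕ} (hp : 1 ≤ p) :
    braidOf (descWord p p) ^ p = braidOf (ascWord p) ^ p := by
  induction p, hp using Nat.le_induction with
  | base => rfl
  | succ n hn ih =>
    -- The ascending sweep raises each `σ_i` with i < n by one and the descending sweep lowers it
    -- back.
    have hc : Commute (braidOf (ascWord n) ^ n)
        (braidOf (descWord (n + 1) (n + 1)) * braidOf (ascWord (n + 1))) := by
      refine Commute.pow_left (commute_braidOf fun i hi => ?_) n
      rw [mem_ascWord] at hi
      have h1 := semiconjBy_asc (n := n + 1) hi.1 (by omega)
      have h2 := semiconjBy_desc (n := n) (u := n) (i := i) le_rfl (by omega) hi.2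
      exact (h2.mul_left h1).symm
    rw [pow_succ', desc_pow hn, ih, ← mul_assoc, ← hc.eq, ← mul_assoc, ← asc_pow hn le_rfl,
      ← pow_succ]

/-- With A = A_n σ_n = σ_1 A' and A A_n = A' A, one has A² = A' A σ_n, so σ_1 A² = σ_1 A' A σ_n = A²
σ_n. -/
theorem asc_sq_last {n : ℕ} (hn : 1 ≤ n) :
    SemiconjBy (braidOf (ascWord (n + 1)) ^ 2) (braidOf [n]) (braidOf [1]) := by
  have h1 : SemiconjBy (braidOf (ascWord (n + 1))) (braidOf (ascWord n))
      (braidOf ((ascWord n).map (· + 1))) := by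
    refine semiconjBy_succ fun i hi => ?_
    rw [mem_ascWord] at hi
    exact semiconjBy_asc hi.1 (by omega)
  have h2 : ascWord (n + 1) = 1 :: (ascWord n).map (· + 1) := by
    obtain ⟨m, rfl⟩ : ∃ m, n = m + 1 := ⟨n - 1, by omega⟩
    simp only [ascWord, Nat.add_sub_cancel, map_succ_range']
    rfl
  have h3 : braidOf (ascWord (n + 1)) = braidOf [1] * braidOf ((ascWord n).map (· + 1)) := by
    rw [h2, braidOf_cons]
  have h4 : braidOf (ascWord (n + 1)) = braidOf (ascWord n) * braidOf [n] := by
    rw [ascWord_succ hn, braidOf_append]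
  have h5 : braidOf (ascWord (n + 1)) ^ 2 =
      braidOf ((ascWord n).map (· + 1)) * (braidOf (ascWord (n + 1)) * braidOf [n]) := by
    rw [pow_two]
    nth_rewrite 2 [h4]
    rw [← mul_assoc, h1.eq, mul_assoc]
  rw [SemiconjBy]
  nth_rewrite 2 [h5]
  rw [← mul_assoc, ← h3, pow_two, mul_assoc]

theorem asc_pow_semiconj {p i k : ℕ} (hi : 1 ≤ i) (hk : i + k < p) :
    SemiconjBy (braidOf (ascWord p) ^ k) (braidOf [i]) (braidOf [i + k]) := by
  induction k with
  | zero => exact SemiconjBy.one_left _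
  | succ k ih =>
    rw [pow_succ']
    exact (semiconjBy_asc (n := p) (i := i + k) (by omega) (by omega)).mul_left (ih (by omega))

/-- The full twist is central. -/
theorem commute_fullTwist {p : ℕ} {w : List ℕ} (hw : IsBraidWord p w) :
    Commute (braidOf w) (braidOf (ascWord p) ^ p) := by
  refine commute_braidOf fun i hi => ?_
  obtain ⟨h1, h2⟩ := hw i hi
  obtain ⟨n, rfl⟩ : ∃ n, p = n + 1 := ⟨p - 1, by omega⟩
  -- Conjugation by the sweep shifts `σ_i` up to `σ_n` in n - i steps, wraps round to `σ_1` in 2,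
  -- and climbs back to `σ_i` in i - 1: n + 1 steps in all.
  have e1 := asc_pow_semiconj (p := n + 1) (i := i) (k := n - i) h1 (by omega)
  have e2 := asc_sq_last (n := n) (by omega)
  have e3 := asc_pow_semiconj (p := n + 1) (i := 1) (k := i - 1) le_rfl (by omega)
  rw [show i + (n - i) = n by omega] at e1
  rw [show 1 + (i - 1) = i by omega] at e3
  have := (e3.mul_left e2).mul_left e1
  rw [← pow_add, ← pow_add, show i - 1 + 2 + (n - i) = n + 1 by omega] at this
  exact this.symm

/-! ### Trading strands for descending factors -/

/-- The word `(σ_{p-1} ⋯ σ_{p-u₁+1})^{v₁} ⋯ (σ_{p-1} ⋯ σ_{p-u_m+1})^{v_m}`. -/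
def overWord (p : ℕ) (W : List (ℕ × ℕ)) : List ℕ :=
  W.flatMap fun x => wordPow (descWord p x.1) x.2

theorem overWord_append (p : ℕ) (W W' : List (ℕ × ℕ)) :
    overWord p (W ++ W') = overWord p W ++ overWord p W' := List.flatMap_append

/-- As x ≤ u, all letters of D_{P+1,x} lie in the range which D_{P+1,u+1} lowers by one, and the
lowered word is D_{P,x}. -/
theorem semiconjBy_overWord {P u : ℕ} (hu : u ≤ P) {W : List (ℕ × ℕ)}
    (hW : ∀ x ∈ W, 1 ≤ x.1 ∧ x.1 ≤ u) :
    SemiconjBy (braidOf (descWord (P + 1) (u + 1))) (braidOf (overWord (P + 1) W))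
      (braidOf (overWord P W)) := by
  induction W with
  | nil => exact SemiconjBy.one_right _
  | cons x W ih =>
    rw [List.forall_mem_cons] at hW
    obtain ⟨⟨h1, h2⟩, h3⟩ := hW
    have hx : SemiconjBy (braidOf (descWord (P + 1) (u + 1))) (braidOf (descWord (P + 1) x.1))
        (braidOf (descWord P x.1)) := by
      rw [descWord_succ (h2.trans hu)]
      refine semiconjBy_pred fun i hi => ?_
      rw [mem_descWord h1 (by omega)] at hi
      exact semiconjBy_desc hu (by omega) hi.2
    have hcons : ∀ p, overWord p (x :: W) = wordPow (descWord p x.1) x.2 ++ overWord p W :=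
      fun _ => List.flatMap_cons
    rw [hcons, hcons, braidOf_append, braidOf_append, braidOf_wordPow, braidOf_wordPow]
    exact (hx.pow_right _).mul_right (ih h3)

theorem isBraidWord_wordPow {N : ℕ} {w : List ℕ} (hw : IsBraidWord N w) (s : ℕ) :
    IsBraidWord N (wordPow w s) := by
  intro i hi
  simp only [wordPow, List.mem_flatten] at hi
  obtain ⟨l, hl, hil⟩ := hi
  rw [List.eq_of_mem_replicate hl] at hil
  exact hw i hil

theorem isBraidWord_ascWord {N r : ℕ} (h : r ≤ N) : IsBraidWord N (ascWord r) := by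
  intro i hi
  rw [mem_ascWord] at hi
  omega

theorem isBraidWord_descWord {p u : ℕ} (h1 : 1 ≤ u) (h2 : u ≤ p) :
    IsBraidWord p (descWord p u) := by
  intro i hi
  rw [mem_descWord h1 h2] at hi
  omega

theorem isBraidWord_overWord {p : ℕ} {W : List (ℕ × ℕ)} (hW : ∀ x ∈ W, 1 ≤ x.1 ∧ x.1 ≤ p) :
    IsBraidWord p (overWord p W) := by
  intro i hi
  obtain ⟨x, hx, hix⟩ := List.mem_flatMap.1 hi
  exact isBraidWord_wordPow (isBraidWord_descWord (hW x hx).1 (hW x hx).2) _ i hix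

theorem isBraidWord_tWord {p : ℕ} {W : List (ℕ × ℕ)} (hW : ∀ x ∈ W, x.1 ≤ p) :
    IsBraidWord p (tWord W) := by
  intro i hi
  obtain ⟨x, hx, hix⟩ := List.mem_flatMap.1 hi
  exact isBraidWord_wordPow (isBraidWord_ascWord (hW x hx)) _ i hix

/-- Replace A_{P+1}^u by A_P^u σ_P D_{P,u}, carry the last two factors past the descending blocks,
which drop to P strands, and destabilize at the only remaining `σ_P`. -/
theorem closedBraid_destabilize_asc {P u : ℕ} (hu : 1 ≤ u) (huP : u ≤ P) {β : List ℕ}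
    (hβ : IsBraidWord P β) {W : List (ℕ × ℕ)} (hW : ∀ x ∈ W, 1 ≤ x.1 ∧ x.1 ≤ u) :
    LinkEquiv (closedBraid (P + 1) (β ++ (wordPow (ascWord (P + 1)) u ++ overWord (P + 1) W)))
      (closedBraid P (β ++ (wordPow (ascWord P) u ++ (overWord P W ++ descWord P u)))) := by
  have hP : 1 ≤ P := by omega
  have hA := isBraidWord_wordPow (isBraidWord_ascWord (le_refl P)) u
  have hO := isBraidWord_overWord (p := P) (W := W) fun x hx => ⟨(hW x hx).1, (hW x hx).2.trans huP⟩
  have hO' := isBraidWord_overWord (p := P + 1) (W := W) fun x hx =>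
    ⟨(hW x hx).1, by have := (hW x hx).2; omega⟩
  have hD := isBraidWord_descWord hu huP
  have hX : IsBraidWord P (β ++ (wordPow (ascWord P) u ++ overWord P W)) :=
    isBraidWord_append.2 ⟨hβ, isBraidWord_append.2 ⟨hA, hO⟩⟩
  have hDX := isBraidWord_append.2 ⟨hD, hX⟩
  have hXD := isBraidWord_append.2 ⟨hX, hD⟩
  have hsingle : IsBraidWord (P + 1) [P] := by
    rw [isBraidWord_cons]
    exact ⟨by omega, isBraidWord_nil _⟩
  have e1 : LinkEquiv
      (closedBraid (P + 1) (β ++ (wordPow (ascWord (P + 1)) u ++ overWord (P + 1) W)))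
      (closedBraid (P + 1) ((β ++ (wordPow (ascWord P) u ++ overWord P W)) ++
        (P :: descWord P u))) := by
    refine closedBraid_congr (isBraidWord_append.2 ⟨hβ.mono (Nat.le_succ P), isBraidWord_append.2
      ⟨isBraidWord_wordPow (isBraidWord_ascWord le_rfl) u, hO'⟩⟩) ?_
    rw [← descWord_succ_succ hu huP]
    simp only [braidOf_append, braidOf_wordPow, asc_pow hP huP, mul_assoc,
      (semiconjBy_overWord huP hW).eq]
  have e2 := closedBraid_append_comm (N := P + 1)
    (x := β ++ (wordPow (ascWord P) u ++ overWord P W)) (y := P :: descWord P u)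
    (isBraidWord_append.2 ⟨hX.mono (Nat.le_succ P), isBraidWord_cons.2
      ⟨(isBraidWord_cons.1 hsingle).1, hD.mono (Nat.le_succ P)⟩⟩)
  have e3 := closedBraid_destabilize hP hDX
  have e4 := closedBraid_append_comm hDX
  have := e1.trans (e2.trans (e3.trans e4))
  simpa only [List.append_assoc] using this

theorem closedBraid_destabilize_asc_iterate {P u : ℕ} (hu : 1 ≤ u) (huP : u ≤ P) {β : List ℕ}
    (hβ : IsBraidWord P β) (v : ℕ) {W : List (ℕ × ℕ)} (hW : ∀ x ∈ W, 1 ≤ x.1 ∧ x.1 ≤ u) :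
    LinkEquiv (closedBraid (P + v) (β ++ (wordPow (ascWord (P + v)) u ++ overWord (P + v) W)))
      (closedBraid P (β ++ (wordPow (ascWord P) u ++ overWord P (W ++ [(u, v)])))) := by
  induction v generalizing W with
  | zero =>
    have : overWord P (W ++ [(u, 0)]) = overWord P W := by
      rw [overWord_append]
      simp [overWord, wordPow]
    rw [this]
    exact LinkEquiv.refl _
  | succ v ih =>
    have h1 := closedBraid_destabilize_asc (P := P + v) hu (by omega)
      (hβ.mono (Nat.le_add_right P v)) hW
    have h2 := ih (W := W ++ [(u, 1)]) (by
      intro x hx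
      rcases List.mem_append.1 hx with hx | hx
      · exact hW x hx
      · rw [List.mem_singleton.1 hx]
        exact ⟨hu, le_rfl⟩)
    have h3 : overWord (P + v) (W ++ [(u, 1)]) = overWord (P + v) W ++ descWord (P + v) u := by
      rw [overWord_append]
      simp [overWord, wordPow]
    have h4 : overWord P (W ++ [(u, 1)] ++ [(u, v)]) = overWord P (W ++ [(u, v + 1)]) := by
      simp only [overWord_append, List.append_assoc]
      simp [overWord, wordPow, List.replicate_succ]
    rw [h3, h4] at h2
    exact h1.trans h2

theorem wordPow_add (w : List ℕ) (a b : ℕ) : wordPow w (a + b) = wordPow w a ++ wordPow w b := by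
  rw [wordPow, List.replicate_add, List.flatten_append]
  rfl

theorem tWord_cons (x : ℕ × ℕ) (L : List (ℕ × ℕ)) :
    tWord (x :: L) = wordPow (ascWord x.1) x.2 ++ tWord L := List.flatMap_cons

/-- The number of strands of the T-link with parameters `dualTail p q l`. -/
def topStrands (p : ℕ) (l : List (ℕ × ℕ)) : ℕ := p + (l.map Prod.snd).sum

theorem topStrands_cons (p : ℕ) (x : ℕ × ℕ) (l : List (ℕ × ℕ)) :
    topStrands p (x :: l) = topStrands (p + x.2) l := by
  simp only [topStrands, List.map_cons, List.sum_cons]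
  omega

theorem foldr_max_dualTail (p q : ℕ) (l : List (ℕ × ℕ)) :
    ((dualTail p q l).map Prod.fst).foldr max 0 = topStrands p l := by
  induction l generalizing p q with
  | nil => simp [dualTail, topStrands]
  | cons x l ih =>
    rw [topStrands_cons, ← ih (p + x.2) x.1]
    obtain ⟨u, v⟩ := x
    simp only [dualTail, List.map_cons, List.foldr_cons]
    rw [ih]
    apply max_eq_right
    simp only [topStrands]
    omega

theorem foldr_max_append {R : List (ℕ × ℕ)} {p q : ℕ} (hR : ∀ x ∈ R, x.1 ≤ p)
    (l : List (ℕ × ℕ)) :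
    ((R ++ dualTail p q l).map Prod.fst).foldr max 0 = topStrands p l := by
  induction R with
  | nil => exact foldr_max_dualTail p q l
  | cons x R ih =>
    rw [List.forall_mem_cons] at hR
    rw [List.cons_append, List.map_cons, List.foldr_cons, ih hR.2]
    apply max_eq_right
    have := hR.1
    simp only [topStrands]
    omega

/-- The strands are removed from the outside inwards. By induction the rest of the tail has become
A_{p+v}^u followed by descending blocks of width at most u; removing v more strands turns this into
A_p^u with the block D_{p,u}^v appended, and A_p^{q-u} restores A_p^q. -/
theorem closedBraid_dualTail {p q : ℕ} {β : List ℕ} (hβ : IsBraidWord p β) {l : List (ℕ × ℕ)}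
    (hl : ∀ x ∈ l, 1 ≤ x.1 ∧ x.1 ≤ p ∧ x.1 ≤ q) (hs : l.Pairwise fun x y => y.1 ≤ x.1) :
    LinkEquiv (closedBraid (topStrands p l) (β ++ tWord (dualTail p q l)))
      (closedBraid p (β ++ (wordPow (ascWord p) q ++ overWord p l.reverse))) := by
  induction l generalizing p q β with
  | nil =>
    simp only [topStrands, dualTail, tWord_cons, List.map_nil, List.sum_nil, Nat.add_zero,
      List.reverse_nil]
    exact LinkEquiv.refl _
  | cons x l ih =>
    obtain ⟨u, v⟩ := x
    rw [List.forall_mem_cons] at hl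
    rw [List.pairwise_cons] at hs
    obtain ⟨⟨h1, h2, h3⟩, hl⟩ := hl
    dsimp only at h1 h2 h3
    have hβ' : IsBraidWord p (β ++ wordPow (ascWord p) (q - u)) :=
      isBraidWord_append.2 ⟨hβ, isBraidWord_wordPow (isBraidWord_ascWord le_rfl) _⟩
    have e1 := ih (p := p + v) (q := u) (hβ'.mono (Nat.le_add_right p v)) (fun x hx =>
      ⟨(hl x hx).1, by have := (hl x hx).2.1; omega, hs.1 x hx⟩) hs.2
    have e2 := closedBraid_destabilize_asc_iterate h1 h2 hβ' v (W := l.reverse) (fun x hx =>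
      ⟨(hl x (List.mem_reverse.1 hx)).1, hs.1 x (List.mem_reverse.1 hx)⟩)
    have h4 : wordPow (ascWord p) q
        = wordPow (ascWord p) (q - u) ++ wordPow (ascWord p) u := by
      rw [← wordPow_add, Nat.sub_add_cancel h3]
    rw [topStrands_cons, dualTail, tWord_cons, List.reverse_cons, h4]
    have := e1.trans e2
    simpa only [List.append_assoc] using this

/-! ### Effect of the half-turn on words -/

theorem flipWord_append (N : ℕ) (x y : List ℕ) :
    flipWord N (x ++ y) = flipWord N x ++ flipWord N y := List.map_append

theorem flipWord_wordPow (N : ℕ) (w : List ℕ) (s : ℕ) :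
    flipWord N (wordPow w s) = wordPow (flipWord N w) s := by
  simp only [flipWord, wordPow, List.map_flatten, List.map_replicate]

theorem flipWord_ascWord {p r : ℕ} (hr : r ≤ p) : flipWord p (ascWord r) = descWord p r := by
  apply List.ext_getElem
  · simp [flipWord, ascWord, descWord]
  · intro i h1 h2
    simp only [flipWord, ascWord, descWord, List.getElem_map, List.getElem_range',
      List.getElem_reverse, List.length_range']
    simp only [flipWord, ascWord, List.length_map, List.length_range'] at h1
    omega

theorem flipWord_flipWord {N : ℕ} {w : List ℕ} (hw : IsBraidWord N w) :
    flipWord N (flipWord N w) = w := by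
  rw [flipWord, flipWord, List.map_map]
  conv_rhs => rw [← List.map_id w]
  refine List.map_congr_left fun i hi => ?_
  have := hw i hi
  simp only [Function.comp, id]
  omega

theorem flipWord_descWord {p u : ℕ} (hu : u ≤ p) : flipWord p (descWord p u) = ascWord u := by
  rw [← flipWord_ascWord hu, flipWord_flipWord (isBraidWord_ascWord hu)]

theorem flipWord_tWord {p : ℕ} {W : List (ℕ × ℕ)} (hW : ∀ x ∈ W, x.1 ≤ p) :
    flipWord p (tWord W) = overWord p W := by
  induction W with
  | nil => rfl
  | cons x W ih =>
    rw [List.forall_mem_cons] at hW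
    rw [tWord_cons, flipWord_append, flipWord_wordPow, flipWord_ascWord hW.1, ih hW.2]
    simp only [overWord, List.flatMap_cons]

theorem flipWord_overWord {p : ℕ} {W : List (ℕ × ℕ)} (hW : ∀ x ∈ W, x.1 ≤ p) :
    flipWord p (overWord p W) = tWord W := by
  rw [← flipWord_tWord hW, flipWord_flipWord (isBraidWord_tWord hW)]

/-! ### Comparison of both T-links with the V-link -/

theorem vLink_linkEquiv_first {U R : List (ℕ × ℕ)} {p q : ℕ} (hpq : p ≤ q)
    (hR : ∀ x ∈ R, x.1 ≤ p) (hU : ∀ x ∈ U, 1 ≤ x.1 ∧ x.1 ≤ p)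
    (hs : U.Pairwise fun x y => x.1 ≤ y.1) :
    LinkEquiv (VLink U R p q) (TLink (R ++ dualTail p q U.reverse)) := by
  have hβ := isBraidWord_tWord hR
  have hA := isBraidWord_wordPow (isBraidWord_ascWord (le_refl p)) q
  have h1 := closedBraid_dualTail (q := q) hβ (l := U.reverse) (fun x hx => by
    have := hU x (List.mem_reverse.1 hx)
    exact ⟨this.1, this.2, this.2.trans hpq⟩) (List.pairwise_reverse.2 hs)
  rw [List.reverse_reverse] at h1
  have h2 : tWord (R ++ dualTail p q U.reverse) = tWord R ++ tWord (dualTail p q U.reverse) :=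
    List.flatMap_append
  rw [TLink, foldr_max_append hR, h2]
  refine LinkEquiv.trans ?_ h1.symm
  have h3 := closedBraid_append_comm (N := p) (x := overWord p U)
    (y := tWord R ++ wordPow (ascWord p) q)
    (isBraidWord_append.2 ⟨isBraidWord_overWord hU, isBraidWord_append.2 ⟨hβ, hA⟩⟩)
  change LinkEquiv (closedBraid p (overWord p U ++ tWord R ++ wordPow (ascWord p) q)) _
  simpa only [List.append_assoc] using h3

theorem vLink_linkEquiv_second {U R : List (ℕ × ℕ)} {p q : ℕ} (hp : 0 < p) (hpq : p ≤ q)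
    (hR : ∀ x ∈ R, 1 ≤ x.1 ∧ x.1 ≤ p) (hU : ∀ x ∈ U, 1 ≤ x.1 ∧ x.1 ≤ p)
    (hs : R.Pairwise fun x y => x.1 ≤ y.1) :
    LinkEquiv (VLink U R p q) (TLink (U ++ dualTail q p R.reverse)) := by
  have hU' : ∀ x ∈ U, x.1 ≤ p := fun x hx => (hU x hx).2
  have hR' : ∀ x ∈ R, x.1 ≤ p := fun x hx => (hR x hx).2
  have hβ := isBraidWord_tWord hU'
  have hA := isBraidWord_ascWord (le_refl p)
  have hD := isBraidWord_descWord hp (le_refl p)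
  have h1 := closedBraid_dualTail (q := p) (hβ.mono hpq) (l := R.reverse) (fun x hx => by
    have := hR x (List.mem_reverse.1 hx)
    exact ⟨this.1, this.2.trans hpq, this.2⟩) (List.pairwise_reverse.2 hs)
  rw [List.reverse_reverse] at h1
  have h2 : tWord (U ++ dualTail q p R.reverse) = tWord U ++ tWord (dualTail q p R.reverse) :=
    List.flatMap_append
  rw [TLink, foldr_max_append (fun x hx => (hU' x hx).trans hpq), h2]
  refine LinkEquiv.trans ?_ h1.symm
  obtain ⟨d, rfl⟩ := Nat.exists_eq_add_of_le hpq
  -- The exponent of A_q is only p, so the q - p superfluous strands can also be removed, each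
  -- leaving a factor D_{p,p}.
  have h3 := closedBraid_destabilize_asc_iterate hp le_rfl hβ d hR
  have h4 : overWord p (R ++ [(p, d)]) = overWord p R ++ wordPow (descWord p p) d := by
    rw [overWord_append]
    simp [overWord]
  rw [h4] at h3
  refine LinkEquiv.trans ?_ h3.symm
  have h5 := closedBraid_flip (N := p)
    (w := tWord U ++ (wordPow (ascWord p) p ++ (overWord p R ++ wordPow (descWord p p) d)))
    (isBraidWord_append.2 ⟨hβ, isBraidWord_append.2 ⟨isBraidWord_wordPow hA p,
      isBraidWord_append.2 ⟨isBraidWord_overWord hR, isBraidWord_wordPow hD d⟩⟩⟩)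
  refine LinkEquiv.trans ?_ h5.symm
  rw [flipWord_append, flipWord_append, flipWord_append, flipWord_wordPow, flipWord_wordPow,
    flipWord_ascWord le_rfl, flipWord_descWord le_rfl, flipWord_tWord hU', flipWord_overWord hR']
  refine closedBraid_congr ?_ ?_
  · exact isBraidWord_append.2 ⟨isBraidWord_append.2 ⟨isBraidWord_overWord hU,
      isBraidWord_tWord hR'⟩, isBraidWord_wordPow hA _⟩
  -- After the half-turn the word contains D_{p,p}^p, which is the full twist A_p^p; it commutes
  -- past the middle factor and joins A_p^d to form A_p^q.
  · have hc := commute_fullTwist (isBraidWord_tWord hR')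
    change braidOf (overWord p U ++ tWord R ++ wordPow (ascWord p) (p + d)) = _
    simp only [braidOf_append, braidOf_wordPow, desc_pow_self hp, pow_add, mul_assoc]
    rw [← mul_assoc (braidOf (tWord R)), hc.eq]
    simp only [mul_assoc]

theorem mainTheorem2 (n m : ℕ) (r s : Fin n → ℕ) (u v : Fin m → ℕ) (p q : ℕ)
    (hr_two : ∀ i, 2 ≤ r i) (hr_mono : StrictMono r) (hr_lt : ∀ i, r i < p)
    (hs_pos : ∀ i, 0 < s i)
    (hu_two : ∀ j, 2 ≤ u j) (hu_mono : StrictMono u) (hu_le : ∀ j, u j ≤ p)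
    (hv_pos : ∀ j, 0 < v j)
    (hp_pos : 0 < p) (hpq : p ≤ q)
    (R U : List (ℕ × ℕ))
    (hR : R = List.ofFn fun i => (r i, s i)) (hU : U = List.ofFn fun j => (u j, v j)) :
    LinkEquiv (TLink (R ++ dualTail p q U.reverse)) (TLink (U ++ dualTail q p R.reverse)) ∧
    LinkEquiv (VLink U R p q) (TLink (R ++ dualTail p q U.reverse)) ∧
    LinkEquiv (VLink U R p q) (TLink (U ++ dualTail q p R.reverse)) := by
  have hRmem : ∀ x ∈ R, 1 ≤ x.1 ∧ x.1 ≤ p := by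
    rw [hR, List.forall_mem_ofFn_iff]
    exact fun i => ⟨one_le_two.trans (hr_two i), (hr_lt i).le⟩
  have hUmem : ∀ x ∈ U, 1 ≤ x.1 ∧ x.1 ≤ p := by
    rw [hU, List.forall_mem_ofFn_iff]
    exact fun j => ⟨one_le_two.trans (hu_two j), hu_le j⟩
  have hRs : R.Pairwise fun x y => x.1 ≤ y.1 := by
    rw [hR, List.pairwise_ofFn]
    exact fun i j hij => (hr_mono hij).le
  have hUs : U.Pairwise fun x y => x.1 ≤ y.1 := by
    rw [hU, List.pairwise_ofFn]
    exact fun i j hij => (hu_mono hij).le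
  have h1 := vLink_linkEquiv_first hpq (fun x hx => (hRmem x hx).2) hUmem hUs
  have h2 := vLink_linkEquiv_second hp_pos hpq hRmem hUmem hRs
  exact ⟨h1.symm.trans h2, h1, h2⟩
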